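/- For an integer $y\ge 2$ let $\alpha_y(n)=1$ if every prime dividing $n$ is $>y$ and $\alpha_y(n)=0$ otherwise, and let $P_y=\prod_{p\le y}(1-1/p)$, the product running over primes. For integers $y,H\ge 2$ put $$M(H,y)=\prod_{2<p\le y}\Bigl(1-\frac2p\Bigr)\sum_{n\ge 1} g_y(n)\Bigl\{\frac{H}{2n}\Bigr\}\Bigl(1-\Bigl\{\frac{H}{2n}\Bigr\}\Bigr),$$ where $\{\cdot\}$ is the fractional part and $g_y$ is the multiplicative function supported on squarefree integers with $g_y(p)=\frac{p}{p-2}$ for primes $2<p\le y$ and $g_y(p)=0$ for all other primes. There is an absolute constant $C>0$ with the following property. Let $w:\mathbb R\to\mathbb R$ satisfy $w(x)\to\infty$ as $x\to\infty$, and let $\varepsilon,\delta>0$ be fixed. Let the integers $y,H,X$ run through sequences tending together to infinity, with $1<y\le X$ and $1<H\le X$, such that (from some point on) $$y\ge(\log H)^{1+\varepsilon}\qquad\text{and}\qquad \Bigl(1+\frac{\log\log H}{\log y}\Bigr)\frac{\log H}{\log\log H}\le(1-\delta)\frac{\log X}{\log y}.$$ Then for almost all real $x\in[0,X]$ one has $$\Bigl|\sum_{x<n\le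 x+H}\alpha_y(n)-H P_y\Bigr|\le C\,M(H,y)^{1/2}\,w(x),$$ that is, the Lebesgue measure of the set of $x\in[0,X]$ for which this inequality fails is $o(X)$ in the limit. (If $w$ is not measurable, outer Lebesgue measure is meant.) -/

import Mathlib

noncomputable section

namespace SiftedIntervals

open Classical in
/-- The indicator of the integers all of whose prime factors exceed `y`. -/
def alpha (y n : ℕ) : ℝ :=
  if ∀ p : ℕ, p.Prime → p ∣ n → y < p then 1 else 0

/-- The number of `y`-rough integers `n` with `x < n ≤ x + H` (meant for `0 ≤ x`, where
`x < n ≤ x + H` says the same as `⌊x⌋₊ < n ≤ ⌊x + H⌋₊`). -/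
def roughCount (y H : ℕ) (x : ℝ) : ℝ :=
  ∑ n ∈ Finset.Ioc ⌊x⌋₊ ⌊x + (H : ℝ)⌋₊, alpha y n

/-- The mean value of `alpha y`: the product of `1 - 1 / p` over the primes `p ≤ y`. -/
def P (y : ℕ) : ℝ :=
  ∏ p ∈ (Finset.Icc 1 y).filter Nat.Prime, (1 - 1 / (p : ℝ))

/-- The multiplicative function supported on squarefree integers whose value at a prime `p` is
`p / (p - 2)` if `2 < p ≤ y`, and `0` otherwise. -/
def g (y n : ℕ) : ℝ :=
  if Squarefree n then
    ∏ p ∈ n.primeFactors, (if 2 < p ∧ p ≤ y then (p : ℝ) / ((p : ℝ) - 2) else 0)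
  else 0

/-- The main term of the variance. The series has finitely many nonzero terms, and its term at
`n = 0` vanishes because `g y 0 = 0`. -/
def M (H y : ℕ) : ℝ :=
  (∏ p ∈ (Finset.Icc 3 y).filter Nat.Prime, (1 - 2 / (p : ℝ))) *
    ∑' n : ℕ, g y n *
      (Int.fract ((H : ℝ) / (2 * (n : ℝ))) * (1 - Int.fract ((H : ℝ) / (2 * (n : ℝ)))))

theorem g_zero (y : ℕ) : g y 0 = 0 := by
  simp [g]

theorem g_support_finite (y : ℕ) : (Function.support (g y)).Finite := by
  refine ((Finset.Icc 1 y).powerset.image fun s => ∏ p ∈ s, p).finite_toSet.subset ?_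
  intro n hn
  have hsq : Squarefree n := by
    by_contra h
    exact hn (by simp [g, h])
  have hp : ∀ p ∈ n.primeFactors, 2 < p ∧ p ≤ y := by
    intro p hp
    by_contra h
    refine hn ?_
    simp only [g, hsq, if_true]
    exact Finset.prod_eq_zero hp (by simp only [h, if_false])
  simp only [Finset.coe_image, Set.mem_image, Finset.mem_coe, Finset.mem_powerset]
  refine ⟨n.primeFactors, ?_, Nat.prod_primeFactors_of_squarefree hsq⟩
  intro p h
  have := hp p h
  exact Finset.mem_Icc.2 ⟨by omega, this.2⟩

/-- The series in the definition of `M` converges, being a finite sum. -/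
theorem summable_M (H y : ℕ) : Summable fun n : ℕ => g y n *
    (Int.fract ((H : ℝ) / (2 * (n : ℝ))) * (1 - Int.fract ((H : ℝ) / (2 * (n : ℝ))))) := by
  refine summable_of_hasFiniteSupport ((g_support_finite y).subset ?_)
  intro n hn h
  exact hn (by simp [h])

end SiftedIntervals

end

namespace SiftedIntervals
open Finset

/-! Since w tends to infinity and the count depends only on ⌊x⌋, Markov's inequality
(`volume_exceed_le`) reduces everything to a first moment: the sum over n ≤ X of |count after n − H
P| must be at most a constant times X √M (`eventually_sum_abs_le`).

Over a full period Q = ∏ p the variance of the count is exactly M (`fullVar_primesUpTo`): the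
Chinese remainder theorem gives the pair correlations, and counting congruent pairs gives the
fractional parts. But Q need not be small compared with X. The indicator is therefore expanded into
products of mean-zero fluctuations `kappa p` over sets t of primes, which are mutually orthogonal
over Q. Keeping only sets of small product leaves functions whose pairwise products have period at
most X. The large sieve `sum_range_le_mean` carries the mean of their square from a full period to
an initial range, at the cost of a constant, and by orthogonality the truncation only lowers that
mean (`sum_range_truncSum_sq_le`).

The truncation error is bounded in mean by an alternating cancellation followed by Rankin's trick
(`abs_rough_sub_trunc_le`). With u = log X / log y the primes are split at y^(1/K). The small ones
are truncated at X^η, with an error so tiny that no density factor is needed. The large ones are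
truncated at X^(1/2 − 2η), while the small primes stay as a sieve weight, so that their error
carries the full density P (`sum_rough_mul_divSum_le`); its relative size is about exp(−(u log
u)/2).

This must lie below √M. Products of about log H / log y primes from [y^(1−η), y] give M ≥ H P
exp(−(log H / log y) log log H − small) (`M_ge_exp`); the condition y ≥ (log H)^(1+ε) supplies
enough such primes. After squaring, what is needed is that u log u exceed Λ = log H + (log H / log
y) log log H by a constant factor, and the hypothesis on X says this, because log u is at least
nearly log log H (`mul_log_ge_of_condition`).

The small-prime error contains a power of log y, which must be absorbed by a power of H. When H <
(log y)^(1/4) this fails, but then H P ≤ 1 and the triangle inequality with an upper-bound sieve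
suffices (`sum_abs_le_of_short`). -/

/-! ### Periodic functions and a large sieve inequality -/

theorem sum_range_shift_of_periodic {A : Type*} [AddCommGroup A] {f : ℕ → A} {N : ℕ}
    (hf : Function.Periodic f N) (h : ℕ) :
    ∑ n ∈ range N, f (n + h) = ∑ n ∈ range N, f n := by
  induction h with
  | zero => simp
  | succ h ih =>
    rw [← ih]
    have h1 := Finset.sum_range_succ' (fun n => f (n + h)) N
    have h2 := Finset.sum_range_succ (fun n => f (n + h)) N
    rw [h2] at h1
    have h3 : f (N + h) = f (0 + h) := by
      rw [add_comm N h, zero_add]; exact hf h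
    rw [h3] at h1
    have := add_right_cancel h1
    rw [this]
    exact Finset.sum_congr rfl fun n _ => by congr 1; ring

theorem sum_range_mul_of_periodic {f : ℕ → ℝ} {N : ℕ} (hf : Function.Periodic f N) (k : ℕ) :
    ∑ n ∈ range (k * N), f n = k * ∑ n ∈ range N, f n := by
  induction k with
  | zero => simp
  | succ k ih =>
    rw [Nat.succ_mul, Finset.sum_range_add, ih]
    have : ∀ n, f (k * N + n) = f n := fun n => by
      rw [add_comm]; exact hf.nat_mul k n
    simp only [this]
    push_cast; ring

/-- A nontrivial character of large modulus is orthogonal to a function of small period. -/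
theorem sum_mul_pow_eq_zero {g : ℕ → ℂ} {m N : ℕ} (hg : Function.Periodic g m)
    (hm : m ∣ N) {ζ : ℂ} (hN : ζ ^ N = 1) (hζ : ζ ^ m ≠ 1) :
    ∑ n ∈ range N, g n * ζ ^ n = 0 := by
  have hper : Function.Periodic (fun n => g n * ζ ^ n) N := by
    intro n
    obtain ⟨k, rfl⟩ := hm
    have : g (n + m * k) = g n := by rw [mul_comm]; exact hg.nat_mul k n
    simp only [this, pow_add, hN, mul_one]
  -- Translation by m fixes the sum and also multiplies it by ζ ^ m ≠ 1.
  have h := sum_range_shift_of_periodic hper m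
  have h2 : ∑ n ∈ range N, g (n + m) * ζ ^ (n + m) =
      (∑ n ∈ range N, g n * ζ ^ n) * ζ ^ m := by
    rw [Finset.sum_mul]
    exact Finset.sum_congr rfl fun n _ => by rw [hg n, pow_add, mul_assoc]
  rw [h2] at h
  have h3 : (∑ n ∈ range N, g n * ζ ^ n) * (ζ ^ m - 1) = 0 := by
    rw [mul_sub, h]; ring
  rcases mul_eq_zero.1 h3 with h4 | h4
  · exact h4
  · exact absurd (sub_eq_zero.1 h4) hζ

open Complex in
theorem exp_pow_ne_one {N : ℕ} {l : ℤ} {m : ℕ} (hm : 0 < m) (hl : l ≠ 0)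
    (h : |l| * m < N) : (exp (2 * Real.pi * I / N) ^ l) ^ m ≠ 1 := by
  intro he
  have hN : N ≠ 0 := by
    rintro rfl
    have : 0 ≤ |l| * (m : ℤ) := by positivity
    simp at h; omega
  have hprim := isPrimitiveRoot_exp N hN
  rw [← zpow_natCast, ← zpow_mul, hprim.zpow_eq_one_iff_dvd] at he
  have h0 : l * m = 0 := by
    refine Int.eq_zero_of_abs_lt_dvd he ?_
    rw [abs_mul, Nat.abs_cast]; exact h
  rcases mul_eq_zero.1 h0 with h1 | h1
  · exact hl h1
  · omega

open Complex in
/-- A large sieve inequality for nonnegative functions made of functions of small period. -/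
theorem sum_range_le_mean {ι : Type*} (I : Finset ι) (G : ι → ℕ → ℝ) (m : ι → ℕ) {Q X : ℕ}
    (hQ : 0 < Q) (hX : 0 < X) (hper : ∀ i ∈ I, Function.Periodic (G i) (m i))
    (hm : ∀ i ∈ I, 0 < m i ∧ m i ∣ Q ∧ m i ≤ X)
    (hnn : ∀ n, 0 ≤ ∑ i ∈ I, G i n) :
    ∑ n ∈ range X, ∑ i ∈ I, G i n ≤ 24 * X * ((∑ n ∈ range Q, ∑ i ∈ I, G i n) / Q) := by
  set F : ℕ → ℝ := fun n => ∑ i ∈ I, G i n with hF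
  -- The factor 6 keeps the phases 2π j n / N at most π/3 for j < Q and n < X, so every cosine is at
  -- least 1/2. Also Q * m i ≤ N, so no nonzero frequency difference resonates with a period m i.
  set N := 6 * X * Q with hN
  have hNpos : 0 < N := by positivity
  set ζ : ℂ := exp (2 * Real.pi * Complex.I / N) with hζ
  have hζN : ζ ^ N = 1 := (isPrimitiveRoot_exp N hNpos.ne').pow_eq_one
  have hζ0 : ζ ≠ 0 := exp_ne_zero _
  set K : ℕ → ℂ := fun n => ∑ j ∈ range Q, (ζ ^ j) ^ n with hK
  have hζnorm : ‖ζ‖ = 1 := (isPrimitiveRoot_exp N hNpos.ne').norm'_eq_one hNpos.ne'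
  have hconj : (starRingEnd ℂ) ζ = ζ⁻¹ := (Complex.inv_eq_conj hζnorm).symm
  have hFper : Function.Periodic F Q := by
    intro n
    refine Finset.sum_congr rfl fun i hi => ?_
    obtain ⟨k, hk⟩ := (hm i hi).2.1
    rw [hk, mul_comm]
    exact (hper i hi).nat_mul k n
  -- the weighted sum
  have hexp : ∀ n, ((‖K n‖ ^ 2 : ℝ) : ℂ) =
      ∑ j ∈ range Q, ∑ j' ∈ range Q, (ζ ^ ((j : ℤ) - j')) ^ n := by
    intro n
    rw [← Complex.normSq_eq_norm_sq, Complex.normSq_eq_conj_mul_self, hK]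
    simp only [map_sum, map_pow, hconj]
    rw [Finset.sum_mul_sum, Finset.sum_comm]
    refine Finset.sum_congr rfl fun j _ => Finset.sum_congr rfl fun j' _ => ?_
    rw [zpow_sub₀ hζ0, zpow_natCast, zpow_natCast, inv_pow, div_eq_inv_mul, mul_pow]
  -- After expanding |K|² only the diagonal survives: a nonzero frequency below Q is orthogonal to
  -- each `G i`.
  have hweight : ∑ n ∈ range N, F n * ‖K n‖ ^ 2 = Q * ∑ n ∈ range N, F n := by
    have : ((∑ n ∈ range N, F n * ‖K n‖ ^ 2 : ℝ) : ℂ) = ((Q * ∑ n ∈ range N, F n : ℝ) : ℂ) := by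
      push_cast
      have h1 : ∀ n, (F n : ℂ) * (‖K n‖ : ℂ) ^ 2 =
          ∑ j ∈ range Q, ∑ j' ∈ range Q, (F n : ℂ) * (ζ ^ ((j : ℤ) - j')) ^ n := by
        intro n
        have := hexp n
        push_cast at this
        rw [this, Finset.mul_sum]
        exact Finset.sum_congr rfl fun j _ => Finset.mul_sum _ _ _
      simp only [h1]
      rw [Finset.sum_comm]
      have h2 : ∀ j ∈ range Q, ∑ n ∈ range N, ∑ j' ∈ range Q,
          (F n : ℂ) * (ζ ^ ((j : ℤ) - j')) ^ n = ∑ n ∈ range N, (F n : ℂ) := by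
        intro j hj
        rw [Finset.sum_comm, Finset.sum_eq_single_of_mem j hj]
        · simp
        · intro j' hj' hne
          have hl : (j : ℤ) - j' ≠ 0 := by omega
          have habs : |(j : ℤ) - j'| < Q := by
            rw [Finset.mem_range] at hj hj'
            rw [abs_lt]; omega
          simp only [hF]
          push_cast
          simp only [Finset.sum_mul]
          rw [Finset.sum_comm]
          refine Finset.sum_eq_zero fun i hi => ?_
          obtain ⟨hm0, hmQ, hmX⟩ := hm i hi
          refine sum_mul_pow_eq_zero (g := fun n => (G i n : ℂ)) (m := m i) ?_ ?_ ?_ ?_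
          · intro n; simp only [hper i hi n]
          · exact hmQ.mul_left _
          · rw [← zpow_natCast, ← zpow_mul, mul_comm, zpow_mul, zpow_natCast, hζN, one_zpow]
          · refine exp_pow_ne_one hm0 hl ?_
            have h3 : |(j : ℤ) - j'| * (m i) < Q * (m i) :=
              mul_lt_mul_of_pos_right habs (by exact_mod_cast hm0)
            have h4 : (Q : ℤ) * (m i) ≤ N := by
              have : Q * m i ≤ N := by rw [hN]; nlinarith
              exact_mod_cast this
            exact lt_of_lt_of_le h3 h4
      rw [Finset.sum_congr rfl h2]
      simp
    exact_mod_cast this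
  -- lower bound for the weight
  have hlow : ∀ n ∈ range X, (Q : ℝ) ^ 2 / 4 ≤ ‖K n‖ ^ 2 := by
    intro n hn
    have hre : (Q : ℝ) / 2 ≤ (K n).re := by
      simp only [hK, Complex.re_sum]
      have : (Q : ℝ) / 2 = ∑ j ∈ range Q, (1 / 2 : ℝ) := by simp; ring
      rw [this]
      refine Finset.sum_le_sum fun j hj => ?_
      have h1 : (ζ ^ j) ^ n = exp (((2 * Real.pi * (j * n) / N : ℝ) : ℂ) * Complex.I) := by
        rw [hζ, ← Complex.exp_nat_mul, ← Complex.exp_nat_mul]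
        congr 1
        push_cast
        ring
      rw [h1, Complex.exp_ofReal_mul_I_re, ← Real.cos_pi_div_three]
      have hjn : (j * n : ℝ) / N ≤ 1 / 6 := by
        rw [div_le_div_iff₀ (by exact_mod_cast hNpos) (by norm_num)]
        rw [Finset.mem_range] at hj hn
        have : j * n * 6 ≤ 1 * N := by
          rw [hN]
          have := Nat.mul_le_mul hj.le hn.le
          nlinarith
        exact_mod_cast this
      have hjn0 : 0 ≤ (j * n : ℝ) / N := by positivity
      have heq : 2 * Real.pi * (j * n) / N = 2 * Real.pi * ((j * n : ℝ) / N) := by ring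
      rw [heq]
      refine Real.cos_le_cos_of_nonneg_of_le_pi (by positivity) ?_ ?_
      · linarith [Real.pi_pos]
      · nlinarith [Real.pi_pos]
    have h2 : (Q : ℝ) / 2 ≤ ‖K n‖ := hre.trans (Complex.re_le_norm _)
    have h3 : ((Q : ℝ) / 2) ^ 2 ≤ ‖K n‖ ^ 2 := by gcongr
    calc (Q : ℝ) ^ 2 / 4 = ((Q : ℝ) / 2) ^ 2 := by ring
      _ ≤ _ := h3
  have hXN : X ≤ N := by rw [hN]; nlinarith
  have h1 : (Q : ℝ) ^ 2 / 4 * ∑ n ∈ range X, F n ≤ ∑ n ∈ range N, F n * ‖K n‖ ^ 2 := by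
    rw [Finset.mul_sum]
    calc ∑ n ∈ range X, (Q : ℝ) ^ 2 / 4 * F n ≤ ∑ n ∈ range X, F n * ‖K n‖ ^ 2 :=
          Finset.sum_le_sum fun n hn => by
            rw [mul_comm]; exact mul_le_mul_of_nonneg_left (hlow n hn) (hnn n)
      _ ≤ _ := Finset.sum_le_sum_of_subset_of_nonneg
          (Finset.range_subset_range.2 hXN)
          fun n _ _ => mul_nonneg (hnn n) (by positivity)
  rw [hweight, hN, sum_range_mul_of_periodic hFper] at h1
  have hQ' : (0 : ℝ) < Q := by exact_mod_cast hQ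
  push_cast at h1
  have h5 : ∑ n ∈ range X, F n ≤ (Q * (6 * X * ∑ n ∈ range Q, F n)) / ((Q : ℝ) ^ 2 / 4) := by
    rw [le_div_iff₀ (by positivity)]; linarith
  refine h5.trans (le_of_eq ?_)
  field_simp
  ring


/-! ### Orthogonal expansion of the indicator of rough integers -/

/-- The fluctuation of the indicator of `p ∤ n`, scaled by its mean. -/
noncomputable def kappa (p n : ℕ) : ℝ := if p ∣ n then -1 else 1 / ((p : ℝ) - 1)

/-- The density of the integers that are free of prime factors in `s`. -/
noncomputable def dens (s : Finset ℕ) : ℝ := ∏ p ∈ s, (1 - 1 / (p : ℝ))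

/-- The indicator of the integers that are free of prime factors in `s`. -/
noncomputable def rough (s : Finset ℕ) (n : ℕ) : ℝ := ∏ p ∈ s, if p ∣ n then 0 else 1

theorem kappa_periodic (p : ℕ) : Function.Periodic (kappa p) p := by
  intro n
  simp [kappa]

theorem sum_mul_of_coprime {a b : ℕ → ℝ} {m k : ℕ} (ha : Function.Periodic a m)
    (hb : Function.Periodic b k) (h : m.Coprime k) (hm : 0 < m) (hk : 0 < k) :
    ∑ n ∈ range (m * k), a n * b n = (∑ n ∈ range m, a n) * ∑ n ∈ range k, b n := by
  rw [Finset.sum_mul_sum, ← Finset.sum_product']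
  refine Finset.sum_bij' (fun n _ => (n % m, n % k))
    (fun x _ => (Nat.chineseRemainder h x.1 x.2 : ℕ)) ?_ ?_ ?_ ?_ ?_
  · intro n _
    simp only [mem_product, mem_range]
    exact ⟨Nat.mod_lt _ hm, Nat.mod_lt _ hk⟩
  · intro x _
    exact mem_range.2 (Nat.chineseRemainder_lt_mul h _ _ hm.ne' hk.ne')
  · intro n hn
    have h1 := (Nat.chineseRemainder h (n % m) (n % k)).2
    have h2 : (Nat.chineseRemainder h (n % m) (n % k) : ℕ) ≡ n [MOD m * k] :=
      (Nat.modEq_and_modEq_iff_modEq_mul h).1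
        ⟨h1.1.trans (Nat.mod_modEq _ _), h1.2.trans (Nat.mod_modEq _ _)⟩
    exact Nat.ModEq.eq_of_lt_of_lt h2 (Nat.chineseRemainder_lt_mul h _ _ hm.ne' hk.ne')
      (mem_range.1 hn)
  · rintro ⟨i, j⟩ hx
    simp only [mem_product, mem_range] at hx
    have h1 := (Nat.chineseRemainder h i j).2
    ext
    · exact (Nat.mod_eq_of_modEq h1.1 hx.1)
    · exact (Nat.mod_eq_of_modEq h1.2 hx.2)
  · intro n _
    simp only [ha.map_mod_nat, hb.map_mod_nat]

theorem prod_periodic {s : Finset ℕ} {f : ℕ → ℕ → ℝ}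
    (hf : ∀ p ∈ s, Function.Periodic (f p) p) :
    Function.Periodic (fun n => ∏ p ∈ s, f p n) (∏ p ∈ s, p) := by
  intro n
  refine Finset.prod_congr rfl fun p hp => ?_
  obtain ⟨k, hk⟩ := Finset.dvd_prod_of_mem (fun p => p) hp
  rw [hk, mul_comm]
  exact (hf p hp).nat_mul k n

/-- The Chinese remainder theorem for the mean of a product. -/
theorem sum_prod_eq_prod_sum {s : Finset ℕ} (hs : ∀ p ∈ s, p.Prime) {f : ℕ → ℕ → ℝ}
    (hf : ∀ p ∈ s, Function.Periodic (f p) p) :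
    ∑ n ∈ range (∏ p ∈ s, p), ∏ p ∈ s, f p n = ∏ p ∈ s, ∑ a ∈ range p, f p a := by
  induction s using Finset.induction_on with
  | empty => simp
  | insert q s hq ih =>
    have hs' : ∀ p ∈ s, p.Prime := fun p hp => hs p (mem_insert_of_mem hp)
    have hf' : ∀ p ∈ s, Function.Periodic (f p) p := fun p hp => hf p (mem_insert_of_mem hp)
    simp only [Finset.prod_insert hq]
    rw [← ih hs' hf']
    refine sum_mul_of_coprime (hf q (mem_insert_self _ _)) (prod_periodic hf') ?_
      (hs q (mem_insert_self _ _)).pos (Finset.prod_pos fun p hp => (hs' p hp).pos)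
    refine Nat.Coprime.prod_right fun p hp => ?_
    refine (Nat.coprime_primes (hs q (mem_insert_self _ _)) (hs' p hp)).2 ?_
    rintro rfl; exact hq hp

theorem sum_ite_dvd_range {p : ℕ} (hp : 0 < p) (a b : ℝ) :
    ∑ n ∈ range p, (if p ∣ n then a else b) = a + (p - 1) * b := by
  obtain ⟨k, rfl⟩ : ∃ k, p = k + 1 := ⟨p - 1, by omega⟩
  rw [Finset.sum_range_succ']
  have : ∀ i ∈ range k, (if k + 1 ∣ i + 1 then a else b) = b := by
    intro i hi
    rw [mem_range] at hi
    rw [if_neg]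
    intro h
    have := Nat.le_of_dvd (by omega) h
    omega
  rw [Finset.sum_congr rfl this]
  simp; ring

theorem sum_kappa_shift {p : ℕ} (hp : p.Prime) (h : ℕ) :
    ∑ n ∈ range p, kappa p (n + h) = 0 := by
  rw [sum_range_shift_of_periodic (kappa_periodic p)]
  unfold kappa
  rw [sum_ite_dvd_range hp.pos]
  have : (1 : ℝ) < p := by exact_mod_cast hp.one_lt
  have : (p : ℝ) - 1 ≠ 0 := by linarith
  field_simp
  ring

/-- Factoring the density out at each prime leaves 1 plus a function of mean zero, so expanding the
product over primes gives an orthogonal expansion. -/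
theorem one_sub_mul_one_add_kappa {p : ℕ} (hp : p.Prime) (n : ℕ) :
    (1 - 1 / (p : ℝ)) * (1 + kappa p n) = if p ∣ n then 0 else 1 := by
  have : (1 : ℝ) < p := by exact_mod_cast hp.one_lt
  have h2 : (p : ℝ) - 1 ≠ 0 := by linarith
  unfold kappa
  split_ifs
  · simp
  · field_simp
    ring

theorem rough_eq_sum_kappa {s : Finset ℕ} (hs : ∀ p ∈ s, p.Prime) (n : ℕ) :
    rough s n = dens s * ∑ t ∈ s.powerset, ∏ p ∈ t, kappa p n := by
  rw [← Finset.prod_one_add, dens, rough, ← Finset.prod_mul_distrib]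
  exact Finset.prod_congr rfl fun p hp => (one_sub_mul_one_add_kappa (hs p hp) n).symm

/-- Distinct products of fluctuations are orthogonal. -/
theorem sum_kappa_mul_kappa_eq_zero {s t t' : Finset ℕ} (hs : ∀ p ∈ s, p.Prime)
    (ht : t ⊆ s) (ht' : t' ⊆ s) (hne : t ≠ t') (h h' : ℕ) :
    ∑ n ∈ range (∏ p ∈ s, p), (∏ p ∈ t, kappa p (n + h)) * ∏ p ∈ t', kappa p (n + h') = 0 := by
  classical
  have key : ∀ n, (∏ p ∈ t, kappa p (n + h)) * ∏ p ∈ t', kappa p (n + h') =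
      ∏ p ∈ s, ((if p ∈ t then kappa p (n + h) else 1) *
        (if p ∈ t' then kappa p (n + h') else 1)) := by
    intro n
    rw [Finset.prod_mul_distrib, Finset.prod_ite_mem, Finset.prod_ite_mem,
      Finset.inter_eq_right.2 ht, Finset.inter_eq_right.2 ht']
  simp only [key]
  rw [sum_prod_eq_prod_sum hs (f := fun p n => (if p ∈ t then kappa p (n + h) else 1) *
        (if p ∈ t' then kappa p (n + h') else 1))]
  -- A prime lying in exactly one of the two sets contributes a factor of sum zero.
  · obtain ⟨p, hp⟩ : ∃ p, ¬ (p ∈ t ↔ p ∈ t') := by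
      by_contra hcon
      push Not at hcon
      exact hne (Finset.ext hcon)
    by_cases h1 : p ∈ t
    · have h2 : p ∉ t' := fun h2 => hp (by simp [h1, h2])
      refine Finset.prod_eq_zero (ht h1) ?_
      simp only [h1, h2, if_true, if_false, mul_one]
      exact sum_kappa_shift (hs p (ht h1)) h
    · have h2 : p ∈ t' := by
        by_contra h2; exact hp (by simp [h1, h2])
      refine Finset.prod_eq_zero (ht' h2) ?_
      simp only [h1, h2, if_true, if_false, one_mul]
      exact sum_kappa_shift (hs p (ht' h2)) h'
  · intro p _ n
    have e1 : kappa p (n + p + h) = kappa p (n + h) := by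
      rw [add_right_comm]; exact kappa_periodic p _
    have e2 : kappa p (n + p + h') = kappa p (n + h') := by
      rw [add_right_comm]; exact kappa_periodic p _
    simp only [e1, e2]

/-- The contribution of a set of primes to the count in the interval after `n`. -/
noncomputable def kappaSum (H : ℕ) (t : Finset ℕ) (n : ℕ) : ℝ :=
  ∑ h ∈ Icc 1 H, ∏ p ∈ t, kappa p (n + h)

theorem kappaSum_empty (H n : ℕ) : kappaSum H ∅ n = H := by
  simp [kappaSum]

theorem kappaSum_periodic (H : ℕ) (t : Finset ℕ) :
    Function.Periodic (kappaSum H t) (∏ p ∈ t, p) := by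
  intro n
  refine Finset.sum_congr rfl fun h _ => ?_
  rw [add_right_comm]
  exact prod_periodic (fun p _ => kappa_periodic p) _

theorem sum_kappaSum_mul_eq_zero {s t t' : Finset ℕ} (hs : ∀ p ∈ s, p.Prime)
    (ht : t ⊆ s) (ht' : t' ⊆ s) (hne : t ≠ t') (H : ℕ) :
    ∑ n ∈ range (∏ p ∈ s, p), kappaSum H t n * kappaSum H t' n = 0 := by
  unfold kappaSum
  simp only [Finset.sum_mul_sum]
  rw [Finset.sum_comm]
  refine Finset.sum_eq_zero fun h _ => ?_
  rw [Finset.sum_comm]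
  exact Finset.sum_eq_zero fun h' _ => sum_kappa_mul_kappa_eq_zero hs ht ht' hne h h'

/-- Parseval's identity: the terms for different t are orthogonal, so enlarging the family can only
increase the mean square. -/
theorem sum_sq_sum_kappaSum {s : Finset ℕ} (hs : ∀ p ∈ s, p.Prime) (H : ℕ)
    (D : Finset (Finset ℕ)) (hD : D ⊆ s.powerset) :
    ∑ n ∈ range (∏ p ∈ s, p), (∑ t ∈ D, kappaSum H t n) ^ 2 =
      ∑ t ∈ D, ∑ n ∈ range (∏ p ∈ s, p), kappaSum H t n ^ 2 := by
  simp only [sq, Finset.sum_mul_sum]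
  rw [Finset.sum_comm]
  refine Finset.sum_congr rfl fun t ht => ?_
  rw [Finset.sum_comm, Finset.sum_eq_single_of_mem t ht]
  intro t' ht' hne
  exact sum_kappaSum_mul_eq_zero hs (mem_powerset.1 (hD ht)) (mem_powerset.1 (hD ht')) hne.symm H

/-! ### The truncated variance on an initial range -/

/-- The variance over a full period of the count of integers without prime factors in `s`. -/
noncomputable def fullVar (s : Finset ℕ) (H : ℕ) : ℝ :=
  (∑ n ∈ range (∏ p ∈ s, p), (∑ h ∈ Icc 1 H, rough s (n + h) - H * dens s) ^ 2) /
    (∏ p ∈ s, p : ℕ)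

theorem sum_rough_sub_eq {s : Finset ℕ} (hs : ∀ p ∈ s, p.Prime) (H n : ℕ) :
    ∑ h ∈ Icc 1 H, rough s (n + h) - H * dens s =
      dens s * ∑ t ∈ s.powerset.erase ∅, kappaSum H t n := by
  have h1 : ∑ h ∈ Icc 1 H, rough s (n + h) = dens s * ∑ t ∈ s.powerset, kappaSum H t n := by
    simp only [rough_eq_sum_kappa hs, ← Finset.mul_sum]
    rw [Finset.sum_comm]
    rfl
  rw [h1, ← Finset.add_sum_erase _ _ (Finset.empty_mem_powerset s), kappaSum_empty]
  ring

/-- The truncation of the count to a family of sets of primes. -/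
noncomputable def truncSum (s : Finset ℕ) (D : Finset (Finset ℕ)) (H n : ℕ) : ℝ :=
  dens s * ∑ t ∈ D, kappaSum H t n

/-- The square of the truncated fluctuation is nonnegative and made of pieces of period at most X,
so the large sieve compares its sum over n < X with its full-period mean; Parseval then restores the
omitted sets. -/
theorem sum_range_truncSum_sq_le {s : Finset ℕ} (hs : ∀ p ∈ s, p.Prime)
    (D : Finset (Finset ℕ)) (hD : D ⊆ s.powerset) (hempty : ∅ ∈ D) (H : ℕ) {X : ℕ} (hX : 0 < X)
    (hDX : ∀ t ∈ D, ∀ t' ∈ D, (∏ p ∈ t, p) * ∏ p ∈ t', p ≤ X) :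
    ∑ n ∈ range X, (truncSum s D H n - H * dens s) ^ 2 ≤ 24 * X * fullVar s H := by
  have hpos : ∀ t ∈ D, 0 < ∏ p ∈ t, p := fun t ht =>
    Finset.prod_pos fun p hp => (hs p (mem_powerset.1 (hD ht) hp)).pos
  have hQ : 0 < ∏ p ∈ s, p := Finset.prod_pos fun p hp => (hs p hp).pos
  set D' := D.erase ∅ with hD'
  have hD's : D' ⊆ D := Finset.erase_subset _ _
  have h1 : ∀ n, truncSum s D H n - H * dens s = dens s * ∑ t ∈ D', kappaSum H t n := by
    intro n
    rw [truncSum, ← Finset.add_sum_erase _ _ hempty, kappaSum_empty]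
    ring
  have h2 : ∀ n, (truncSum s D H n - H * dens s) ^ 2 =
      ∑ x ∈ D' ×ˢ D', dens s ^ 2 * (kappaSum H x.1 n * kappaSum H x.2 n) := by
    intro n
    rw [h1, mul_pow, ← Finset.mul_sum, Finset.sum_product, sq (∑ t ∈ D', _), Finset.sum_mul_sum]
  have hlcm : ∀ t ∈ D, ∀ t' ∈ D, Nat.lcm (∏ p ∈ t, p) (∏ p ∈ t', p) ∣ ∏ p ∈ s, p := by
    intro t ht t' ht'
    exact Nat.lcm_dvd (Finset.prod_dvd_prod_of_subset _ _ _ (mem_powerset.1 (hD ht)))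
      (Finset.prod_dvd_prod_of_subset _ _ _ (mem_powerset.1 (hD ht')))
  -- The square is opened into pairs: each pair has the lcm of its two moduli as a period, and `hDX`
  -- keeps that at most X.
  have h3 := sum_range_le_mean (D' ×ˢ D')
    (fun x n => dens s ^ 2 * (kappaSum H x.1 n * kappaSum H x.2 n))
    (fun x => Nat.lcm (∏ p ∈ x.1, p) (∏ p ∈ x.2, p)) hQ hX ?_ ?_ ?_
  · simp only [← h2] at h3
    refine h3.trans ?_
    refine mul_le_mul_of_nonneg_left ?_ (by positivity)
    refine div_le_div_of_nonneg_right ?_ (by positivity)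
    simp only [h1, sum_rough_sub_eq hs, mul_pow, ← Finset.mul_sum]
    refine mul_le_mul_of_nonneg_left ?_ (by positivity)
    rw [sum_sq_sum_kappaSum hs H D' (hD's.trans hD),
      sum_sq_sum_kappaSum hs H _ (Finset.erase_subset _ _)]
    refine Finset.sum_le_sum_of_subset_of_nonneg (Finset.erase_subset_erase _ hD) ?_
    intro t _ _
    positivity
  · rintro ⟨t, t'⟩ _ n
    obtain ⟨k, hk⟩ := Nat.dvd_lcm_left (∏ p ∈ t, p) (∏ p ∈ t', p)
    obtain ⟨k', hk'⟩ := Nat.dvd_lcm_right (∏ p ∈ t, p) (∏ p ∈ t', p)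
    have e1 : kappaSum H t (n + Nat.lcm (∏ p ∈ t, p) (∏ p ∈ t', p)) = kappaSum H t n := by
      rw [hk, mul_comm]; exact (kappaSum_periodic H t).nat_mul k n
    have e2 : kappaSum H t' (n + Nat.lcm (∏ p ∈ t, p) (∏ p ∈ t', p)) = kappaSum H t' n := by
      rw [hk', mul_comm]; exact (kappaSum_periodic H t').nat_mul k' n
    simp only [e1, e2]
  · rintro ⟨t, t'⟩ hx
    rw [mem_product] at hx
    have ht := hD's hx.1
    have ht' := hD's hx.2
    refine ⟨Nat.lcm_pos (hpos _ ht) (hpos _ ht'), hlcm _ ht _ ht', ?_⟩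
    refine (Nat.le_of_dvd (Nat.mul_pos (hpos _ ht) (hpos _ ht')) (Nat.lcm_dvd_mul _ _)).trans ?_
    exact hDX _ ht _ ht'
  · intro n
    rw [← h2]; positivity


/-! ### The full-period variance equals the main term -/

/-- The primes up to `y`. -/
def primesUpTo (y : ℕ) : Finset ℕ := (Icc 1 y).filter Nat.Prime

theorem mem_primesUpTo {y p : ℕ} : p ∈ primesUpTo y ↔ p.Prime ∧ p ≤ y := by
  simp only [primesUpTo, mem_filter, mem_Icc]
  exact ⟨fun h => ⟨h.2, h.1.2⟩, fun h => ⟨⟨h.1.one_lt.le, h.2⟩, h.1⟩⟩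

theorem prime_of_mem_primesUpTo {y : ℕ} : ∀ p ∈ primesUpTo y, p.Prime :=
  fun _ hp => (mem_primesUpTo.1 hp).1

theorem dens_primesUpTo (y : ℕ) : dens (primesUpTo y) = P y := rfl

/-- The odd primes up to `y`. -/
def oddPrimesUpTo (y : ℕ) : Finset ℕ := (Icc 3 y).filter Nat.Prime

theorem mem_oddPrimesUpTo {y p : ℕ} : p ∈ oddPrimesUpTo y ↔ p.Prime ∧ 2 < p ∧ p ≤ y := by
  simp only [oddPrimesUpTo, mem_filter, mem_Icc]
  exact ⟨fun h => ⟨h.2, by omega, h.1.2⟩, fun h => ⟨⟨by omega, h.2.2⟩, h.1⟩⟩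

theorem two_notMem_oddPrimesUpTo (y : ℕ) : 2 ∉ oddPrimesUpTo y := by
  intro h
  have := (mem_oddPrimesUpTo.1 h).2.1
  omega

theorem primesUpTo_eq_insert {y : ℕ} (hy : 2 ≤ y) :
    primesUpTo y = insert 2 (oddPrimesUpTo y) := by
  ext p
  simp only [mem_insert, mem_primesUpTo, mem_oddPrimesUpTo]
  constructor
  · rintro ⟨h1, h2⟩
    have := h1.two_le
    by_cases h : p = 2
    · exact Or.inl h
    · exact Or.inr ⟨h1, by omega, h2⟩
  · rintro (rfl | ⟨h1, _, h2⟩)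
    · exact ⟨Nat.prime_two, hy⟩
    · exact ⟨h1, h2⟩

theorem oddPrimesUpTo_prime {y : ℕ} : ∀ p ∈ oddPrimesUpTo y, p.Prime :=
  fun _ hp => (mem_oddPrimesUpTo.1 hp).1

/-- The summand of the variance, as a function of a modulus. -/
noncomputable def fracTerm (H : ℕ) (m : ℝ) : ℝ :=
  Int.fract ((H : ℝ) / m) * (1 - Int.fract ((H : ℝ) / m))

theorem fracTerm_nonneg (H : ℕ) (m : ℝ) : 0 ≤ fracTerm H m :=
  mul_nonneg (Int.fract_nonneg _) (by linarith [Int.fract_lt_one ((H : ℝ) / m)])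

theorem prod_injOn_primes {s : Finset ℕ} (hs : ∀ p ∈ s, p.Prime) :
    Set.InjOn (fun t : Finset ℕ => ∏ p ∈ t, p) (s.powerset : Set (Finset ℕ)) := by
  intro t ht t' ht' h
  have ht := Finset.mem_powerset.1 (Finset.mem_coe.1 ht)
  have ht' := Finset.mem_powerset.1 (Finset.mem_coe.1 ht')
  have h := congrArg Nat.primeFactors h
  simp only at h
  rwa [Nat.primeFactors_prod fun p hp => hs p (ht hp),
    Nat.primeFactors_prod fun p hp => hs p (ht' hp)] at h

theorem squarefree_prod_primes {t : Finset ℕ} (ht : ∀ p ∈ t, p.Prime) :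
    Squarefree (∏ p ∈ t, p) := by
  refine Finset.squarefree_prod_of_pairwise_isCoprime ?_ fun p hp => (ht p hp).squarefree
  intro p hp q hq hne
  exact Nat.coprime_iff_isRelPrime.1 ((Nat.coprime_primes (ht p hp) (ht q hq)).2 hne)

theorem M_eq_sum (H y : ℕ) : M H y = (∏ p ∈ oddPrimesUpTo y, (1 - 2 / (p : ℝ))) *
    ∑ t ∈ (oddPrimesUpTo y).powerset, (∏ p ∈ t, (p : ℝ) / ((p : ℝ) - 2)) *
      fracTerm H (2 * (∏ p ∈ t, p : ℕ)) := by
  unfold M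
  congr 1
  have hinj := prod_injOn_primes (oddPrimesUpTo_prime (y := y))
  rw [tsum_eq_sum (s := (oddPrimesUpTo y).powerset.image fun t => ∏ p ∈ t, p),
    Finset.sum_image hinj]
  · refine Finset.sum_congr rfl fun t ht => ?_
    have ht := mem_powerset.1 ht
    have hp : ∀ p ∈ t, p.Prime := fun p h => oddPrimesUpTo_prime p (ht h)
    have : g y (∏ p ∈ t, p) = ∏ p ∈ t, (p : ℝ) / ((p : ℝ) - 2) := by
      rw [g, if_pos (squarefree_prod_primes hp), Nat.primeFactors_prod hp]
      exact Finset.prod_congr rfl fun p h => if_pos (mem_oddPrimesUpTo.1 (ht h)).2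
    rw [this]
    rfl
  · intro n hn
    have : g y n = 0 := by
      by_contra h
      refine hn (mem_image.2 ⟨n.primeFactors, ?_, ?_⟩)
      · rw [mem_powerset]
        intro p hp
        rw [mem_oddPrimesUpTo]
        refine ⟨Nat.prime_of_mem_primeFactors hp, ?_⟩
        by_contra hcon
        refine h ?_
        unfold g
        split_ifs
        · exact Finset.prod_eq_zero hp (if_neg hcon)
        · rfl
      · refine Nat.prod_primeFactors_of_squarefree ?_
        by_contra hcon
        exact h (by simp [g, hcon])
    rw [this, zero_mul]

theorem card_filter_modEq_succ (H : ℕ) {m : ℕ} :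
    ((Icc 1 H).filter fun h => h ≡ H + 1 [MOD m]).card = H / m := by
  rw [← Nat.Ioc_filter_dvd_card_eq_div]
  -- Reflection in H + 1 turns the congruence into divisibility.
  refine Finset.card_bij' (fun h _ => H + 1 - h) (fun h _ => H + 1 - h) ?_ ?_ ?_ ?_
  · intro h hh
    simp only [mem_filter, mem_Icc, mem_Ioc] at hh ⊢
    exact ⟨by omega, (Nat.modEq_iff_dvd' (by omega)).1 hh.2⟩
  · intro h hh
    simp only [mem_filter, mem_Icc, mem_Ioc] at hh ⊢
    refine ⟨by omega, (Nat.modEq_iff_dvd' (by omega)).2 ?_⟩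
    have : H + 1 - (H + 1 - h) = h := by omega
    rw [this]; exact hh.2
  · intro h hh
    simp only [mem_filter, mem_Icc] at hh
    omega
  · intro h hh
    simp only [mem_filter, mem_Ioc] at hh
    omega

/-- The number of pairs of congruent integers in an initial interval. -/
theorem sum_modEq_nat (H : ℕ) {m : ℕ} (hm : 0 < m) :
    ∑ h ∈ Icc 1 H, ∑ h' ∈ Icc 1 H, (if h ≡ h' [MOD m] then 1 else 0) =
      m * (H / m) ^ 2 + 2 * (H % m) * (H / m) + H % m := by
  induction H with
  | zero => simp
  | succ H ih =>
    have hsplit : ∀ f : ℕ → ℕ, ∑ h ∈ Icc 1 (H + 1), f h = ∑ h ∈ Icc 1 H, f h + f (H + 1) :=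
      fun f => Finset.sum_Icc_succ_top (by omega) f
    have h1 : ∑ h ∈ Icc 1 H, (if h ≡ H + 1 [MOD m] then 1 else 0) = H / m := by
      rw [← Finset.card_filter, card_filter_modEq_succ]
    have h2 : ∑ h ∈ Icc 1 H, (if H + 1 ≡ h [MOD m] then 1 else 0) = H / m := by
      rw [← h1]
      exact Finset.sum_congr rfl fun h _ => by simp only [Nat.ModEq.comm]
    rw [hsplit, hsplit]
    simp only [hsplit, Finset.sum_add_distrib]
    rw [ih, h1, h2, if_pos (Nat.ModEq.refl _)]
    have hlt := Nat.mod_lt H hm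
    have hdm := Nat.div_add_mod H m
    set q := H / m
    set r := H % m
    by_cases hr : r + 1 < m
    · have e1 : (H + 1) / m = q := by
        rw [Nat.div_eq_iff hm, ← hdm]
        constructor
        · nlinarith
        · have : q * m = m * q := mul_comm _ _
          omega
      have e2 : (H + 1) % m = r + 1 := by
        have := Nat.div_add_mod (H + 1) m
        rw [e1] at this
        omega
      rw [e1, e2]; ring
    · have hr' : r + 1 = m := by omega
      have e0 : H + 1 = m * (q + 1) := by rw [← hdm, mul_add, mul_one]; omega
      rw [e0, Nat.mul_div_cancel_left _ hm, Nat.mul_mod_right, ← hr']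
      ring

/-- With H = m q + r, the excess of m q² + 2 q r + r over H² / m is r (m − r) / m. This is the
source of the fractional parts in `M`. -/
theorem sum_modEq (H : ℕ) {m : ℕ} (hm : 0 < m) :
    ∑ h ∈ Icc 1 H, ∑ h' ∈ Icc 1 H, (if h ≡ h' [MOD m] then (1 : ℝ) else 0) =
      (H : ℝ) ^ 2 / m + m * fracTerm H m := by
  have h1 := congrArg (fun n : ℕ => (n : ℝ)) (sum_modEq_nat H hm)
  simp only [Nat.cast_sum, Nat.cast_ite, Nat.cast_one, Nat.cast_zero] at h1
  rw [h1, fracTerm]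
  have h2 : Int.fract ((H : ℝ) / m) = (H % m : ℕ) / (m : ℝ) := by
    rw [Int.fract_div_natCast_eq_div_natCast_mod]
  have h3 : (H : ℝ) = m * (H / m : ℕ) + (H % m : ℕ) := by
    exact_mod_cast (Nat.div_add_mod H m).symm
  have hm' : (m : ℝ) ≠ 0 := by positivity
  rw [h2]
  push_cast
  generalize ((H / m : ℕ) : ℝ) = q at *
  generalize ((H % m : ℕ) : ℝ) = r at *
  rw [h3]
  field_simp
  ring

/-- Each of the two conditions excludes one residue class, and the two classes coincide exactly when
h and h' are congruent. -/
theorem sum_range_coprime_pair {p : ℕ} (hp : 0 < p) (h h' : ℕ) :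
    ∑ a ∈ range p, ((if p ∣ a + h then (0 : ℝ) else 1) * (if p ∣ a + h' then 0 else 1)) =
      (p : ℝ) - 2 + if h ≡ h' [MOD p] then 1 else 0 := by
  have hsum : ∀ k, ∑ a ∈ range p, (if p ∣ a + k then (1 : ℝ) else 0) = 1 := by
    intro k
    have hper : Function.Periodic (fun a => if p ∣ a then (1 : ℝ) else 0) p := by
      intro n; simp
    rw [sum_range_shift_of_periodic hper k, sum_ite_dvd_range hp]
    simp
  have key : ∀ a, ((if p ∣ a + h then (0 : ℝ) else 1) * (if p ∣ a + h' then 0 else 1)) =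
      1 - (if p ∣ a + h then (1 : ℝ) else 0) - (if p ∣ a + h' then (1 : ℝ) else 0) +
        (if h ≡ h' [MOD p] then 1 else 0) * (if p ∣ a + h then (1 : ℝ) else 0) := by
    intro a
    by_cases hm : h ≡ h' [MOD p]
    · have : p ∣ a + h ↔ p ∣ a + h' := (Nat.ModEq.add_left a hm).dvd_iff dvd_rfl
      by_cases h1 : p ∣ a + h
      · simp [h1, this.1 h1, hm]
      · simp [h1, mt this.2 h1]
    · by_cases h1 : p ∣ a + h
      · have h2 : ¬ p ∣ a + h' := by
          intro h2
          refine hm (Nat.ModEq.add_left_cancel' a ?_)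
          exact ((Nat.modEq_zero_iff_dvd).2 h1).trans ((Nat.modEq_zero_iff_dvd).2 h2).symm
        simp [h1, h2, hm]
      · by_cases h2 : p ∣ a + h' <;> simp [h1, h2]
  simp only [key, Finset.sum_add_distrib, Finset.sum_sub_distrib, ← Finset.mul_sum, hsum]
  simp
  ring

theorem modEq_prod_iff {t : Finset ℕ} (ht : ∀ p ∈ t, p.Prime) (h h' : ℕ) :
    h ≡ h' [MOD ∏ p ∈ t, p] ↔ ∀ p ∈ t, h ≡ h' [MOD p] := by
  induction t using Finset.induction_on with
  | empty => simp [Nat.modEq_one]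
  | insert q t hq ih =>
    rw [Finset.prod_insert hq, ← Nat.modEq_and_modEq_iff_modEq_mul,
      ih fun p hp => ht p (mem_insert_of_mem hp)]
    · simp
    · refine Nat.Coprime.prod_right fun p hp => ?_
      refine (Nat.coprime_primes (ht q (mem_insert_self _ _)) (ht p (mem_insert_of_mem hp))).2 ?_
      rintro rfl; exact hq hp

/-- The local factors multiply by the Chinese remainder theorem. At the prime 2 the term p − 2
vanishes, which forces h and h' to have equal parity; this is why the moduli are 2n with n odd. -/
theorem sum_rough_mul_rough {y : ℕ} (hy : 2 ≤ y) (h h' : ℕ) :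
    (∑ n ∈ range (∏ p ∈ primesUpTo y, p), rough (primesUpTo y) (n + h) *
      rough (primesUpTo y) (n + h')) / (∏ p ∈ primesUpTo y, p : ℕ) =
    (∏ p ∈ oddPrimesUpTo y, (1 - 2 / (p : ℝ))) / 2 * ∑ t ∈ (oddPrimesUpTo y).powerset,
      (∏ p ∈ t, 1 / ((p : ℝ) - 2)) * if h ≡ h' [MOD 2 * ∏ p ∈ t, p] then 1 else 0 := by
  have hs := prime_of_mem_primesUpTo (y := y)
  have hso := oddPrimesUpTo_prime (y := y)
  simp only [rough, ← Finset.prod_mul_distrib]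
  rw [sum_prod_eq_prod_sum hs (f := fun p n => (if p ∣ n + h then (0 : ℝ) else 1) *
    (if p ∣ n + h' then 0 else 1))]
  · push_cast
    rw [← Finset.prod_div_distrib]
    have h1 : ∀ p ∈ primesUpTo y, (∑ a ∈ range p, (if p ∣ a + h then (0 : ℝ) else 1) *
        (if p ∣ a + h' then 0 else 1)) / p =
        ((p : ℝ) - 2 + if h ≡ h' [MOD p] then 1 else 0) / p := fun p hp => by
      rw [sum_range_coprime_pair (hs p hp).pos]
    rw [Finset.prod_congr rfl h1, primesUpTo_eq_insert hy,
      Finset.prod_insert (two_notMem_oddPrimesUpTo y)]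
    have h2 : ∀ p ∈ oddPrimesUpTo y, ((p : ℝ) - 2 + if h ≡ h' [MOD p] then 1 else 0) / p =
        (1 - 2 / (p : ℝ)) * (1 + 1 / ((p : ℝ) - 2) * if h ≡ h' [MOD p] then 1 else 0) := by
      intro p hp
      have h3 : (2 : ℝ) < p := by exact_mod_cast (mem_oddPrimesUpTo.1 hp).2.1
      have h4 : (p : ℝ) - 2 ≠ 0 := by linarith
      field_simp
    rw [Finset.prod_congr rfl h2, Finset.prod_mul_distrib, Finset.prod_one_add]
    have h5 : ∀ t ∈ (oddPrimesUpTo y).powerset,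
        (if h ≡ h' [MOD 2] then (1 : ℝ) else 0) *
          ∏ p ∈ t, (1 / ((p : ℝ) - 2) * if h ≡ h' [MOD p] then 1 else 0) =
        (∏ p ∈ t, 1 / ((p : ℝ) - 2)) * if h ≡ h' [MOD 2 * ∏ p ∈ t, p] then 1 else 0 := by
      intro t ht
      have ht := mem_powerset.1 ht
      have h2t : 2 ∉ t := fun h => two_notMem_oddPrimesUpTo y (ht h)
      have h6 := modEq_prod_iff (t := insert 2 t) (by
        intro p hp
        rcases mem_insert.1 hp with rfl | hp
        · exact Nat.prime_two
        · exact hso p (ht hp)) h h'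
      rw [Finset.prod_insert h2t] at h6
      rw [Finset.prod_mul_distrib, mul_left_comm]
      congr 1
      rw [Finset.prod_ite_zero]
      simp only [Finset.prod_const_one, h6, Finset.forall_mem_insert, ite_and]
      split_ifs <;> simp
    rw [← Finset.sum_congr rfl h5, ← Finset.mul_sum]
    push_cast
    ring
  · intro p _ n
    have : ∀ k, p ∣ n + p + k ↔ p ∣ n + k := fun k => by
      rw [add_right_comm, Nat.dvd_add_left dvd_rfl]
    simp only [this]

theorem sum_range_rough_shift {s : Finset ℕ} (hs : ∀ p ∈ s, p.Prime) (h : ℕ) :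
    ∑ n ∈ range (∏ p ∈ s, p), rough s (n + h) = dens s * (∏ p ∈ s, p : ℕ) := by
  have hper : Function.Periodic (rough s) (∏ p ∈ s, p) :=
    prod_periodic (f := fun p n => if p ∣ n then (0 : ℝ) else 1) fun p _ n => by simp
  rw [sum_range_shift_of_periodic hper]
  unfold rough dens
  rw [sum_prod_eq_prod_sum hs (f := fun p n => if p ∣ n then (0 : ℝ) else 1)
    fun p _ n => by simp]
  push_cast
  rw [← Finset.prod_mul_distrib]
  refine Finset.prod_congr rfl fun p hp => ?_
  rw [sum_ite_dvd_range (hs p hp).pos]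
  have : (p : ℝ) ≠ 0 := by exact_mod_cast (hs p hp).ne_zero
  field_simp
  ring

/-- The variance over a full period is the main term. -/
theorem fullVar_primesUpTo {y : ℕ} (hy : 2 ≤ y) (H : ℕ) : fullVar (primesUpTo y) H = M H y := by
  have hs := prime_of_mem_primesUpTo (y := y)
  have hso := oddPrimesUpTo_prime (y := y)
  set s := primesUpTo y with hsdef
  set Q : ℕ := ∏ p ∈ s, p with hQ
  have hQ0 : (Q : ℝ) ≠ 0 := by
    have : 0 < Q := Finset.prod_pos fun p hp => (hs p hp).pos
    positivity
  set S : ℕ → ℝ := fun n => ∑ h ∈ Icc 1 H, rough s (n + h) with hS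
  have hS1 : ∑ n ∈ range Q, S n = H * dens s * Q := by
    simp only [hS]
    rw [Finset.sum_comm, Finset.sum_congr rfl fun h _ => sum_range_rough_shift hs h,
      Finset.sum_const, nsmul_eq_mul, Nat.card_Icc, Nat.add_sub_cancel]
    ring
  have hS2 : (∑ n ∈ range Q, S n ^ 2) / Q = M H y + (H * dens s) ^ 2 := by
    have e1 : (∑ n ∈ range Q, S n ^ 2) / Q = ∑ h ∈ Icc 1 H, ∑ h' ∈ Icc 1 H,
        (∑ n ∈ range Q, rough s (n + h) * rough s (n + h')) / Q := by
      simp only [hS, sq, Finset.sum_mul_sum]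
      rw [Finset.sum_comm, Finset.sum_div]
      refine Finset.sum_congr rfl fun h _ => ?_
      rw [Finset.sum_comm, Finset.sum_div]
    rw [e1]
    have e2 : ∀ h h', (∑ n ∈ range Q, rough s (n + h) * rough s (n + h')) / Q = _ :=
      fun h h' => sum_rough_mul_rough hy h h'
    simp only [e2, ← Finset.mul_sum]
    -- For each modulus the pair count splits into an H² part, which belongs to the squared mean,
    -- and a fractional part term, which belongs to `M`.
    have e3 : ∑ h ∈ Icc 1 H, ∑ h' ∈ Icc 1 H, ∑ t ∈ (oddPrimesUpTo y).powerset,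
        ((∏ p ∈ t, 1 / ((p : ℝ) - 2)) * if h ≡ h' [MOD 2 * ∏ p ∈ t, p] then 1 else 0) =
        ∑ t ∈ (oddPrimesUpTo y).powerset, ((∏ p ∈ t, 1 / ((p : ℝ) * ((p : ℝ) - 2))) *
          ((H : ℝ) ^ 2 / 2) + 2 * ((∏ p ∈ t, (p : ℝ) / ((p : ℝ) - 2)) *
            fracTerm H (2 * (∏ p ∈ t, p : ℕ)))) := by
      rw [Finset.sum_congr rfl fun h _ => Finset.sum_comm, Finset.sum_comm]
      refine Finset.sum_congr rfl fun t ht => ?_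
      have ht := mem_powerset.1 ht
      have hpos : 0 < ∏ p ∈ t, p := Finset.prod_pos fun p hp => (hso p (ht hp)).pos
      simp only [← Finset.mul_sum]
      rw [sum_modEq H (by positivity)]
      have f1 : ∏ p ∈ t, 1 / ((p : ℝ) * ((p : ℝ) - 2)) =
          (∏ p ∈ t, 1 / ((p : ℝ) - 2)) / (∏ p ∈ t, p : ℕ) := by
        push_cast
        rw [← Finset.prod_div_distrib]
        exact Finset.prod_congr rfl fun p _ => by rw [div_div, mul_comm]
      have f2 : ∏ p ∈ t, (p : ℝ) / ((p : ℝ) - 2) =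
          (∏ p ∈ t, 1 / ((p : ℝ) - 2)) * (∏ p ∈ t, p : ℕ) := by
        push_cast
        rw [← Finset.prod_mul_distrib]
        exact Finset.prod_congr rfl fun p _ => by ring
      rw [f1, f2, Nat.cast_mul, Nat.cast_two]
      have : ((∏ p ∈ t, p : ℕ) : ℝ) ≠ 0 := by positivity
      generalize ((∏ p ∈ t, p : ℕ) : ℝ) = m at *
      field_simp
    rw [e3, Finset.sum_add_distrib, ← Finset.sum_mul, ← Finset.mul_sum, ← Finset.prod_one_add,
      M_eq_sum]
    -- The H² parts add up to exactly the square of the mean.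
    have e4 : (∏ p ∈ oddPrimesUpTo y, (1 - 2 / (p : ℝ))) *
        ∏ p ∈ oddPrimesUpTo y, (1 + 1 / ((p : ℝ) * ((p : ℝ) - 2))) =
        (∏ p ∈ oddPrimesUpTo y, (1 - 1 / (p : ℝ))) ^ 2 := by
      rw [← Finset.prod_mul_distrib, ← Finset.prod_pow]
      refine Finset.prod_congr rfl fun p hp => ?_
      have h3 : (2 : ℝ) < p := by exact_mod_cast (mem_oddPrimesUpTo.1 hp).2.1
      have h4 : (p : ℝ) - 2 ≠ 0 := by linarith
      field_simp
      ring
    have e5 : dens s = 1 / 2 * ∏ p ∈ oddPrimesUpTo y, (1 - 1 / (p : ℝ)) := by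
      rw [dens, hsdef, primesUpTo_eq_insert hy, Finset.prod_insert (two_notMem_oddPrimesUpTo y)]
      norm_num
    rw [e5]
    linear_combination ((H : ℝ) ^ 2 / 4) * e4
  rw [fullVar]
  have e6 : ∑ n ∈ range Q, (S n - H * dens s) ^ 2 =
      ∑ n ∈ range Q, S n ^ 2 - 2 * (H * dens s) * ∑ n ∈ range Q, S n +
        Q * (H * dens s) ^ 2 := by
    rw [Finset.mul_sum, ← Finset.sum_sub_distrib]
    have : (Q : ℝ) * (H * dens s) ^ 2 = ∑ n ∈ range Q, (H * dens s) ^ 2 := by simp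
    rw [this, ← Finset.sum_add_distrib]
    exact Finset.sum_congr rfl fun n _ => by ring
  change (∑ n ∈ range Q, (S n - H * dens s) ^ 2) / Q = M H y
  rw [e6, hS1, add_div, sub_div, hS2]
  field_simp
  ring


/-! ### Truncation error: cancellation and Rankin's trick -/

/-- Pairing a with a ∪ {q} for one fixed q cancels everything except the sets whose product m has m
b ≤ D < q m b. For those q m ≤ D y, and the Rankin weight (q m b / D) ^ σ is at least 1. The
cancellation is what confines the majorant to divisors at most D y, which later leaves room for a
sieve. -/
theorem abs_sum_neg_one_pow_card_le {y D σ : ℝ} {b : ℕ} (hy : 1 ≤ y) (hD : 1 ≤ D)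
    (hσ : 0 ≤ σ) (s : Finset ℕ) (hs0 : ∀ p ∈ s, 0 < p) (hs : ∀ p ∈ s, (p : ℝ) ≤ y) :
    |∑ a ∈ s.powerset, if D < (∏ p ∈ a, p : ℕ) * (b : ℝ) then (-1 : ℝ) ^ a.card else 0| ≤
      ∑ d ∈ s.powerset, if ((∏ p ∈ d, p : ℕ) : ℝ) ≤ D * y then
        ((∏ p ∈ d, p : ℕ) * (b : ℝ) / D) ^ σ else 0 := by
  have hD0 : 0 < D := by linarith
  have one_le : ∀ x : ℝ, D < x → 1 ≤ (x / D) ^ σ := fun x hx =>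
    Real.one_le_rpow ((one_le_div hD0).2 hx.le) hσ
  have hnn : ∀ d : Finset ℕ, 0 ≤ if ((∏ p ∈ d, p : ℕ) : ℝ) ≤ D * y then
      ((∏ p ∈ d, p : ℕ) * (b : ℝ) / D) ^ σ else 0 := by
    intro d
    split_ifs
    · positivity
    · exact le_rfl
  induction s using Finset.induction_on with
  | empty =>
    have : (1 : ℝ) ≤ D * y := by nlinarith
    simp only [powerset_empty, sum_singleton, prod_empty, card_empty, pow_zero, Nat.cast_one,
      one_mul, this, if_true]
    split_ifs with h
    · simpa using one_le _ h
    · simp only [abs_zero]; positivity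
  | insert q s hq _ =>
    rw [Finset.sum_powerset_insert hq, Finset.sum_powerset_insert hq, ← Finset.sum_add_distrib]
    refine (Finset.abs_sum_le_sum_abs _ _).trans ?_
    refine le_trans ?_ (le_add_of_nonneg_left (Finset.sum_nonneg fun d _ => hnn d))
    refine Finset.sum_le_sum fun a ha => ?_
    have hqa : q ∉ a := fun h => hq (mem_powerset.1 ha h)
    rw [Finset.prod_insert hqa, Finset.card_insert_of_notMem hqa, pow_succ]
    have hqy : (q : ℝ) ≤ y := hs q (mem_insert_self _ _)
    push_cast
    set m : ℝ := ∏ p ∈ a, (p : ℝ) with hm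
    have hm0 : 0 ≤ m := Finset.prod_nonneg fun p _ => by positivity
    have hrhs : 0 ≤ if q * m ≤ D * y then (q * m * (b : ℝ) / D) ^ σ else 0 := by
      split_ifs
      · positivity
      · exact le_rfl
    by_cases h1 : D < m * b
    · by_cases h2 : D < q * m * b
      · simp only [h1, h2, if_true]
        simpa using hrhs
      · exfalso
        have : (1 : ℝ) ≤ q := by exact_mod_cast hs0 q (mem_insert_self _ _)
        have hmb : 0 ≤ m * b := by positivity
        nlinarith
    · by_cases h2 : D < q * m * b
      · have hb : (1 : ℝ) ≤ b := by
          have : b ≠ 0 := by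
            rintro rfl
            simp at h2; linarith
          exact_mod_cast Nat.one_le_iff_ne_zero.2 this
        have h3 : q * m ≤ D * y := by
          have : m ≤ D := by nlinarith
          have : (0 : ℝ) ≤ q := by positivity
          nlinarith
        simp only [h1, h2, h3, if_true, if_false]
        rw [zero_add, abs_mul, abs_pow, abs_neg, abs_one, one_pow, one_mul]
        exact one_le _ h2
      · simp only [h1, h2, if_false]
        simpa using hrhs

/-- The divisor sum that majorizes the truncation error. -/
noncomputable def divSum (s : Finset ℕ) (B σ : ℝ) (n : ℕ) : ℝ :=
  ∑ d ∈ s.powerset, if ∏ p ∈ d, p ∣ n ∧ ((∏ p ∈ d, p : ℕ) : ℝ) ≤ B then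
    ((∏ p ∈ d, p : ℕ) : ℝ) ^ σ else 0

/-- The truncation at level `D` of the indicator `rough s`. -/
noncomputable def trunc (s : Finset ℕ) (D : ℝ) (n : ℕ) : ℝ :=
  dens s * ∑ t ∈ s.powerset with ((∏ p ∈ t, p : ℕ) : ℝ) ≤ D, ∏ p ∈ t, kappa p n

theorem divSum_nonneg (s : Finset ℕ) (B σ : ℝ) (n : ℕ) : 0 ≤ divSum s B σ n := by
  refine Finset.sum_nonneg fun d _ => ?_
  split_ifs
  · positivity
  · exact le_rfl

theorem dens_factor_nonneg (p : ℕ) : (0 : ℝ) ≤ 1 - 1 / (p : ℝ) := by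
  rcases Nat.eq_zero_or_pos p with rfl | hp
  · simp
  · have : (1 : ℝ) ≤ p := by exact_mod_cast hp
    have := (div_le_one (by linarith : (0 : ℝ) < p)).2 this
    linarith

theorem dens_nonneg (s : Finset ℕ) : 0 ≤ dens s :=
  Finset.prod_nonneg fun p _ => dens_factor_nonneg p

theorem dens_le_one (s : Finset ℕ) : dens s ≤ 1 := by
  refine Finset.prod_le_one (fun p _ => dens_factor_nonneg p) fun p _ => ?_
  have : (0 : ℝ) ≤ 1 / p := by positivity
  linarith

theorem dens_pos {s : Finset ℕ} (hs : ∀ p ∈ s, p.Prime) : 0 < dens s := by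
  refine Finset.prod_pos fun p hp => ?_
  have : (1 : ℝ) < p := by exact_mod_cast (hs p hp).one_lt
  have := (div_lt_one (by linarith : (0 : ℝ) < p)).2 this
  linarith

theorem rough_nonneg (s : Finset ℕ) (n : ℕ) : 0 ≤ rough s n :=
  Finset.prod_nonneg fun p _ => by split_ifs <;> norm_num

theorem rough_le_one (s : Finset ℕ) (n : ℕ) : rough s n ≤ 1 :=
  Finset.prod_le_one (fun p _ => by split_ifs <;> norm_num) fun p _ => by split_ifs <;> norm_num

theorem sum_powerset_filter_split {s : Finset ℕ} (q : ℕ → Prop) [DecidablePred q]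
    (f : Finset ℕ → ℝ) :
    ∑ t ∈ s.powerset, f t =
      ∑ b ∈ (s.filter fun p => ¬ q p).powerset, ∑ a ∈ (s.filter q).powerset, f (a ∪ b) := by
  rw [← Finset.sum_product' (f := fun b a => f (a ∪ b))]
  refine Finset.sum_bij' (fun t _ => (t.filter fun p => ¬ q p, t.filter q))
    (fun x _ => x.2 ∪ x.1) ?_ ?_ ?_ ?_ ?_
  · intro t ht
    rw [mem_powerset] at ht
    simp only [mem_product, mem_powerset]
    exact ⟨Finset.filter_subset_filter _ ht, Finset.filter_subset_filter _ ht⟩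
  · rintro ⟨b, a⟩ hx
    simp only [mem_product, mem_powerset] at hx ⊢
    exact Finset.union_subset (hx.2.trans (filter_subset _ _)) (hx.1.trans (filter_subset _ _))
  · intro t _
    exact Finset.filter_union_filter_not_eq _ _
  · rintro ⟨b, a⟩ hx
    simp only [mem_product, mem_powerset] at hx
    have h1 : ∀ p ∈ b, ¬ q p := fun p hp => (mem_filter.1 (hx.1 hp)).2
    have h2 : ∀ p ∈ a, q p := fun p hp => (mem_filter.1 (hx.2 hp)).2
    ext p
    · simp only [mem_filter, mem_union]
      exact ⟨fun h => h.1.resolve_left fun h' => h.2 (h2 p h'), fun h => ⟨Or.inr h, h1 p h⟩⟩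
    · simp only [mem_filter, mem_union]
      exact ⟨fun h => h.1.resolve_right fun h' => h1 p h' h.2, fun h => ⟨Or.inl h, h2 p h⟩⟩
  · intro t _
    simp only
    rw [Finset.filter_union_filter_not_eq]

theorem cast_prod_rpow (t : Finset ℕ) (σ : ℝ) :
    ((∏ p ∈ t, p : ℕ) : ℝ) ^ σ = ∏ p ∈ t, (p : ℝ) ^ σ := by
  push_cast
  exact (Real.finsetProd_rpow _ _ (fun p _ => by positivity) _).symm

theorem sum_powerset_rpow_le_divSum {s : Finset ℕ} (hs : ∀ p ∈ s, p.Prime) (B σ : ℝ) (n : ℕ) :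
    ∑ d ∈ (s.filter (· ∣ n)).powerset, (if ((∏ p ∈ d, p : ℕ) : ℝ) ≤ B then
      ((∏ p ∈ d, p : ℕ) : ℝ) ^ σ else 0) ≤ divSum s B σ n := by
  unfold divSum
  have : ∀ d ∈ (s.filter (· ∣ n)).powerset, (if ((∏ p ∈ d, p : ℕ) : ℝ) ≤ B then
      ((∏ p ∈ d, p : ℕ) : ℝ) ^ σ else 0) = if ∏ p ∈ d, p ∣ n ∧ ((∏ p ∈ d, p : ℕ) : ℝ) ≤ B then
      ((∏ p ∈ d, p : ℕ) : ℝ) ^ σ else 0 := by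
    intro d hd
    have hd := mem_powerset.1 hd
    have hdvd : ∏ p ∈ d, p ∣ n := Finset.prod_primes_dvd n
      (fun p hp => (hs p (mem_filter.1 (hd hp)).1).prime) fun p hp => (mem_filter.1 (hd hp)).2
    simp only [hdvd, true_and]
  rw [Finset.sum_congr rfl this]
  refine Finset.sum_le_sum_of_subset_of_nonneg
    (Finset.powerset_mono.2 (Finset.filter_subset _ _)) fun d _ _ => ?_
  split_ifs
  · positivity
  · exact le_rfl

/-- The pointwise bound for the truncation error. -/
theorem abs_rough_sub_trunc_le {s : Finset ℕ} (hs : ∀ p ∈ s, p.Prime) {y D σ : ℝ} (hy : 1 ≤ y)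
    (hD : 1 ≤ D) (hσ : 0 ≤ σ) (hsy : ∀ p ∈ s, (p : ℝ) ≤ y) (n : ℕ) :
    |rough s n - trunc s D n| ≤
      dens s * (D ^ (-σ) * ∏ p ∈ s, (1 + (p : ℝ) ^ σ / ((p : ℝ) - 1))) *
        divSum s (D * y) σ n := by
  have hD0 : 0 < D := by linarith
  have h1 : rough s n - trunc s D n = dens s *
      ∑ t ∈ s.powerset, if D < (∏ p ∈ t, p : ℕ) then ∏ p ∈ t, kappa p n else 0 := by
    rw [rough_eq_sum_kappa hs, trunc, ← mul_sub, Finset.sum_filter, ← Finset.sum_sub_distrib]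
    congr 1
    refine Finset.sum_congr rfl fun t _ => ?_
    by_cases h : ((∏ p ∈ t, p : ℕ) : ℝ) ≤ D
    · rw [if_pos h, if_neg (not_lt.2 h), sub_self]
    · rw [if_neg h, if_pos (not_le.1 h), sub_zero]
  rw [h1, abs_mul, abs_of_nonneg (dens_nonneg s), mul_assoc]
  refine mul_le_mul_of_nonneg_left ?_ (dens_nonneg s)
  -- The primes of t dividing n carry `kappa` = −1 and the others 1 / (p − 1). With the second part
  -- b fixed, the sum over the first part alternates in sign.
  rw [sum_powerset_filter_split (· ∣ n)]
  set sn := s.filter (· ∣ n) with hsn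
  set sc := s.filter fun p => ¬ p ∣ n with hsc
  have hpm1 : ∀ p ∈ s, (0 : ℝ) < (p : ℝ) - 1 := fun p hp => by
    have : (1 : ℝ) < p := by exact_mod_cast (hs p hp).one_lt
    linarith
  have h2 : ∀ b ∈ sc.powerset, ∀ a ∈ sn.powerset,
      (if D < (∏ p ∈ a ∪ b, p : ℕ) then ∏ p ∈ a ∪ b, kappa p n else 0) =
      (∏ p ∈ b, 1 / ((p : ℝ) - 1)) *
        if D < (∏ p ∈ a, p : ℕ) * ((∏ p ∈ b, p : ℕ) : ℝ) then (-1 : ℝ) ^ a.card else 0 := by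
    intro b hb a ha
    have hb := mem_powerset.1 hb
    have ha := mem_powerset.1 ha
    have hdisj : Disjoint a b := by
      rw [Finset.disjoint_left]
      intro p hpa hpb
      exact (mem_filter.1 (hb hpb)).2 (mem_filter.1 (ha hpa)).2
    rw [Finset.prod_union hdisj, Finset.prod_union hdisj, Nat.cast_mul]
    have e1 : ∏ p ∈ a, kappa p n = (-1) ^ a.card := by
      rw [← Finset.prod_const]
      exact Finset.prod_congr rfl fun p hp => if_pos (mem_filter.1 (ha hp)).2
    have e2 : ∏ p ∈ b, kappa p n = ∏ p ∈ b, 1 / ((p : ℝ) - 1) :=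
      Finset.prod_congr rfl fun p hp => if_neg (mem_filter.1 (hb hp)).2
    rw [e1, e2]
    split_ifs
    · ring
    · ring
  rw [Finset.sum_congr rfl fun b hb => Finset.sum_congr rfl (h2 b hb)]
  simp only [← Finset.mul_sum]
  refine (Finset.abs_sum_le_sum_abs _ _).trans ?_
  have h3 : ∀ b ∈ sc.powerset, |(∏ p ∈ b, 1 / ((p : ℝ) - 1)) * ∑ a ∈ sn.powerset,
        if D < (∏ p ∈ a, p : ℕ) * ((∏ p ∈ b, p : ℕ) : ℝ) then (-1 : ℝ) ^ a.card else 0| ≤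
      (∏ p ∈ b, (p : ℝ) ^ σ / ((p : ℝ) - 1)) * (D ^ (-σ) * divSum s (D * y) σ n) := by
    intro b hb
    have hb := mem_powerset.1 hb
    have hbs : ∀ p ∈ b, p ∈ s := fun p hp => (mem_filter.1 (hb hp)).1
    have hnn : 0 ≤ ∏ p ∈ b, 1 / ((p : ℝ) - 1) :=
      Finset.prod_nonneg fun p hp => (one_div_pos.2 (hpm1 p (hbs p hp))).le
    rw [abs_mul, abs_of_nonneg hnn]
    have h4 := abs_sum_neg_one_pow_card_le (b := ∏ p ∈ b, p) hy hD hσ sn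
      (fun p hp => (hs p (mem_filter.1 hp).1).pos) fun p hp => hsy p (mem_filter.1 hp).1
    refine (mul_le_mul_of_nonneg_left h4 hnn).trans ?_
    have h5 : ∀ d : Finset ℕ, (if ((∏ p ∈ d, p : ℕ) : ℝ) ≤ D * y then
        ((∏ p ∈ d, p : ℕ) * ((∏ p ∈ b, p : ℕ) : ℝ) / D) ^ σ else 0) =
        ((∏ p ∈ b, p : ℕ) : ℝ) ^ σ * D ^ (-σ) * if ((∏ p ∈ d, p : ℕ) : ℝ) ≤ D * y then
        ((∏ p ∈ d, p : ℕ) : ℝ) ^ σ else 0 := by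
      intro d
      split_ifs
      · rw [Real.div_rpow (by positivity) hD0.le, Real.mul_rpow (by positivity) (by positivity),
          Real.rpow_neg hD0.le]
        ring
      · ring
    simp only [h5, ← Finset.mul_sum]
    have h6 : ∏ p ∈ b, (p : ℝ) ^ σ / ((p : ℝ) - 1) =
        (∏ p ∈ b, 1 / ((p : ℝ) - 1)) * ((∏ p ∈ b, p : ℕ) : ℝ) ^ σ := by
      rw [cast_prod_rpow, ← Finset.prod_mul_distrib]
      exact Finset.prod_congr rfl fun p _ => by ring
    rw [h6, mul_assoc, mul_assoc]
    refine mul_le_mul_of_nonneg_left ?_ hnn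
    refine mul_le_mul_of_nonneg_left ?_ (by positivity)
    refine mul_le_mul_of_nonneg_left ?_ (by positivity)
    exact sum_powerset_rpow_le_divSum hs _ _ _
  refine (Finset.sum_le_sum h3).trans ?_
  rw [← Finset.sum_mul, ← mul_assoc, mul_comm (D ^ (-σ))]
  refine mul_le_mul_of_nonneg_right ?_ (divSum_nonneg _ _ _ _)
  refine mul_le_mul_of_nonneg_right ?_ (by positivity)
  rw [← Finset.prod_one_add]
  refine Finset.prod_le_prod_of_subset_of_one_le (Finset.filter_subset _ _) ?_ ?_
  · intro p hp
    have := hpm1 p (mem_filter.1 hp).1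
    positivity
  · intro p hp _
    have := hpm1 p hp
    have : 0 ≤ (p : ℝ) ^ σ / ((p : ℝ) - 1) := by positivity
    linarith

theorem card_Icc_filter_dvd_le (N : ℕ) {d : ℕ} :
    (((Icc 1 N).filter (d ∣ ·)).card : ℝ) ≤ N / d := by
  have : ((Icc 1 N).filter (d ∣ ·)).card = N / d := Nat.Ioc_filter_dvd_card_eq_div N d
  rw [this]
  exact Nat.cast_div_le

theorem sum_powerset_rpow_div {s : Finset ℕ} (hs : ∀ p ∈ s, p.Prime) (σ : ℝ) :
    ∑ d ∈ s.powerset, ((∏ p ∈ d, p : ℕ) : ℝ) ^ σ / (∏ p ∈ d, p : ℕ) =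
      ∏ p ∈ s, (1 + (p : ℝ) ^ (σ - 1)) := by
  rw [Finset.prod_one_add]
  refine Finset.sum_congr rfl fun d hd => ?_
  rw [cast_prod_rpow]
  push_cast
  rw [← Finset.prod_div_distrib]
  refine Finset.prod_congr rfl fun p hp => ?_
  have : (0 : ℝ) < p := by exact_mod_cast (hs p (mem_powerset.1 hd hp)).pos
  rw [Real.rpow_sub_one this.ne']

theorem sum_divSum_le {s : Finset ℕ} (hs : ∀ p ∈ s, p.Prime) (B σ : ℝ) (N : ℕ) :
    ∑ n ∈ Icc 1 N, divSum s B σ n ≤ N * ∏ p ∈ s, (1 + (p : ℝ) ^ (σ - 1)) := by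
  unfold divSum
  rw [Finset.sum_comm, ← sum_powerset_rpow_div hs, Finset.mul_sum]
  refine Finset.sum_le_sum fun d _ => ?_
  calc ∑ n ∈ Icc 1 N, (if ∏ p ∈ d, p ∣ n ∧ ((∏ p ∈ d, p : ℕ) : ℝ) ≤ B then
        ((∏ p ∈ d, p : ℕ) : ℝ) ^ σ else 0)
      ≤ ∑ n ∈ Icc 1 N, (if ∏ p ∈ d, p ∣ n then ((∏ p ∈ d, p : ℕ) : ℝ) ^ σ else 0) := by
        refine Finset.sum_le_sum fun n _ => ?_
        by_cases h : ∏ p ∈ d, p ∣ n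
        · simp only [h, true_and, if_true]
          split_ifs
          · exact le_rfl
          · positivity
        · simp [h]
    _ = ((Icc 1 N).filter (∏ p ∈ d, p ∣ ·)).card * ((∏ p ∈ d, p : ℕ) : ℝ) ^ σ := by
        rw [← Finset.sum_filter, Finset.sum_const, nsmul_eq_mul]
    _ ≤ N / (∏ p ∈ d, p : ℕ) * ((∏ p ∈ d, p : ℕ) : ℝ) ^ σ :=
        mul_le_mul_of_nonneg_right (card_Icc_filter_dvd_le N) (by positivity)
    _ = _ := by ring

/-- Divisors built from disjoint sets of primes are coprime, so their product divides n; the size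
restrictions are dropped, and the mean factors into two Rankin products. -/
theorem sum_divSum_mul_divSum_le {s₁ s₂ : Finset ℕ} (hs₁ : ∀ p ∈ s₁, p.Prime)
    (hs₂ : ∀ p ∈ s₂, p.Prime) (hdisj : Disjoint s₁ s₂) (B₁ B₂ σ₁ σ₂ : ℝ) (N : ℕ) :
    ∑ n ∈ Icc 1 N, divSum s₁ B₁ σ₁ n * divSum s₂ B₂ σ₂ n ≤
      N * ((∏ p ∈ s₁, (1 + (p : ℝ) ^ (σ₁ - 1))) * ∏ p ∈ s₂, (1 + (p : ℝ) ^ (σ₂ - 1))) := by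
  unfold divSum
  simp only [Finset.sum_mul_sum]
  rw [Finset.sum_comm, ← sum_powerset_rpow_div hs₁, ← sum_powerset_rpow_div hs₂,
    Finset.sum_mul_sum, Finset.mul_sum]
  refine Finset.sum_le_sum fun d hd => ?_
  rw [Finset.sum_comm, Finset.mul_sum]
  refine Finset.sum_le_sum fun e he => ?_
  have hd := mem_powerset.1 hd
  have he := mem_powerset.1 he
  have hcop : Nat.Coprime (∏ p ∈ d, p) (∏ p ∈ e, p) := by
    refine Nat.Coprime.prod_left fun p hp => Nat.Coprime.prod_right fun q hq => ?_
    refine (Nat.coprime_primes (hs₁ p (hd hp)) (hs₂ q (he hq))).2 ?_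
    rintro rfl
    exact Finset.disjoint_left.1 hdisj (hd hp) (he hq)
  set a := ∏ p ∈ d, p
  set b := ∏ p ∈ e, p
  calc ∑ n ∈ Icc 1 N, ((if a ∣ n ∧ (a : ℝ) ≤ B₁ then (a : ℝ) ^ σ₁ else 0) *
        (if b ∣ n ∧ (b : ℝ) ≤ B₂ then (b : ℝ) ^ σ₂ else 0))
      ≤ ∑ n ∈ Icc 1 N, (if a * b ∣ n then (a : ℝ) ^ σ₁ * (b : ℝ) ^ σ₂ else 0) := by
        refine Finset.sum_le_sum fun n _ => ?_
        by_cases h : a * b ∣ n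
        · rw [if_pos h]
          refine mul_le_mul ?_ ?_ ?_ (by positivity)
          all_goals split_ifs
          all_goals first | exact le_rfl | positivity
        · rw [if_neg h]
          by_cases h1 : a ∣ n
          · have h2 : ¬ b ∣ n := fun h2 => h (hcop.mul_dvd_of_dvd_of_dvd h1 h2)
            simp [h2]
          · simp [h1]
    _ = ((Icc 1 N).filter (a * b ∣ ·)).card * ((a : ℝ) ^ σ₁ * (b : ℝ) ^ σ₂) := by
        rw [← Finset.sum_filter, Finset.sum_const, nsmul_eq_mul]
    _ ≤ N / (a * b : ℕ) * ((a : ℝ) ^ σ₁ * (b : ℝ) ^ σ₂) :=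
        mul_le_mul_of_nonneg_right (card_Icc_filter_dvd_le N) (by positivity)
    _ = N * ((a : ℝ) ^ σ₁ / a * ((b : ℝ) ^ σ₂ / b)) := by
        push_cast
        rw [div_mul_div_comm]
        ring


/-! ### An upper-bound sieve and the mean error of a two-level truncation -/

theorem rough_eq_sum_neg_one_pow {s : Finset ℕ} (hs : ∀ p ∈ s, p.Prime) (n : ℕ) :
    rough s n = ∑ d ∈ s.powerset, if ∏ p ∈ d, p ∣ n then (-1 : ℝ) ^ d.card else 0 := by
  have h1 : rough s n = ∏ p ∈ s, (1 + if p ∣ n then (-1 : ℝ) else 0) :=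
    Finset.prod_congr rfl fun p _ => by split_ifs <;> norm_num
  rw [h1, Finset.prod_one_add]
  refine Finset.sum_congr rfl fun d hd => ?_
  have hd := mem_powerset.1 hd
  have h2 : ∏ p ∈ d, p ∣ n ↔ ∀ p ∈ d, p ∣ n :=
    ⟨fun h p hp => (Finset.dvd_prod_of_mem _ hp).trans h,
      fun h => Finset.prod_primes_dvd n (fun p hp => (hs p (hd hp)).prime) h⟩
  rw [Finset.prod_ite_zero, Finset.prod_const]
  simp only [h2]

/-- Legendre's sieve with Rankin's trick: an upper bound for the sifted integers. -/
theorem sum_rough_le {s : Finset ℕ} (hs : ∀ p ∈ s, p.Prime) {D σ : ℝ}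
    (hD : 1 ≤ D) (hσ : 0 ≤ σ) (N : ℕ) :
    ∑ n ∈ Icc 1 N, rough s n ≤
      N * dens s + D + 2 * N * (D ^ (-σ) * ∏ p ∈ s, (1 + (p : ℝ) ^ (σ - 1))) := by
  have hD0 : 0 < D := by linarith
  set m : Finset ℕ → ℕ := fun d => ∏ p ∈ d, p with hm
  set R : ℝ := D ^ (-σ) * ∏ p ∈ s, (1 + (p : ℝ) ^ (σ - 1)) with hR
  -- Any upper bound for the primes in s will do: the restriction to divisors at most D y disappears
  -- in the average.
  set y : ℝ := 1 + ∑ p ∈ s, (p : ℝ) with hy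
  have hy1 : 1 ≤ y := by
    have : 0 ≤ ∑ p ∈ s, (p : ℝ) := Finset.sum_nonneg fun p _ => by positivity
    linarith
  have hsy : ∀ p ∈ s, (p : ℝ) ≤ y := fun p hp => by
    have := Finset.single_le_sum (f := fun p : ℕ => (p : ℝ)) (fun p _ => by positivity) hp
    linarith
  -- pointwise bound
  have hpt : ∀ n, rough s n ≤ (∑ d ∈ s.powerset with (m d : ℝ) ≤ D,
      if m d ∣ n then (-1 : ℝ) ^ d.card else 0) + D ^ (-σ) * divSum s (D * y) σ n := by
    intro n
    rw [rough_eq_sum_neg_one_pow hs, ← Finset.sum_filter_add_sum_filter_not s.powerset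
      (fun d => (m d : ℝ) ≤ D)]
    gcongr
    have h1 : ∑ d ∈ s.powerset with ¬ (m d : ℝ) ≤ D, (if m d ∣ n then (-1 : ℝ) ^ d.card else 0) =
        ∑ d ∈ (s.filter (· ∣ n)).powerset,
          if D < (m d : ℝ) * ((1 : ℕ) : ℝ) then (-1 : ℝ) ^ d.card else 0 := by
      rw [Finset.sum_filter, ← Finset.sum_subset (Finset.powerset_mono.2 (Finset.filter_subset
        (· ∣ n) s))]
      · refine Finset.sum_congr rfl fun d hd => ?_
        have hd := mem_powerset.1 hd
        have : m d ∣ n := Finset.prod_primes_dvd n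
          (fun p hp => (hs p (mem_filter.1 (hd hp)).1).prime) fun p hp => (mem_filter.1 (hd hp)).2
        simp [this]
      · intro d hd hd'
        have : ¬ m d ∣ n := by
          intro h
          refine hd' (mem_powerset.2 fun p hp => mem_filter.2 ⟨mem_powerset.1 hd hp, ?_⟩)
          exact (Finset.dvd_prod_of_mem _ hp).trans h
        simp [this]
    rw [h1]
    refine (le_abs_self _).trans ((abs_sum_neg_one_pow_card_le hy1 hD hσ _
      (fun p hp => (hs p (mem_filter.1 hp).1).pos) fun p hp => hsy p (mem_filter.1 hp).1).trans ?_)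
    have h2 : ∀ d : Finset ℕ, (if (m d : ℝ) ≤ D * y then
        ((m d : ℝ) * ((1 : ℕ) : ℝ) / D) ^ σ else 0) =
        D ^ (-σ) * if (m d : ℝ) ≤ D * y then (m d : ℝ) ^ σ else 0 := by
      intro d
      split_ifs
      · rw [Nat.cast_one, mul_one, Real.div_rpow (by positivity) hD0.le, Real.rpow_neg hD0.le]
        ring
      · ring
    rw [Finset.sum_congr rfl fun d _ => h2 d, ← Finset.mul_sum]
    exact mul_le_mul_of_nonneg_left (sum_powerset_rpow_le_divSum hs _ _ _) (by positivity)
  have hmpos : ∀ d ∈ s.powerset, 0 < m d := fun d hd =>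
    Finset.prod_pos fun p hp => (hs p (mem_powerset.1 hd hp)).pos
  -- the main part
  have hmain : ∑ n ∈ Icc 1 N, ∑ d ∈ s.powerset with (m d : ℝ) ≤ D,
      (if m d ∣ n then (-1 : ℝ) ^ d.card else 0) ≤ N * dens s + D + N * R := by
    rw [Finset.sum_comm]
    have h1 : ∀ d ∈ s.powerset.filter (fun d => (m d : ℝ) ≤ D),
        ∑ n ∈ Icc 1 N, (if m d ∣ n then (-1 : ℝ) ^ d.card else 0) ≤
          N * ((-1 : ℝ) ^ d.card / m d) + 1 := by
      intro d hd
      have hpos := hmpos d (mem_filter.1 hd).1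
      rw [← Finset.sum_filter, Finset.sum_const, nsmul_eq_mul]
      have hcard : ((Icc 1 N).filter (m d ∣ ·)).card = N / m d :=
        Nat.Ioc_filter_dvd_card_eq_div N (m d)
      rw [hcard]
      have h2 : ((N / m d : ℕ) : ℝ) ≤ N / m d := Nat.cast_div_le
      have h3 : (N : ℝ) / m d < (N / m d : ℕ) + 1 := by
        rw [div_lt_iff₀ (by exact_mod_cast hpos)]
        exact_mod_cast Nat.lt_mul_of_div_lt (Nat.lt_succ_self _) hpos |>.trans_eq
          (by rw [Nat.succ_eq_add_one])
      have h4 : (N : ℝ) * ((-1) ^ d.card / m d) = N / m d * (-1) ^ d.card := by ring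
      rw [h4]
      rcases neg_one_pow_eq_or ℝ d.card with h5 | h5 <;> rw [h5] <;> linarith
    refine (Finset.sum_le_sum h1).trans ?_
    rw [Finset.sum_add_distrib, ← Finset.mul_sum, Finset.sum_const, nsmul_eq_mul, mul_one]
    have hcard : (((s.powerset.filter fun d => (m d : ℝ) ≤ D).card : ℕ) : ℝ) ≤ D := by
      have h2 : (s.powerset.filter fun d => (m d : ℝ) ≤ D).card ≤ (Icc 1 ⌊D⌋₊).card := by
        refine Finset.card_le_card_of_injOn m ?_ ?_
        · intro d hd
          have hd := mem_filter.1 (Finset.mem_coe.1 hd)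
          exact Finset.mem_coe.2 (mem_Icc.2 ⟨hmpos d hd.1, Nat.le_floor hd.2⟩)
        · exact (prod_injOn_primes hs).mono fun d hd =>
            Finset.mem_coe.2 (mem_filter.1 (Finset.mem_coe.1 hd)).1
      rw [Nat.card_Icc, Nat.add_sub_cancel] at h2
      exact (Nat.cast_le.2 h2).trans (Nat.floor_le hD0.le)
    have hdens : ∑ d ∈ s.powerset, (-1 : ℝ) ^ d.card / m d = dens s := by
      have : dens s = ∏ p ∈ s, (1 + -1 / (p : ℝ)) :=
        Finset.prod_congr rfl fun p _ => by ring
      rw [this, Finset.prod_one_add]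
      refine Finset.sum_congr rfl fun d _ => ?_
      rw [Finset.prod_div_distrib, Finset.prod_const, hm]
      push_cast
      rfl
    -- Completing the truncated Legendre sum to `dens s` costs one R; the pointwise tail costs
    -- another, whence the 2 in the bound.
    have htail : -R ≤ ∑ d ∈ s.powerset with ¬ (m d : ℝ) ≤ D, (-1 : ℝ) ^ d.card / m d := by
      have h3 : |∑ d ∈ s.powerset with ¬ (m d : ℝ) ≤ D, (-1 : ℝ) ^ d.card / m d| ≤ R := by
        refine (Finset.abs_sum_le_sum_abs _ _).trans ?_
        rw [hR, ← sum_powerset_rpow_div hs, Finset.mul_sum]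
        refine le_trans ?_ (Finset.sum_le_sum_of_subset_of_nonneg (Finset.filter_subset
          (fun d => ¬ (m d : ℝ) ≤ D) _) fun d _ _ => by positivity)
        refine Finset.sum_le_sum fun d hd => ?_
        have hlt := not_le.1 (mem_filter.1 hd).2
        rw [abs_div, abs_pow, abs_neg, abs_one, one_pow, abs_of_nonneg (by positivity),
          ← mul_div_assoc]
        refine div_le_div_of_nonneg_right ?_ (by positivity)
        rw [Real.rpow_neg hD0.le, inv_mul_eq_div, ← Real.div_rpow (by positivity) hD0.le]
        exact Real.one_le_rpow ((one_le_div hD0).2 hlt.le) hσ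
      linarith [(abs_le.1 h3).1]
    have hsplit := Finset.sum_filter_add_sum_filter_not s.powerset
      (fun d => (m d : ℝ) ≤ D) (fun d => (-1 : ℝ) ^ d.card / m d)
    rw [hdens] at hsplit
    have h6 : ∑ d ∈ s.powerset with (m d : ℝ) ≤ D, (-1 : ℝ) ^ d.card / m d ≤ dens s + R := by
      linarith
    have h7 := mul_le_mul_of_nonneg_left h6 (Nat.cast_nonneg (α := ℝ) N)
    linarith
  calc ∑ n ∈ Icc 1 N, rough s n ≤ ∑ n ∈ Icc 1 N, ((∑ d ∈ s.powerset with (m d : ℝ) ≤ D,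
      if m d ∣ n then (-1 : ℝ) ^ d.card else 0) + D ^ (-σ) * divSum s (D * y) σ n) :=
        Finset.sum_le_sum fun n _ => hpt n
    _ ≤ (N * dens s + D + N * R) + D ^ (-σ) * (N * ∏ p ∈ s, (1 + (p : ℝ) ^ (σ - 1))) := by
        rw [Finset.sum_add_distrib, ← Finset.mul_sum]
        exact add_le_add hmain
          (mul_le_mul_of_nonneg_left (sum_divSum_le hs _ _ _) (by positivity))
    _ = _ := by rw [hR]; ring

/-- The relative size of the truncation error. -/
noncomputable def relErr (s : Finset ℕ) (D σ : ℝ) : ℝ :=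
  D ^ (-σ) * (∏ p ∈ s, (1 + (p : ℝ) ^ σ / ((p : ℝ) - 1))) * ∏ p ∈ s, (1 + (p : ℝ) ^ (σ - 1))

theorem one_le_prod_fst {s : Finset ℕ} (hs : ∀ p ∈ s, p.Prime) (σ : ℝ) :
    1 ≤ ∏ p ∈ s, (1 + (p : ℝ) ^ σ / ((p : ℝ) - 1)) := by
  refine Finset.one_le_prod fun p hp => ?_
  have : (1 : ℝ) < p := by exact_mod_cast (hs p hp).one_lt
  have : 0 < (p : ℝ) - 1 := by linarith
  have : 0 ≤ (p : ℝ) ^ σ / ((p : ℝ) - 1) := by positivity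
  linarith

/-- Write n = a k with a the divisor coming from s₂. It is coprime to s₁, so the weight passes to k;
a ≤ B makes the range of k one to which `hsieve` applies. Hence the average gains the factor `dens
s₁`, which an average of `divSum` alone would miss. -/
theorem sum_rough_mul_divSum_le {s₁ s₂ : Finset ℕ} (hs₁ : ∀ p ∈ s₁, p.Prime)
    (hs₂ : ∀ p ∈ s₂, p.Prime) (hdisj : Disjoint s₁ s₂) {B σ : ℝ} {N : ℕ}
    (hsieve : ∀ Y : ℕ, (N : ℝ) ≤ (Y + 1) * B → ∑ n ∈ Icc 1 Y, rough s₁ n ≤ 2 * dens s₁ * Y) :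
    ∑ n ∈ Icc 1 N, rough s₁ n * divSum s₂ B σ n ≤
      2 * dens s₁ * (N * ∏ p ∈ s₂, (1 + (p : ℝ) ^ (σ - 1))) := by
  unfold divSum
  simp only [Finset.mul_sum]
  rw [Finset.sum_comm, ← sum_powerset_rpow_div hs₂, Finset.mul_sum, Finset.mul_sum]
  refine Finset.sum_le_sum fun d hd => ?_
  have hd := mem_powerset.1 hd
  have hpos : 0 < ∏ p ∈ d, p := Finset.prod_pos fun p hp => (hs₂ p (hd hp)).pos
  have hrough : ∀ n, rough s₁ ((∏ p ∈ d, p) * n) = rough s₁ n := by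
    intro n
    refine Finset.prod_congr rfl fun q hq => ?_
    have : q ∣ (∏ p ∈ d, p) * n ↔ q ∣ n := by
      refine Nat.Coprime.dvd_mul_left (Nat.Coprime.prod_right fun p hp => ?_)
      refine (Nat.coprime_primes (hs₁ q hq) (hs₂ p (hd hp))).2 ?_
      rintro rfl
      exact Finset.disjoint_left.1 hdisj hq (hd hp)
    simp only [this]
  set a := ∏ p ∈ d, p with ha
  have hdn := dens_nonneg s₁
  by_cases hB : (a : ℝ) ≤ B
  · simp only [hB, and_true, mul_ite, mul_zero]
    rw [← Finset.sum_filter]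
    have h1 : ∑ n ∈ Icc 1 N with a ∣ n, rough s₁ n * (a : ℝ) ^ σ =
        ∑ k ∈ Icc 1 (N / a), rough s₁ k * (a : ℝ) ^ σ := by
      symm
      refine Finset.sum_bij' (fun k _ => a * k) (fun n _ => n / a) ?_ ?_ ?_ ?_ ?_
      · intro k hk
        simp only [mem_filter, mem_Icc] at hk ⊢
        refine ⟨⟨Nat.mul_pos hpos hk.1, ?_⟩, dvd_mul_right _ _⟩
        rw [mul_comm]; exact (Nat.le_div_iff_mul_le hpos).1 hk.2
      · intro n hn
        simp only [mem_filter, mem_Icc] at hn ⊢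
        exact ⟨Nat.div_pos (Nat.le_of_dvd hn.1.1 hn.2) hpos, Nat.div_le_div_right hn.1.2⟩
      · intro k _
        exact Nat.mul_div_cancel_left k hpos
      · intro n hn
        exact Nat.mul_div_cancel' (mem_filter.1 hn).2
      · intro k _
        rw [hrough]
    rw [h1, ← Finset.sum_mul]
    have h2 : (N : ℝ) ≤ ((N / a : ℕ) + 1) * B := by
      have h3 : N ≤ (N / a + 1) * a := by
        have h4 := Nat.div_add_mod N a
        have h5 := Nat.mod_lt N hpos
        nlinarith
      have h4 : (N : ℝ) ≤ ((N / a : ℕ) + 1) * a := by exact_mod_cast h3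
      exact h4.trans (mul_le_mul_of_nonneg_left hB (by positivity))
    have h6 : ((N / a : ℕ) : ℝ) ≤ N / a := Nat.cast_div_le
    calc (∑ k ∈ Icc 1 (N / a), rough s₁ k) * (a : ℝ) ^ σ
        ≤ (2 * dens s₁ * (N / a : ℕ)) * (a : ℝ) ^ σ :=
          mul_le_mul_of_nonneg_right (hsieve _ h2) (by positivity)
      _ ≤ (2 * dens s₁ * (N / a)) * (a : ℝ) ^ σ := by gcongr
      _ = _ := by ring
  · simp only [hB, and_false, if_false, mul_zero, Finset.sum_const_zero]
    positivity

/-- The mean error of the two-level truncation. -/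
theorem sum_abs_rough_sub_trunc_le {s₁ s₂ : Finset ℕ} (hs₁ : ∀ p ∈ s₁, p.Prime)
    (hs₂ : ∀ p ∈ s₂, p.Prime) (hdisj : Disjoint s₁ s₂) {y D₁ D₂ σ₁ σ₂ : ℝ} (hy : 1 ≤ y)
    (hD₁ : 1 ≤ D₁) (hD₂ : 1 ≤ D₂) (hσ₁ : 0 ≤ σ₁) (hσ₂ : 0 ≤ σ₂)
    (hsy₁ : ∀ p ∈ s₁, (p : ℝ) ≤ y) (hsy₂ : ∀ p ∈ s₂, (p : ℝ) ≤ y) {N : ℕ}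
    (hsieve : ∀ Y : ℕ, (N : ℝ) ≤ (Y + 1) * (D₂ * y) →
      ∑ n ∈ Icc 1 Y, rough s₁ n ≤ 2 * dens s₁ * Y) :
    ∑ n ∈ Icc 1 N, |rough s₁ n * rough s₂ n - trunc s₁ D₁ n * trunc s₂ D₂ n| ≤
      N * (2 * (dens s₁ * dens s₂) * relErr s₂ D₂ σ₂ +
        relErr s₁ D₁ σ₁ * (1 + relErr s₂ D₂ σ₂)) := by
  set A₁ := D₁ ^ (-σ₁) * ∏ p ∈ s₁, (1 + (p : ℝ) ^ σ₁ / ((p : ℝ) - 1)) with hA₁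
  set A₂ := D₂ ^ (-σ₂) * ∏ p ∈ s₂, (1 + (p : ℝ) ^ σ₂ / ((p : ℝ) - 1)) with hA₂
  set B₁ := ∏ p ∈ s₁, (1 + (p : ℝ) ^ (σ₁ - 1)) with hB₁
  set B₂ := ∏ p ∈ s₂, (1 + (p : ℝ) ^ (σ₂ - 1)) with hB₂
  have hA₁0 : 0 ≤ A₁ := mul_nonneg (by positivity) (by linarith [one_le_prod_fst hs₁ σ₁])
  have hA₂0 : 0 ≤ A₂ := mul_nonneg (by positivity) (by linarith [one_le_prod_fst hs₂ σ₂])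
  have hd1 := dens_nonneg s₁
  have hd2 := dens_nonneg s₂
  have hd1' := dens_le_one s₁
  have hd2' := dens_le_one s₂
  set T₁ := divSum s₁ (D₁ * y) σ₁ with hT₁
  set T₂ := divSum s₂ (D₂ * y) σ₂ with hT₂
  have hpt : ∀ n, |rough s₁ n * rough s₂ n - trunc s₁ D₁ n * trunc s₂ D₂ n| ≤
      dens s₂ * A₂ * (rough s₁ n * T₂ n) + A₁ * T₁ n + A₁ * A₂ * (T₁ n * T₂ n) := by
    intro n
    have e1 : |rough s₁ n - trunc s₁ D₁ n| ≤ A₁ * T₁ n := by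
      refine (abs_rough_sub_trunc_le hs₁ hy hD₁ hσ₁ hsy₁ n).trans ?_
      refine mul_le_mul_of_nonneg_right ?_ (divSum_nonneg _ _ _ _)
      exact mul_le_of_le_one_left hA₁0 hd1'
    have e2 := abs_rough_sub_trunc_le hs₂ hy hD₂ hσ₂ hsy₂ n
    rw [← hA₂] at e2
    have hT2 : 0 ≤ T₂ n := divSum_nonneg _ _ _ _
    have hT1 : 0 ≤ T₁ n := divSum_nonneg _ _ _ _
    have e3 : |trunc s₂ D₂ n| ≤ 1 + A₂ * T₂ n := by
      have h1 : |trunc s₂ D₂ n| ≤ |rough s₂ n| + |rough s₂ n - trunc s₂ D₂ n| := by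
        have := abs_sub_abs_le_abs_sub (trunc s₂ D₂ n) (rough s₂ n)
        rw [abs_sub_comm] at this
        linarith
      have h2 : |rough s₂ n| ≤ 1 := by
        rw [abs_of_nonneg (rough_nonneg _ _)]; exact rough_le_one _ _
      have h3 : dens s₂ * A₂ * T₂ n ≤ A₂ * T₂ n :=
        mul_le_mul_of_nonneg_right (mul_le_of_le_one_left hA₂0 hd2') hT2
      linarith
    -- The order of replacement matters: the s₂ error is paired with the true indicator `rough s₁`,
    -- which can be sieved, and only the much smaller s₁ error meets the truncated factor.
    have e4 : rough s₁ n * rough s₂ n - trunc s₁ D₁ n * trunc s₂ D₂ n =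
        rough s₁ n * (rough s₂ n - trunc s₂ D₂ n) +
          (rough s₁ n - trunc s₁ D₁ n) * trunc s₂ D₂ n := by ring
    rw [e4]
    refine (abs_add_le _ _).trans ?_
    rw [abs_mul, abs_mul, abs_of_nonneg (rough_nonneg s₁ n)]
    have f1 := mul_le_mul_of_nonneg_left e2 (rough_nonneg s₁ n)
    have f2 : |rough s₁ n - trunc s₁ D₁ n| * |trunc s₂ D₂ n| ≤ A₁ * T₁ n * (1 + A₂ * T₂ n) :=
      mul_le_mul e1 e3 (abs_nonneg _) (by positivity)
    calc _ ≤ rough s₁ n * (dens s₂ * A₂ * T₂ n) + A₁ * T₁ n * (1 + A₂ * T₂ n) :=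
          add_le_add f1 f2
      _ = _ := by ring
  refine (Finset.sum_le_sum fun n _ => hpt n).trans ?_
  simp only [Finset.sum_add_distrib, ← Finset.mul_sum]
  have g1 : dens s₂ * A₂ * ∑ n ∈ Icc 1 N, rough s₁ n * T₂ n ≤
      dens s₂ * A₂ * (2 * dens s₁ * (N * B₂)) :=
    mul_le_mul_of_nonneg_left (sum_rough_mul_divSum_le hs₁ hs₂ hdisj hsieve) (by positivity)
  have g2 : A₁ * ∑ n ∈ Icc 1 N, T₁ n ≤ A₁ * (N * B₁) :=
    mul_le_mul_of_nonneg_left (sum_divSum_le hs₁ _ _ _) hA₁0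
  have g3 : A₁ * A₂ * ∑ n ∈ Icc 1 N, T₁ n * T₂ n ≤ A₁ * A₂ * (N * (B₁ * B₂)) :=
    mul_le_mul_of_nonneg_left (sum_divSum_mul_divSum_le hs₁ hs₂ hdisj _ _ _ _ _) (by positivity)
  have r1 : relErr s₁ D₁ σ₁ = A₁ * B₁ := rfl
  have r2 : relErr s₂ D₂ σ₂ = A₂ * B₂ := rfl
  rw [r1, r2]
  linarith


/-! ### First moment of the count in short intervals -/

/-- The sets of primes kept by the two-level truncation. -/
noncomputable def levelFamily (s₁ s₂ : Finset ℕ) (D₁ D₂ : ℝ) : Finset (Finset ℕ) :=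
  (((s₁.powerset.filter fun t => ((∏ p ∈ t, p : ℕ) : ℝ) ≤ D₁) ×ˢ
    (s₂.powerset.filter fun t => ((∏ p ∈ t, p : ℕ) : ℝ) ≤ D₂))).image fun x => x.1 ∪ x.2

theorem union_injOn {s₁ s₂ : Finset ℕ} (hdisj : Disjoint s₁ s₂) {a b a' b' : Finset ℕ}
    (ha : a ⊆ s₁) (hb : b ⊆ s₂) (ha' : a' ⊆ s₁) (hb' : b' ⊆ s₂) (h : a ∪ b = a' ∪ b') :
    a = a' ∧ b = b' := by
  have hd : ∀ p, p ∈ s₁ → p ∉ s₂ := fun p h1 h2 => Finset.disjoint_left.1 hdisj h1 h2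
  have hmem : ∀ p, (p ∈ a ∨ p ∈ b) ↔ (p ∈ a' ∨ p ∈ b') := fun p => by
    rw [← mem_union, ← mem_union, h]
  constructor
  · ext p
    constructor
    · intro hp
      exact ((hmem p).1 (Or.inl hp)).resolve_right fun h' => hd p (ha hp) (hb' h')
    · intro hp
      exact ((hmem p).2 (Or.inl hp)).resolve_right fun h' => hd p (ha' hp) (hb h')
  · ext p
    constructor
    · intro hp
      exact ((hmem p).1 (Or.inr hp)).resolve_left fun h' => hd p (ha' h') (hb hp)
    · intro hp
      exact ((hmem p).2 (Or.inr hp)).resolve_left fun h' => hd p (ha h') (hb' hp)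

/-- The family is a product of two families over disjoint sets of primes, so the two-level
truncation is itself an orthogonal truncation and the variance bound applies to it. -/
theorem dens_mul_sum_levelFamily {s₁ s₂ : Finset ℕ} (hdisj : Disjoint s₁ s₂) (D₁ D₂ : ℝ) (n : ℕ) :
    dens (s₁ ∪ s₂) * ∑ t ∈ levelFamily s₁ s₂ D₁ D₂, ∏ p ∈ t, kappa p n =
      trunc s₁ D₁ n * trunc s₂ D₂ n := by
  rw [levelFamily, Finset.sum_image, Finset.sum_product, dens, Finset.prod_union hdisj, trunc,
    trunc, mul_mul_mul_comm, Finset.sum_mul_sum]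
  · refine congrArg₂ _ rfl (Finset.sum_congr rfl fun a ha => Finset.sum_congr rfl fun b hb => ?_)
    simp only [mem_filter, mem_powerset] at ha hb
    exact Finset.prod_union (Finset.disjoint_of_subset_left ha.1
      (Finset.disjoint_of_subset_right hb.1 hdisj))
  · rintro ⟨a, b⟩ hx ⟨a', b'⟩ hx' h
    simp only [coe_product, Set.mem_prod, Finset.mem_coe, mem_filter, mem_powerset] at hx hx'
    obtain ⟨h1, h2⟩ := union_injOn hdisj hx.1.1 hx.2.1 hx'.1.1 hx'.2.1 h
    rw [h1, h2]

theorem rough_union {s₁ s₂ : Finset ℕ} (hdisj : Disjoint s₁ s₂) (n : ℕ) :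
    rough (s₁ ∪ s₂) n = rough s₁ n * rough s₂ n :=
  Finset.prod_union hdisj

/-- The count of integers without prime factors in `s` in the interval after `n`. -/
noncomputable def roughSum (s : Finset ℕ) (H n : ℕ) : ℝ := ∑ h ∈ Icc 1 H, rough s (n + h)

theorem sum_range_sum_shift_le {f : ℕ → ℝ} (hf : ∀ n, 0 ≤ f n) (X H : ℕ) :
    ∑ n ∈ range (X + 1), ∑ h ∈ Icc 1 H, f (n + h) ≤ H * ∑ n ∈ Icc 1 (X + H), f n := by
  rw [Finset.sum_comm]
  have : ∀ h ∈ Icc 1 H, ∑ n ∈ range (X + 1), f (n + h) ≤ ∑ n ∈ Icc 1 (X + H), f n := by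
    intro h hh
    rw [mem_Icc] at hh
    have h1 : ∑ n ∈ range (X + 1), f (n + h) = ∑ n ∈ (range (X + 1)).image (· + h), f n := by
      rw [Finset.sum_image]
      exact fun a _ b _ hab => Nat.add_right_cancel hab
    rw [h1]
    refine Finset.sum_le_sum_of_subset_of_nonneg ?_ fun n _ _ => hf n
    intro n hn
    obtain ⟨k, hk, rfl⟩ := mem_image.1 hn
    rw [mem_range] at hk
    rw [mem_Icc]
    omega
  refine (Finset.sum_le_sum this).trans ?_
  simp

/-- The first absolute moment of the count in short intervals. -/
theorem sum_abs_roughSum_sub_le {s₁ s₂ : Finset ℕ} (hs₁ : ∀ p ∈ s₁, p.Prime)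
    (hs₂ : ∀ p ∈ s₂, p.Prime) (hdisj : Disjoint s₁ s₂) {y D₁ D₂ σ₁ σ₂ : ℝ} (hy : 1 ≤ y)
    (hD₁ : 1 ≤ D₁) (hD₂ : 1 ≤ D₂) (hσ₁ : 0 ≤ σ₁) (hσ₂ : 0 ≤ σ₂)
    (hsy₁ : ∀ p ∈ s₁, (p : ℝ) ≤ y) (hsy₂ : ∀ p ∈ s₂, (p : ℝ) ≤ y) {X H : ℕ}
    (hlevel : (D₁ * D₂) ^ 2 ≤ X)
    (hsieve : ∀ Y : ℕ, ((X + H : ℕ) : ℝ) ≤ (Y + 1) * (D₂ * y) →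
      ∑ n ∈ Icc 1 Y, rough s₁ n ≤ 2 * dens s₁ * Y) :
    ∑ n ∈ range (X + 1), |roughSum (s₁ ∪ s₂) H n - H * dens (s₁ ∪ s₂)| ≤
      H * ((X + H : ℕ) * (2 * dens (s₁ ∪ s₂) * relErr s₂ D₂ σ₂ +
        relErr s₁ D₁ σ₁ * (1 + relErr s₂ D₂ σ₂))) +
      5 * (X + 1) * √(fullVar (s₁ ∪ s₂) H) := by
  set s := s₁ ∪ s₂ with hsdef
  have hs : ∀ p ∈ s, p.Prime := fun p hp => (mem_union.1 hp).elim (hs₁ p) (hs₂ p)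
  set D := levelFamily s₁ s₂ D₁ D₂ with hD
  have hmem : ∀ t ∈ D, ∃ a b, a ⊆ s₁ ∧ b ⊆ s₂ ∧ ((∏ p ∈ a, p : ℕ) : ℝ) ≤ D₁ ∧
      ((∏ p ∈ b, p : ℕ) : ℝ) ≤ D₂ ∧ a ∪ b = t := by
    intro t ht
    obtain ⟨⟨a, b⟩, hx, rfl⟩ := mem_image.1 ht
    simp only [mem_product, mem_filter, mem_powerset] at hx
    exact ⟨a, b, hx.1.1, hx.2.1, hx.1.2, hx.2.2, rfl⟩
  have hDs : D ⊆ s.powerset := by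
    intro t ht
    obtain ⟨a, b, ha, hb, -, -, rfl⟩ := hmem t ht
    exact mem_powerset.2 (Finset.union_subset_union ha hb)
  have hempty : ∅ ∈ D := by
    refine mem_image.2 ⟨(∅, ∅), ?_, by simp⟩
    simp [hD₁, hD₂]
  have hprod : ∀ t ∈ D, ((∏ p ∈ t, p : ℕ) : ℝ) ≤ D₁ * D₂ := by
    intro t ht
    obtain ⟨a, b, ha, hb, ha', hb', rfl⟩ := hmem t ht
    rw [Finset.prod_union (Finset.disjoint_of_subset_left ha
      (Finset.disjoint_of_subset_right hb hdisj)), Nat.cast_mul]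
    exact mul_le_mul ha' hb' (by positivity) (by linarith)
  have hDX : ∀ t ∈ D, ∀ t' ∈ D, (∏ p ∈ t, p) * ∏ p ∈ t', p ≤ X + 1 := by
    intro t ht t' ht'
    have h1 : (((∏ p ∈ t, p) * ∏ p ∈ t', p : ℕ) : ℝ) ≤ X := by
      rw [Nat.cast_mul]
      refine le_trans ?_ hlevel
      rw [sq]
      exact mul_le_mul (hprod t ht) (hprod t' ht') (by positivity) (by positivity)
    have h2 : (∏ p ∈ t, p) * ∏ p ∈ t', p ≤ X := by exact_mod_cast h1
    omega
  -- The range includes n = X because ⌊x⌋ takes that value at x = X.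
  have hvar := sum_range_truncSum_sq_le hs D hDs hempty H (X := X + 1) (by omega) hDX
  have htrunc : ∀ n, truncSum s D H n =
      ∑ h ∈ Icc 1 H, trunc s₁ D₁ (n + h) * trunc s₂ D₂ (n + h) := by
    intro n
    simp only [← dens_mul_sum_levelFamily hdisj, truncSum, kappaSum, ← Finset.mul_sum]
    rw [Finset.sum_comm]
  have hfirst : ∑ n ∈ range (X + 1), |roughSum s H n - truncSum s D H n| ≤
      H * ((X + H : ℕ) * (2 * dens s * relErr s₂ D₂ σ₂ +
        relErr s₁ D₁ σ₁ * (1 + relErr s₂ D₂ σ₂))) := by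
    have h1 : ∀ n, |roughSum s H n - truncSum s D H n| ≤ ∑ h ∈ Icc 1 H,
        |rough s₁ (n + h) * rough s₂ (n + h) - trunc s₁ D₁ (n + h) * trunc s₂ D₂ (n + h)| := by
      intro n
      rw [htrunc, roughSum, ← Finset.sum_sub_distrib]
      simp only [hsdef, rough_union hdisj]
      exact Finset.abs_sum_le_sum_abs _ _
    refine (Finset.sum_le_sum fun n _ => h1 n).trans ?_
    refine (sum_range_sum_shift_le (f := fun m => |rough s₁ m * rough s₂ m -
      trunc s₁ D₁ m * trunc s₂ D₂ m|) (fun _ => abs_nonneg _) X H).trans ?_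
    refine mul_le_mul_of_nonneg_left ?_ (by positivity)
    have := sum_abs_rough_sub_trunc_le hs₁ hs₂ hdisj hy hD₁ hD₂ hσ₁ hσ₂ hsy₁ hsy₂ hsieve
    rwa [← show dens s = dens s₁ * dens s₂ from Finset.prod_union hdisj] at this
  -- Cauchy–Schwarz, with 24 ≤ 5².
  have hsecond : ∑ n ∈ range (X + 1), |truncSum s D H n - H * dens s| ≤
      5 * (X + 1) * √(fullVar s H) := by
    have hV : 0 ≤ fullVar s H := by unfold fullVar; positivity
    have h2 : (∑ n ∈ range (X + 1), |truncSum s D H n - H * dens s|) ^ 2 ≤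
        (X + 1 : ℝ) * ∑ n ∈ range (X + 1), (truncSum s D H n - H * dens s) ^ 2 := by
      have := sq_sum_le_card_mul_sum_sq (s := range (X + 1))
        (f := fun n => |truncSum s D H n - H * dens s|)
      simpa [sq_abs] using this
    have h3 : (∑ n ∈ range (X + 1), |truncSum s D H n - H * dens s|) ^ 2 ≤
        (5 * (X + 1) * √(fullVar s H)) ^ 2 := by
      refine h2.trans ?_
      rw [mul_pow, mul_pow, Real.sq_sqrt hV]
      push_cast at hvar
      have h4 := mul_le_mul_of_nonneg_left hvar (by positivity : (0 : ℝ) ≤ X + 1)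
      have h5 : 0 ≤ ((X : ℝ) + 1) ^ 2 * fullVar s H := by positivity
      nlinarith
    exact (le_abs_self _).trans (abs_le_of_sq_le_sq h3 (by positivity))
  calc ∑ n ∈ range (X + 1), |roughSum s H n - H * dens s|
      ≤ ∑ n ∈ range (X + 1), (|roughSum s H n - truncSum s D H n| +
        |truncSum s D H n - H * dens s|) := Finset.sum_le_sum fun n _ => abs_sub_le _ _ _
    _ ≤ _ := by rw [Finset.sum_add_distrib]; exact add_le_add hfirst hsecond


/-! ### Estimates of Mertens type -/

theorem sum_log_primes_dvd_le {n : ℕ} (hn : 0 < n) (y : ℕ) :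
    ∑ p ∈ primesUpTo y, (if p ∣ n then Real.log p else 0) ≤ Real.log n := by
  rw [← Finset.sum_filter]
  have h1 : ∏ p ∈ (primesUpTo y).filter (· ∣ n), p ∣ n :=
    Finset.prod_primes_dvd n (fun p hp => (prime_of_mem_primesUpTo p (mem_filter.1 hp).1).prime)
      fun p hp => (mem_filter.1 hp).2
  have h2 : ((∏ p ∈ (primesUpTo y).filter (· ∣ n), p : ℕ) : ℝ) ≤ n := by
    exact_mod_cast Nat.le_of_dvd hn h1
  have h3 : ∑ p ∈ (primesUpTo y).filter (· ∣ n), Real.log p =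
      Real.log ((∏ p ∈ (primesUpTo y).filter (· ∣ n), p : ℕ) : ℝ) := by
    push_cast
    rw [Real.log_prod]
    intro p hp
    exact_mod_cast (prime_of_mem_primesUpTo p (mem_filter.1 hp).1).ne_zero
  rw [h3]
  refine Real.log_le_log ?_ h2
  have : 0 < ∏ p ∈ (primesUpTo y).filter (· ∣ n), p :=
    Finset.prod_pos fun p hp => (prime_of_mem_primesUpTo p (mem_filter.1 hp).1).pos
  exact_mod_cast this

/-- An upper bound of the Mertens type. -/
theorem sum_log_div_le {y : ℕ} (hy : 1 ≤ y) :
    ∑ p ∈ primesUpTo y, Real.log p / p ≤ 2 * Real.log y := by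
  have hy0 : (0 : ℝ) < y := by exact_mod_cast hy
  have h1 : ∑ n ∈ Icc 1 y, ∑ p ∈ primesUpTo y, (if p ∣ n then Real.log p else 0) ≤
      y * Real.log y := by
    calc _ ≤ ∑ n ∈ Icc 1 y, Real.log y := by
          refine Finset.sum_le_sum fun n hn => ?_
          rw [mem_Icc] at hn
          refine (sum_log_primes_dvd_le hn.1 y).trans (Real.log_le_log ?_ ?_)
          · exact_mod_cast hn.1
          · exact_mod_cast hn.2
      _ = _ := by simp
  have h2 : ∀ p ∈ primesUpTo y, y / 2 * (Real.log p / p) ≤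
      ∑ n ∈ Icc 1 y, (if p ∣ n then Real.log p else 0) := by
    intro p hp
    obtain ⟨hp1, hpy⟩ := mem_primesUpTo.1 hp
    have hp0 : (0 : ℝ) < p := by exact_mod_cast hp1.pos
    rw [← Finset.sum_filter, Finset.sum_const, nsmul_eq_mul]
    have hcard : ((Icc 1 y).filter (p ∣ ·)).card = y / p := Nat.Ioc_filter_dvd_card_eq_div y p
    rw [hcard]
    have hlog : 0 ≤ Real.log p := Real.log_natCast_nonneg p
    -- Since p ≤ y the integer quotient is at least 1, so rounding down loses at most a factor 2.
    have h3 : (y : ℝ) / (2 * p) ≤ (y / p : ℕ) := by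
      rw [div_le_iff₀ (by positivity)]
      have h4 := Nat.div_add_mod y p
      have h5 := Nat.mod_lt y hp1.pos
      have h6 : 1 ≤ y / p := Nat.div_pos hpy hp1.pos
      have h7 : y ≤ (y / p) * (2 * p) := by nlinarith
      exact_mod_cast h7
    calc y / 2 * (Real.log p / p) = y / (2 * p) * Real.log p := by field_simp
      _ ≤ _ := mul_le_mul_of_nonneg_right h3 hlog
  rw [Finset.sum_comm] at h1
  have h3 := (Finset.sum_le_sum h2).trans h1
  rw [← Finset.mul_sum] at h3
  have h4 : y * (∑ p ∈ primesUpTo y, Real.log p / p) ≤ y * (2 * Real.log y) := by linarith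
  exact le_of_mul_le_mul_left h4 hy0

/-- The function `n ↦ n ^ (-s)` as a monoid homomorphism. -/
noncomputable def powHom (s : ℝ) : ℕ →* ℝ where
  toFun n := (n : ℝ) ^ (-s)
  map_one' := by simp
  map_mul' m n := by
    push_cast
    exact Real.mul_rpow (by positivity) (by positivity)

theorem powHom_prime_lt_one {s : ℝ} (hs : 0 < s) {p : ℕ} (hp : p.Prime) : ‖powHom s p‖ < 1 := by
  have h1 : (1 : ℝ) < p := by exact_mod_cast hp.one_lt
  have h2 : powHom s p = (p : ℝ) ^ (-s) := rfl
  rw [h2, Real.norm_of_nonneg (by positivity)]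
  exact Real.rpow_lt_one_of_one_lt_of_neg h1 (by linarith)

theorem primesBelow_succ_eq (y : ℕ) : (y + 1).primesBelow = primesUpTo y := by
  ext p
  rw [Nat.mem_primesBelow, mem_primesUpTo]
  constructor
  · exact fun h => ⟨h.2, by omega⟩
  · exact fun h => ⟨by omega, h.1⟩

theorem P_pos (y : ℕ) : 0 < P y := dens_pos prime_of_mem_primesUpTo

/-- The Euler product 1 / P is the sum of 1 / n over all integers without prime factors above y;
this contains the harmonic sum up to y. -/
theorem P_le_one_div_log {y : ℕ} (hy : 2 ≤ y) : P y ≤ 1 / Real.log y := by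
  obtain ⟨hsum, hhas⟩ := EulerProduct.summable_and_hasSum_smoothNumbers_prod_primesBelow_geometric
    (f := powHom 1) (fun {p} hp => powHom_prime_lt_one one_pos hp) (y + 1)
  have hval : ∀ n, powHom 1 n = (n : ℝ)⁻¹ := fun n => by
    change (n : ℝ) ^ (-1 : ℝ) = _
    rw [Real.rpow_neg_one]
  have hlog : 0 < Real.log y := Real.log_pos (by exact_mod_cast hy)
  have hprod : ∏ p ∈ (y + 1).primesBelow, (1 - powHom 1 p)⁻¹ = (P y)⁻¹ := by
    rw [primesBelow_succ_eq, ← dens_primesUpTo, dens, Finset.prod_inv_distrib]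
    congr 1
    exact Finset.prod_congr rfl fun p _ => by rw [hval, one_div]
  rw [hprod] at hhas
  have hmem : ∀ n ∈ Icc 1 y, n ∈ (y + 1).smoothNumbers := fun n hn => by
    rw [mem_Icc] at hn
    exact Nat.mem_smoothNumbers_of_lt hn.1 (by omega)
  have h1 : ∑ n ∈ Icc 1 y, ((n : ℝ))⁻¹ ≤ (P y)⁻¹ := by
    have h2 := hhas.summable.sum_le_tsum ((Icc 1 y).subtype (· ∈ (y + 1).smoothNumbers))
      (fun n _ => by
        have : powHom 1 (n : ℕ) = ((n : ℕ) : ℝ) ^ (-1 : ℝ) := rfl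
        rw [this]; positivity)
    rw [hhas.tsum_eq] at h2
    refine le_trans (le_of_eq ?_) h2
    rw [Finset.sum_subtype_of_mem (f := fun n => powHom 1 n) hmem]
    exact Finset.sum_congr rfl fun n _ => (hval n).symm
  have h3 : Real.log y ≤ ∑ n ∈ Icc 1 y, ((n : ℝ))⁻¹ := by
    have h4 := log_add_one_le_harmonic y
    rw [harmonic_eq_sum_Icc] at h4
    push_cast at h4
    refine le_trans (Real.log_le_log ?_ ?_) h4
    · have : 0 < y := by omega
      exact_mod_cast this
    · linarith
  rw [le_div_iff₀ hlog]
  have h5 := h3.trans h1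
  rw [← mul_inv_cancel₀ (P_pos y).ne']
  exact mul_le_mul_of_nonneg_left h5 (P_pos y).le

/-- The partial Euler product at s = 1 + 1 / log y is at most ζ(s) ≤ 1 + 1 / (s − 1) = 1 + log y.
Passing from exponent s to 1 costs exp(2 e ∑ log p / p), at most exp 4 by `sum_log_div_le`. -/
theorem P_ge {y : ℕ} (hy : 2 ≤ y) : Real.exp (-4) / (1 + Real.log y) ≤ P y := by
  have hlog : 0 < Real.log y := Real.log_pos (by exact_mod_cast hy)
  set e : ℝ := 1 / Real.log y with he
  have he0 : 0 < e := by positivity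
  set s : ℝ := 1 + e with hs
  have hs1 : 1 < s := by linarith
  have hval : ∀ n, powHom s n = (n : ℝ) ^ (-s) := fun n => rfl
  have hsummable : Summable (powHom s) := by
    have := Real.summable_nat_rpow_inv.2 hs1
    refine this.congr fun n => ?_
    rw [hval, Real.rpow_neg (by positivity)]
  have hzeta : ∏ p ∈ primesUpTo y, (1 - powHom s p)⁻¹ ≤ 1 + Real.log y := by
    rw [← primesBelow_succ_eq,
      EulerProduct.prod_primesBelow_geometric_eq_tsum_smoothNumbers hsummable]
    have h1 : ∑' m : (y + 1).smoothNumbers, powHom s m ≤ ∑' n : ℕ, powHom s n :=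
      Summable.tsum_subtype_le _ _ (fun n => by rw [hval]; positivity) hsummable
    refine h1.trans ?_
    have h2 := ZetaAsymptotics.zeta_limit_aux1 hs1
    have h3 : 0 ≤ ZetaAsymptotics.termTSum s := tsum_nonneg fun n =>
      ZetaAsymptotics.term_nonneg _ _
    have h4 : ∑' n : ℕ, powHom s n = ∑' n : ℕ, 1 / (n + 1 : ℝ) ^ s := by
      rw [hsummable.tsum_eq_zero_add]
      have h0 : powHom s 0 = 0 := by
        rw [hval, Nat.cast_zero, Real.zero_rpow (by linarith)]
      rw [h0, zero_add]
      refine tsum_congr fun n => ?_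
      rw [hval, Real.rpow_neg (by positivity)]
      push_cast
      rw [one_div]
    have h5 : 1 / (s - 1) = Real.log y := by
      rw [hs, add_sub_cancel_left, he, one_div_one_div]
    rw [h4]
    rw [h5] at h2
    nlinarith
  -- The 2 in the exponent compensates the factor 1 − 1/p ≥ 1/2.
  have hcomp : ∀ p ∈ primesUpTo y, 1 - powHom s p ≤
      (1 - 1 / (p : ℝ)) * Real.exp (2 * e * (Real.log p / p)) := by
    intro p hp
    have hp1 := prime_of_mem_primesUpTo p hp
    have hp2 : (2 : ℝ) ≤ p := by exact_mod_cast hp1.two_le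
    have hp0 : (0 : ℝ) < p := by linarith
    have h1 : powHom s p = (p : ℝ)⁻¹ * Real.exp (-(e * Real.log p)) := by
      rw [hval, hs, neg_add, Real.rpow_add hp0, Real.rpow_neg_one, Real.rpow_def_of_pos hp0]
      congr 2; ring
    have h2 : 1 - e * Real.log p ≤ Real.exp (-(e * Real.log p)) := by
      have := Real.add_one_le_exp (-(e * Real.log p)); linarith
    have h3 : 1 + 2 * e * (Real.log p / p) ≤ Real.exp (2 * e * (Real.log p / p)) := by
      have := Real.add_one_le_exp (2 * e * (Real.log p / p)); linarith
    have hinv : (p : ℝ)⁻¹ ≤ 1 / 2 := by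
      rw [one_div]; exact inv_anti₀ (by norm_num) hp2
    have hlp : 0 ≤ Real.log p := Real.log_natCast_nonneg p
    have hip : 0 ≤ (p : ℝ)⁻¹ := by positivity
    rw [h1, one_div, div_eq_mul_inv] at *
    have h4 : (p : ℝ)⁻¹ * (1 - e * Real.log p) ≤ (p : ℝ)⁻¹ * Real.exp (-(e * Real.log p)) :=
      mul_le_mul_of_nonneg_left h2 hip
    have h5 : (1 - (p : ℝ)⁻¹) * (1 + 2 * e * (Real.log p * (p : ℝ)⁻¹)) ≤
        (1 - (p : ℝ)⁻¹) * Real.exp (2 * e * (Real.log p * (p : ℝ)⁻¹)) :=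
      mul_le_mul_of_nonneg_left h3 (by linarith)
    have h6 : 0 ≤ e * Real.log p * (p : ℝ)⁻¹ * (1 - 2 * (p : ℝ)⁻¹) := by
      have : 0 ≤ 1 - 2 * (p : ℝ)⁻¹ := by linarith
      positivity
    nlinarith
  have hpos : ∀ p ∈ primesUpTo y, 0 < 1 - powHom s p := fun p hp => by
    have := (Real.norm_eq_abs _ ▸ powHom_prime_lt_one (by linarith : 0 < s)
      (prime_of_mem_primesUpTo p hp))
    have := (abs_lt.1 this).2
    linarith
  have h1 : ∏ p ∈ primesUpTo y, (1 - powHom s p) ≤ P y * Real.exp 4 := by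
    calc _ ≤ ∏ p ∈ primesUpTo y, ((1 - 1 / (p : ℝ)) * Real.exp (2 * e * (Real.log p / p))) :=
          Finset.prod_le_prod (fun p hp => (hpos p hp).le) hcomp
      _ = P y * Real.exp (2 * e * ∑ p ∈ primesUpTo y, Real.log p / p) := by
          rw [Finset.prod_mul_distrib, ← Real.exp_sum, ← Finset.mul_sum]; rfl
      _ ≤ P y * Real.exp 4 := by
          refine mul_le_mul_of_nonneg_left (Real.exp_le_exp.2 ?_) (P_pos y).le
          have h2 := mul_le_mul_of_nonneg_left (sum_log_div_le (y := y) (by omega))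
            (by positivity : 0 ≤ 2 * e)
          refine h2.trans (le_of_eq ?_)
          rw [he]; field_simp; norm_num
  rw [Finset.prod_inv_distrib] at hzeta
  have hq : 0 < ∏ p ∈ primesUpTo y, (1 - powHom s p) := Finset.prod_pos hpos
  have h2 : 1 / (1 + Real.log y) ≤ ∏ p ∈ primesUpTo y, (1 - powHom s p) := by
    rw [one_div, inv_le_comm₀ (by linarith) hq]; exact hzeta
  rw [Real.exp_neg, div_le_iff₀ (by linarith), inv_le_iff_one_le_mul₀ (Real.exp_pos _)]
  have h3 := h2.trans h1
  rw [div_le_iff₀ (by linarith)] at h3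
  linarith

theorem sum_one_div_le {y : ℕ} (hy : 2 ≤ y) :
    ∑ p ∈ primesUpTo y, 1 / (p : ℝ) ≤ 4 + Real.log (1 + Real.log y) := by
  have hlog : 0 < Real.log y := Real.log_pos (by exact_mod_cast hy)
  have h1 : P y ≤ Real.exp (-∑ p ∈ primesUpTo y, 1 / (p : ℝ)) := by
    rw [← Finset.sum_neg_distrib, Real.exp_sum, ← dens_primesUpTo]
    refine Finset.prod_le_prod (fun p _ => dens_factor_nonneg p) fun p _ => ?_
    have := Real.add_one_le_exp (-(1 / (p : ℝ)))
    linarith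
  have h2 := (P_ge hy).trans h1
  have h3 := Real.log_le_log (by positivity) h2
  rw [Real.log_exp, Real.log_div (Real.exp_pos _).ne' (by linarith), Real.log_exp] at h3
  linarith


/-! ### Rankin products over small and large primes -/

theorem relErr_le_exp {s : Finset ℕ} (hs : ∀ p ∈ s, p.Prime) {D σ : ℝ} (hD : 0 ≤ D) :
    relErr s D σ ≤ D ^ (-σ) * Real.exp (3 * ∑ p ∈ s, (p : ℝ) ^ (σ - 1)) := by
  have hnn : ∀ p ∈ s, (0 : ℝ) ≤ (p : ℝ) ^ σ / ((p : ℝ) - 1) := fun p hp => by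
    have : (1 : ℝ) < p := by exact_mod_cast (hs p hp).one_lt
    have : 0 < (p : ℝ) - 1 := by linarith
    positivity
  have h1 : ∏ p ∈ s, (1 + (p : ℝ) ^ σ / ((p : ℝ) - 1)) ≤
      Real.exp (2 * ∑ p ∈ s, (p : ℝ) ^ (σ - 1)) := by
    rw [Finset.mul_sum, Real.exp_sum]
    refine Finset.prod_le_prod (fun p hp => by linarith [hnn p hp]) fun p hp => ?_
    have h2 : (2 : ℝ) ≤ p := by exact_mod_cast (hs p hp).two_le
    have h3 : (p : ℝ) ^ σ / ((p : ℝ) - 1) ≤ 2 * (p : ℝ) ^ (σ - 1) := by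
      rw [Real.rpow_sub_one (by linarith), ← mul_div_assoc,
        div_le_div_iff₀ (by linarith) (by linarith)]
      have : 0 ≤ (p : ℝ) ^ σ := by positivity
      nlinarith
    linarith [Real.add_one_le_exp (2 * (p : ℝ) ^ (σ - 1))]
  have h2 : ∏ p ∈ s, (1 + (p : ℝ) ^ (σ - 1)) ≤ Real.exp (∑ p ∈ s, (p : ℝ) ^ (σ - 1)) := by
    rw [Real.exp_sum]
    refine Finset.prod_le_prod (fun p _ => by positivity) fun p _ => ?_
    linarith [Real.add_one_le_exp ((p : ℝ) ^ (σ - 1))]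
  have h3 : (3 : ℝ) * ∑ p ∈ s, (p : ℝ) ^ (σ - 1) =
      2 * ∑ p ∈ s, (p : ℝ) ^ (σ - 1) + ∑ p ∈ s, (p : ℝ) ^ (σ - 1) := by ring
  rw [relErr, mul_assoc, h3, Real.exp_add]
  refine mul_le_mul_of_nonneg_left ?_ (by positivity)
  exact mul_le_mul h1 h2 (Finset.prod_nonneg fun p _ => by positivity) (Real.exp_pos _).le

/-- The primes up to `y` that are at most `z`. -/
noncomputable def smallPrimes (y : ℕ) (z : ℝ) : Finset ℕ :=
  (primesUpTo y).filter fun p => (p : ℝ) ≤ z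

/-- The primes up to `y` that exceed `z`. -/
noncomputable def largePrimes (y : ℕ) (z : ℝ) : Finset ℕ :=
  (primesUpTo y).filter fun p => ¬ (p : ℝ) ≤ z

theorem prime_of_mem_smallPrimes {y : ℕ} {z : ℝ} : ∀ p ∈ smallPrimes y z, p.Prime :=
  fun p hp => prime_of_mem_primesUpTo p (mem_filter.1 hp).1

theorem prime_of_mem_largePrimes {y : ℕ} {z : ℝ} : ∀ p ∈ largePrimes y z, p.Prime :=
  fun p hp => prime_of_mem_primesUpTo p (mem_filter.1 hp).1

theorem smallPrimes_union_largePrimes (y : ℕ) (z : ℝ) :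
    smallPrimes y z ∪ largePrimes y z = primesUpTo y :=
  Finset.filter_union_filter_not_eq _ _

theorem disjoint_smallPrimes_largePrimes (y : ℕ) (z : ℝ) :
    Disjoint (smallPrimes y z) (largePrimes y z) :=
  Finset.disjoint_filter_filter_not _ _ _

theorem smallPrimes_le (y : ℕ) (z : ℝ) : ∀ p ∈ smallPrimes y z, (p : ℝ) ≤ y := fun p hp => by
  exact_mod_cast (mem_primesUpTo.1 (mem_filter.1 hp).1).2

theorem largePrimes_le (y : ℕ) (z : ℝ) : ∀ p ∈ largePrimes y z, (p : ℝ) ≤ y := fun p hp => by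
  exact_mod_cast (mem_primesUpTo.1 (mem_filter.1 hp).1).2

/-- Inserting log p / log z ≥ 1 reduces this to the sum of log p / p. For z = y^(1/K) no log log y
remains, which is the point of separating the large primes. -/
theorem sum_largePrimes_rpow_le {y : ℕ} {z σ : ℝ} (hy : 1 ≤ y) (hz : 1 < z) (hσ : 0 ≤ σ) :
    ∑ p ∈ largePrimes y z, (p : ℝ) ^ (σ - 1) ≤ (y : ℝ) ^ σ * (2 * Real.log y / Real.log z) := by
  have hlz : 0 < Real.log z := Real.log_pos hz
  calc ∑ p ∈ largePrimes y z, (p : ℝ) ^ (σ - 1)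
      ≤ ∑ p ∈ largePrimes y z, (y : ℝ) ^ σ / Real.log z * (Real.log p / p) := by
        refine Finset.sum_le_sum fun p hp => ?_
        have hp0 : (0 : ℝ) < p := by exact_mod_cast (prime_of_mem_largePrimes p hp).pos
        have hzp : z < p := not_le.1 (mem_filter.1 hp).2
        rw [Real.rpow_sub_one hp0.ne']
        have h1 : (p : ℝ) ^ σ ≤ (y : ℝ) ^ σ :=
          Real.rpow_le_rpow hp0.le (largePrimes_le y z p hp) hσ
        have h2 : 1 ≤ Real.log p / Real.log z :=
          (one_le_div hlz).2 (Real.log_le_log (by linarith) hzp.le)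
        calc (p : ℝ) ^ σ / p ≤ (y : ℝ) ^ σ / p := by gcongr
          _ ≤ (y : ℝ) ^ σ / p * (Real.log p / Real.log z) := le_mul_of_one_le_right (by positivity) h2
          _ = _ := by ring
    _ = (y : ℝ) ^ σ / Real.log z * ∑ p ∈ largePrimes y z, Real.log p / p := by
        rw [Finset.mul_sum]
    _ ≤ (y : ℝ) ^ σ / Real.log z * (2 * Real.log y) := by
        refine mul_le_mul_of_nonneg_left (le_trans ?_ (sum_log_div_le hy)) (by positivity)
        refine Finset.sum_le_sum_of_subset_of_nonneg (Finset.filter_subset _ _) fun p _ _ => ?_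
        exact div_nonneg (Real.log_natCast_nonneg p) (by positivity)
    _ = _ := by ring

/-- From 1 − x ≤ exp(−x) one has p ^ σ ≤ 1 + σ log p · p ^ σ; the first part gives the sum of 1/p,
the second the sum of log p / p up to z. -/
theorem sum_smallPrimes_rpow_le {y : ℕ} {z σ : ℝ} (hy : 2 ≤ y) (hz : 1 < z) (hσ : 0 ≤ σ) :
    ∑ p ∈ smallPrimes y z, (p : ℝ) ^ (σ - 1) ≤
      4 + Real.log (1 + Real.log y) + σ * z ^ σ * (2 * Real.log z) := by
  have h0 : ∀ p ∈ smallPrimes y z, (p : ℝ) ^ (σ - 1) ≤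
      1 / p + σ * z ^ σ * (Real.log p / p) := by
    intro p hp
    have hp0 : (0 : ℝ) < p := by exact_mod_cast (prime_of_mem_smallPrimes p hp).pos
    have hpz : (p : ℝ) ≤ z := (mem_filter.1 hp).2
    have hlog : 0 ≤ Real.log p := Real.log_natCast_nonneg p
    have h1 : (p : ℝ) ^ σ ≤ z ^ σ := Real.rpow_le_rpow hp0.le hpz hσ
    have h2 : (p : ℝ) ^ σ ≤ 1 + σ * Real.log p * (p : ℝ) ^ σ := by
      have h3 := Real.add_one_le_exp (-(Real.log p * σ))
      rw [Real.exp_neg, ← Real.rpow_def_of_pos hp0] at h3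
      have h4 : 0 < (p : ℝ) ^ σ := by positivity
      have h5 := mul_le_mul_of_nonneg_right h3 h4.le
      rw [inv_mul_cancel₀ h4.ne'] at h5
      linarith
    have h3 : (p : ℝ) ^ σ ≤ 1 + σ * Real.log p * z ^ σ :=
      h2.trans (by gcongr)
    rw [Real.rpow_sub_one hp0.ne']
    calc (p : ℝ) ^ σ / p ≤ (1 + σ * Real.log p * z ^ σ) / p := by gcongr
      _ = _ := by ring
  refine (Finset.sum_le_sum h0).trans ?_
  rw [Finset.sum_add_distrib, ← Finset.mul_sum]
  refine add_le_add ?_ ?_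
  · refine le_trans ?_ (sum_one_div_le hy)
    exact Finset.sum_le_sum_of_subset_of_nonneg (Finset.filter_subset _ _) fun p _ _ => by
      positivity
  · refine mul_le_mul_of_nonneg_left ?_ (by positivity)
    have h1 : 1 ≤ ⌊z⌋₊ := Nat.one_le_floor_iff z |>.2 hz.le
    have h2 := sum_log_div_le h1
    have h3 : Real.log ⌊z⌋₊ ≤ Real.log z :=
      Real.log_le_log (by exact_mod_cast h1) (Nat.floor_le (by linarith))
    refine le_trans ?_ (h2.trans (by linarith))
    refine Finset.sum_le_sum_of_subset_of_nonneg ?_ fun p _ _ =>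
      div_nonneg (Real.log_natCast_nonneg p) (by positivity)
    intro p hp
    exact mem_primesUpTo.2 ⟨prime_of_mem_smallPrimes p hp, Nat.le_floor (mem_filter.1 hp).2⟩

/-! ### Lower bounds for the main term from large moduli -/

/-- The normalizing factor of the weights `∏ 1 / (p - 2)`. -/
noncomputable def oddFactor (y : ℕ) : ℝ := ∏ p ∈ oddPrimesUpTo y, (((p : ℝ) - 2) / ((p : ℝ) - 1))

theorem two_lt_of_mem_odd {y p : ℕ} (hp : p ∈ oddPrimesUpTo y) : (2 : ℝ) < p := by
  exact_mod_cast (mem_oddPrimesUpTo.1 hp).2.1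

theorem P_eq_odd {y : ℕ} (hy : 2 ≤ y) : P y = 1 / 2 * ∏ p ∈ oddPrimesUpTo y, (1 - 1 / (p : ℝ)) := by
  rw [← dens_primesUpTo, dens, primesUpTo_eq_insert hy,
    Finset.prod_insert (two_notMem_oddPrimesUpTo y)]
  norm_num

theorem oddFactor_nonneg (y : ℕ) : 0 ≤ oddFactor y := Finset.prod_nonneg fun p hp => by
  have := two_lt_of_mem_odd hp
  exact div_nonneg (by linarith) (by linarith)

theorem oddFactor_ge {y : ℕ} (hy : 2 ≤ y) : P y ^ 2 ≤ oddFactor y := by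
  have h1 : (∏ p ∈ oddPrimesUpTo y, (1 - 1 / (p : ℝ))) ^ 2 ≤ oddFactor y := by
    rw [← Finset.prod_pow]
    refine Finset.prod_le_prod (fun p _ => by positivity) fun p hp => ?_
    have h2 : (3 : ℝ) ≤ p := by exact_mod_cast (mem_oddPrimesUpTo.1 hp).2.1
    have h3 : (1 - 1 / (p : ℝ)) ^ 2 = ((p : ℝ) - 1) ^ 2 / (p : ℝ) ^ 2 := by
      field_simp
    rw [h3, div_le_div_iff₀ (by positivity) (by linarith)]
    nlinarith [mul_nonneg (by linarith : (0 : ℝ) ≤ p - 3) (by linarith : (0 : ℝ) ≤ p)]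
  rw [P_eq_odd hy]
  have h4 : 0 ≤ (∏ p ∈ oddPrimesUpTo y, (1 - 1 / (p : ℝ))) ^ 2 := by positivity
  nlinarith

theorem fracTerm_ge {H m : ℕ} (hm : 0 < m) (hHm : H ≤ m) :
    (H : ℝ) / (4 * m) ≤ fracTerm H (2 * m) := by
  have hm' : (0 : ℝ) < m := by exact_mod_cast hm
  have hHm' : (H : ℝ) ≤ m := by exact_mod_cast hHm
  have h1 : (H : ℝ) / (2 * m) ≤ 1 / 2 := by
    rw [div_le_div_iff₀ (by positivity) (by norm_num)]; linarith
  have h0 : 0 ≤ (H : ℝ) / (2 * m) := by positivity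
  have h2 : Int.fract ((H : ℝ) / (2 * m)) = H / (2 * m) :=
    Int.fract_eq_self.2 ⟨h0, by linarith⟩
  rw [fracTerm, h2]
  have h3 : (H : ℝ) / (4 * m) = H / (2 * m) * (1 / 2) := by ring
  rw [h3]
  exact mul_le_mul_of_nonneg_left (by linarith) h0

/-- The main term is at least its part from the moduli that exceed `H`. -/
theorem M_ge_sum {y : ℕ} (hy : 2 ≤ y) (H : ℕ) :
    H * P y / 2 * (oddFactor y * ∑ t ∈ (oddPrimesUpTo y).powerset with H ≤ ∏ p ∈ t, p,
      ∏ p ∈ t, 1 / ((p : ℝ) - 2)) ≤ M H y := by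
  have hW : ∏ p ∈ oddPrimesUpTo y, (1 - 2 / (p : ℝ)) = oddFactor y * (2 * P y) := by
    rw [P_eq_odd hy, oddFactor]
    have : ∀ x : ℝ, 2 * (1 / 2 * x) = x := fun x => by ring
    rw [this, ← Finset.prod_mul_distrib]
    refine Finset.prod_congr rfl fun p hp => ?_
    have := two_lt_of_mem_odd hp
    have h1 : (p : ℝ) - 1 ≠ 0 := by linarith
    field_simp
  rw [M_eq_sum, hW]
  -- For a modulus m ≥ H the number H / (2m) is its own fractional part and at most 1/2; dividing by
  -- m turns the weights p / (p − 2) into 1 / (p − 2).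
  have hkey : H / 4 * ∑ t ∈ (oddPrimesUpTo y).powerset with H ≤ ∏ p ∈ t, p,
      ∏ p ∈ t, 1 / ((p : ℝ) - 2) ≤ ∑ t ∈ (oddPrimesUpTo y).powerset,
        (∏ p ∈ t, (p : ℝ) / ((p : ℝ) - 2)) * fracTerm H (2 * (∏ p ∈ t, p : ℕ)) := by
    have hnn : ∀ t ∈ (oddPrimesUpTo y).powerset, 0 ≤ ∏ p ∈ t, (p : ℝ) / ((p : ℝ) - 2) :=
      fun t ht => Finset.prod_nonneg fun p hp => by
        have := two_lt_of_mem_odd (mem_powerset.1 ht hp)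
        exact div_nonneg (by linarith) (by linarith)
    refine le_trans ?_ (Finset.sum_le_sum_of_subset_of_nonneg (Finset.filter_subset
      (fun t => H ≤ ∏ p ∈ t, p) _) fun t ht _ => mul_nonneg (hnn t ht) (fracTerm_nonneg _ _))
    rw [Finset.mul_sum]
    refine Finset.sum_le_sum fun t ht => ?_
    obtain ⟨ht, hH⟩ := mem_filter.1 ht
    have hpos : 0 < ∏ p ∈ t, p := Finset.prod_pos fun p hp =>
      (oddPrimesUpTo_prime p (mem_powerset.1 ht hp)).pos
    refine le_trans (le_of_eq ?_) (mul_le_mul_of_nonneg_left (fracTerm_ge hpos hH) (hnn t ht))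
    have h1 : ∏ p ∈ t, (p : ℝ) / ((p : ℝ) - 2) =
        (∏ p ∈ t, 1 / ((p : ℝ) - 2)) * (∏ p ∈ t, p : ℕ) := by
      push_cast
      rw [← Finset.prod_mul_distrib]
      exact Finset.prod_congr rfl fun p _ => by ring
    rw [h1]
    have : ((∏ p ∈ t, p : ℕ) : ℝ) ≠ 0 := by positivity
    generalize ((∏ p ∈ t, p : ℕ) : ℝ) = m at *
    field_simp
  refine le_trans (le_of_eq ?_) (mul_le_mul_of_nonneg_left hkey
    (mul_nonneg (oddFactor_nonneg y) (by linarith [P_pos y])))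
  ring

/-- For intervals short in comparison with `y` the main term is of the size of the mean. -/
theorem M_ge_of_short {y H : ℕ} (hH : 2 ≤ H) (hHy : H ≤ y)
    (h : 2 * Real.exp 4 * (1 + Real.log H) ≤ Real.log y) : H * P y / 4 ≤ M H y := by
  have hy : 2 ≤ y := hH.trans hHy
  -- The normalized weights form a probability measure on sets of odd primes, and `M_ge_sum`
  -- involves the probability that the product is at least H.
  have hfac : oddFactor y * ∏ p ∈ oddPrimesUpTo y, (1 + 1 / ((p : ℝ) - 2)) = 1 := by
    rw [oddFactor, ← Finset.prod_mul_distrib]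
    refine Finset.prod_eq_one fun p hp => ?_
    have := two_lt_of_mem_odd hp
    have h1 : (p : ℝ) - 1 ≠ 0 := by linarith
    have h2 : (p : ℝ) - 2 ≠ 0 := by linarith
    field_simp
    ring
  have hsub : oddPrimesUpTo H ⊆ oddPrimesUpTo y := fun p hp => by
    rw [mem_oddPrimesUpTo] at *
    exact ⟨hp.1, hp.2.1, hp.2.2.trans hHy⟩
  have hnn : ∀ t ⊆ oddPrimesUpTo y, 0 ≤ ∏ p ∈ t, 1 / ((p : ℝ) - 2) :=
    fun t ht => Finset.prod_nonneg fun p hp => by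
      have := two_lt_of_mem_odd (ht hp)
      exact div_nonneg (by linarith) (by linarith)
  -- the complementary part is small
  have hsmall : ∑ t ∈ (oddPrimesUpTo y).powerset with ¬ H ≤ ∏ p ∈ t, p,
      ∏ p ∈ t, 1 / ((p : ℝ) - 2) ≤ ∏ p ∈ oddPrimesUpTo H, (1 + 1 / ((p : ℝ) - 2)) := by
    rw [Finset.prod_one_add]
    -- A product below H uses only primes up to H, so its probability is at most that of avoiding
    -- all primes in (H, y].
    refine Finset.sum_le_sum_of_subset_of_nonneg ?_ fun t ht _ =>
      hnn t ((mem_powerset.1 ht).trans hsub)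
    intro t ht
    obtain ⟨ht, hlt⟩ := mem_filter.1 ht
    have ht := mem_powerset.1 ht
    rw [mem_powerset]
    intro p hp
    have h1 := mem_oddPrimesUpTo.1 (ht hp)
    have h2 : p ≤ ∏ p ∈ t, p := Nat.le_of_dvd (Finset.prod_pos fun q hq =>
      (oddPrimesUpTo_prime q (ht hq)).pos) (Finset.dvd_prod_of_mem _ hp)
    exact mem_oddPrimesUpTo.2 ⟨h1.1, h1.2.1, by omega⟩
  have hratio : oddFactor y * ∏ p ∈ oddPrimesUpTo H, (1 + 1 / ((p : ℝ) - 2)) ≤ P y / P H := by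
    rw [P_eq_odd hy, P_eq_odd hH, oddFactor, ← Finset.prod_sdiff hsub, ← Finset.prod_sdiff
      (f := fun p : ℕ => (1 - 1 / (p : ℝ))) hsub]
    have e1 : (∏ p ∈ oddPrimesUpTo H, (((p : ℝ) - 2) / ((p : ℝ) - 1))) *
        ∏ p ∈ oddPrimesUpTo H, (1 + 1 / ((p : ℝ) - 2)) = 1 := by
      rw [← Finset.prod_mul_distrib]
      refine Finset.prod_eq_one fun p hp => ?_
      have := two_lt_of_mem_odd hp
      have h1 : (p : ℝ) - 1 ≠ 0 := by linarith
      have h2 : (p : ℝ) - 2 ≠ 0 := by linarith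
      field_simp
      ring
    rw [mul_assoc, e1, mul_one]
    have e2 : 0 < ∏ p ∈ oddPrimesUpTo H, (1 - 1 / (p : ℝ)) := dens_pos oddPrimesUpTo_prime
    have e3 : 1 / 2 * ((∏ p ∈ oddPrimesUpTo y \ oddPrimesUpTo H, (1 - 1 / (p : ℝ))) *
        ∏ p ∈ oddPrimesUpTo H, (1 - 1 / (p : ℝ))) /
        (1 / 2 * ∏ p ∈ oddPrimesUpTo H, (1 - 1 / (p : ℝ))) =
        ∏ p ∈ oddPrimesUpTo y \ oddPrimesUpTo H, (1 - 1 / (p : ℝ)) := by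
      field_simp
    rw [e3]
    refine Finset.prod_le_prod ?_ ?_
    · intro p hp
      have := two_lt_of_mem_odd (mem_sdiff.1 hp).1
      exact div_nonneg (by linarith) (by linarith)
    · intro p hp
      have := two_lt_of_mem_odd (mem_sdiff.1 hp).1
      rw [one_sub_div (by linarith), div_le_div_iff₀ (by linarith) (by linarith)]
      nlinarith
  have hlogy : 0 < Real.log y := Real.log_pos (by exact_mod_cast hy)
  have hlogH : 0 < Real.log H := Real.log_pos (by exact_mod_cast hH)
  have hhalf : P y / P H ≤ 1 / 2 := by
    rw [div_le_iff₀ (P_pos H)]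
    refine (P_le_one_div_log hy).trans ?_
    have h1 := P_ge hH
    refine le_trans ?_ (mul_le_mul_of_nonneg_left h1 (by norm_num))
    rw [Real.exp_neg, inv_eq_one_div, div_div, one_div_mul_one_div,
      div_le_div_iff₀ hlogy (by positivity)]
    linarith
  have hsplit := Finset.sum_filter_add_sum_filter_not (oddPrimesUpTo y).powerset
    (fun t => H ≤ ∏ p ∈ t, p) (fun t => ∏ p ∈ t, 1 / ((p : ℝ) - 2))
  rw [← Finset.prod_one_add] at hsplit
  have h5 := mul_le_mul_of_nonneg_left hsmall (oddFactor_nonneg y)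
  have h6 : 1 / 2 ≤ oddFactor y * ∑ t ∈ (oddPrimesUpTo y).powerset with H ≤ ∏ p ∈ t, p,
      ∏ p ∈ t, 1 / ((p : ℝ) - 2) := by
    rw [← hsplit, mul_add] at hfac
    linarith
  refine le_trans ?_ (M_ge_sum hy H)
  have h7 : 0 ≤ H * P y / 2 := by
    have := P_pos y
    positivity
  calc H * P y / 4 = H * P y / 2 * (1 / 2) := by ring
    _ ≤ _ := mul_le_mul_of_nonneg_left h6 h7

/-- A lower bound for the main term from the products of `r` primes. -/
theorem M_ge_of_subset {y H r : ℕ} (hy : 2 ≤ y) (hr : 0 < r) {T : Finset ℕ}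
    (hT : T ⊆ oddPrimesUpTo y) {B : ℝ} (hB : 0 ≤ B) (hTB : ∀ p ∈ T, B ≤ p) (hHB : (H : ℝ) ≤ B ^ r)
    (hcard : 2 * r ≤ T.card) :
    H * P y / 2 * (P y ^ 2 * ((T.card : ℝ) / (2 * r * y)) ^ r) ≤ M H y := by
  have hPp := P_pos y
  have hy0 : (0 : ℝ) < y := by exact_mod_cast (by omega : 0 < y)
  have hr0 : (0 : ℝ) < r := by exact_mod_cast hr
  refine le_trans ?_ (M_ge_sum hy H)
  refine mul_le_mul_of_nonneg_left ?_ (by positivity)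
  refine mul_le_mul (oddFactor_ge hy) ?_ (by positivity) (oddFactor_nonneg y)
  have hsub : T.powersetCard r ⊆ (oddPrimesUpTo y).powerset.filter fun t => H ≤ ∏ p ∈ t, p := by
    intro t ht
    obtain ⟨h1, h2⟩ := mem_powersetCard.1 ht
    refine mem_filter.2 ⟨mem_powerset.2 (h1.trans hT), ?_⟩
    have h3 : (H : ℝ) ≤ (∏ p ∈ t, p : ℕ) := by
      refine hHB.trans ?_
      push_cast
      rw [← h2, ← Finset.prod_const]
      exact Finset.prod_le_prod (fun _ _ => hB) fun p hp => hTB p (h1 hp)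
    exact_mod_cast h3
  have hnn : ∀ t ⊆ oddPrimesUpTo y, 0 ≤ ∏ p ∈ t, 1 / ((p : ℝ) - 2) :=
    fun t ht => Finset.prod_nonneg fun p hp => by
      have := two_lt_of_mem_odd (ht hp)
      exact div_nonneg (by linarith) (by linarith)
  refine le_trans ?_ (Finset.sum_le_sum_of_subset_of_nonneg hsub fun t ht _ =>
    hnn t (mem_powerset.1 (mem_filter.1 ht).1))
  have hterm : ∀ t ∈ T.powersetCard r, (1 / (y : ℝ)) ^ r ≤ ∏ p ∈ t, 1 / ((p : ℝ) - 2) := by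
    intro t ht
    obtain ⟨h1, h2⟩ := mem_powersetCard.1 ht
    rw [← h2, ← Finset.prod_const]
    refine Finset.prod_le_prod (fun _ _ => by positivity) fun p hp => ?_
    have h3 := two_lt_of_mem_odd (hT (h1 hp))
    have h4 : (p : ℝ) ≤ y := by exact_mod_cast (mem_oddPrimesUpTo.1 (hT (h1 hp))).2.2
    exact one_div_le_one_div_of_le (by linarith) (by linarith)
  refine le_trans ?_ (Finset.sum_le_sum hterm)
  rw [Finset.sum_const, Finset.card_powersetCard, nsmul_eq_mul]
  -- As 2 r ≤ |T|, each of the r factors in the numerator of the binomial coefficient is at least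
  -- |T| / 2, and r! ≤ r ^ r.
  have hchoose : ((T.card : ℝ) / (2 * r)) ^ r ≤ (T.card.choose r : ℝ) := by
    refine le_trans ?_ (Nat.pow_le_choose r T.card)
    have h1 : (T.card : ℝ) / 2 ≤ (T.card + 1 - r : ℕ) := by
      have : T.card ≤ 2 * (T.card + 1 - r) := by omega
      have h2 : (T.card : ℝ) ≤ 2 * (T.card + 1 - r : ℕ) := by exact_mod_cast this
      linarith
    have h3 : ((r.factorial : ℕ) : ℝ) ≤ (r : ℝ) ^ r := by exact_mod_cast Nat.factorial_le_pow r
    rw [← div_div, div_pow]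
    gcongr
  calc ((T.card : ℝ) / (2 * r * y)) ^ r = ((T.card : ℝ) / (2 * r)) ^ r * (1 / (y : ℝ)) ^ r := by
        rw [← mul_pow]; congr 1; field_simp
    _ ≤ _ := mul_le_mul_of_nonneg_right hchoose (by positivity)


/-! ### Choice of the Rankin exponents and the first moment for longer intervals -/

/-- The exponent is chosen so that y ^ σ = u ^ (1 − η): the Rankin product then costs O(u ^ (1 −
η)), of lower order than u log u, while D ^ (−σ) saves nearly (u log u) / 2. -/
theorem relErr_largePrimes_le {y : ℕ} {X η K u : ℝ} (hy : 2 ≤ y) (hK : 0 < K) (hη1 : η ≤ 1)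
    (hu : 1 ≤ u) (hX0 : 0 < X) (hX : Real.log X = u * Real.log y) :
    relErr (largePrimes y (Real.exp (Real.log y / K))) (X ^ (1 / 2 - 2 * η))
      ((1 - η) * Real.log u / Real.log y) ≤
    Real.exp (-((1 / 2 - 2 * η) * (1 - η) * (u * Real.log u)) + 6 * K * u ^ (1 - η)) := by
  have hly : 0 < Real.log y := Real.log_pos (by exact_mod_cast hy)
  have hy0 : (0 : ℝ) < y := by exact_mod_cast (by omega : 0 < y)
  have hL : 0 ≤ Real.log u := Real.log_nonneg hu
  set σ := (1 - η) * Real.log u / Real.log y with hσ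
  have hσ0 : 0 ≤ σ := div_nonneg (mul_nonneg (by linarith) hL) hly.le
  have hz : 1 < Real.exp (Real.log y / K) := Real.one_lt_exp_iff.2 (by positivity)
  refine (relErr_le_exp prime_of_mem_largePrimes (by positivity)).trans ?_
  have h1 := sum_largePrimes_rpow_le (y := y) (by omega) hz hσ0
  have h2 : (y : ℝ) ^ σ = u ^ (1 - η) := by
    rw [Real.rpow_def_of_pos hy0, Real.rpow_def_of_pos (by linarith), hσ]
    congr 1; field_simp
  rw [h2, Real.log_exp] at h1
  have h3 : 2 * Real.log y / (Real.log y / K) = 2 * K := by field_simp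
  rw [h3] at h1
  have h4 : (X ^ (1 / 2 - 2 * η)) ^ (-σ) =
      Real.exp (-((1 / 2 - 2 * η) * (1 - η) * (u * Real.log u))) := by
    rw [← Real.rpow_mul hX0.le, Real.rpow_def_of_pos hX0, hX, hσ]
    congr 1; field_simp
  rw [h4, Real.exp_add]
  refine mul_le_mul_of_nonneg_left (Real.exp_le_exp.2 ?_) (Real.exp_pos _).le
  linarith

/-- With z = y^(1/K) the exponent may be larger by a factor of order K and still z ^ σ = √u. The
saving η K / 2 · u log u is made as large a multiple of u log u as desired by the choice of K. -/
theorem relErr_smallPrimes_le {y : ℕ} {X η K u : ℝ} (hy : 2 ≤ y) (hK : 0 < K)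
    (hu : 1 ≤ u) (hX0 : 0 < X) (hX : Real.log X = u * Real.log y) :
    relErr (smallPrimes y (Real.exp (Real.log y / K))) (X ^ η)
      (K * Real.log u / (2 * Real.log y)) ≤
    Real.exp (-(η * K / 2 * (u * Real.log u)) + (12 + 3 * Real.log (1 + Real.log y) +
      3 * Real.log u * Real.exp (Real.log u / 2))) := by
  have hly : 0 < Real.log y := Real.log_pos (by exact_mod_cast hy)
  have hL : 0 ≤ Real.log u := Real.log_nonneg hu
  set σ := K * Real.log u / (2 * Real.log y) with hσ
  have hσ0 : 0 ≤ σ := by positivity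
  have hz : 1 < Real.exp (Real.log y / K) := Real.one_lt_exp_iff.2 (by positivity)
  refine (relErr_le_exp prime_of_mem_smallPrimes (by positivity)).trans ?_
  have h1 := sum_smallPrimes_rpow_le hy hz hσ0
  have h2 : Real.exp (Real.log y / K) ^ σ = Real.exp (Real.log u / 2) := by
    rw [← Real.exp_mul, hσ]
    congr 1; field_simp
  rw [h2, Real.log_exp] at h1
  have h3 : σ * Real.exp (Real.log u / 2) * (2 * (Real.log y / K)) =
      Real.log u * Real.exp (Real.log u / 2) := by rw [hσ]; field_simp
  rw [h3] at h1
  have h4 : (X ^ η) ^ (-σ) = Real.exp (-(η * K / 2 * (u * Real.log u))) := by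
    rw [← Real.rpow_mul hX0.le, Real.rpow_def_of_pos hX0, hX, hσ]
    congr 1; field_simp
  rw [h4, Real.exp_add]
  refine mul_le_mul_of_nonneg_left (Real.exp_le_exp.2 ?_) (Real.exp_pos _).le
  linarith

theorem dens_le_dens_of_subset {s t : Finset ℕ} (h : s ⊆ t) : dens t ≤ dens s := by
  rw [dens, ← Finset.prod_sdiff h]
  exact mul_le_of_le_one_left (dens_nonneg s) (dens_le_one _)

theorem sum_rough_le_relErr {s : Finset ℕ} (hs : ∀ p ∈ s, p.Prime) {D σ : ℝ}
    (hD : 1 ≤ D) (hσ : 0 ≤ σ) (N : ℕ) :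
    ∑ n ∈ Icc 1 N, rough s n ≤ N * dens s + D + 2 * N * relErr s D σ := by
  refine (sum_rough_le hs hD hσ N).trans ?_
  have h1 := one_le_prod_fst hs σ
  have h2 : 0 ≤ ∏ p ∈ s, (1 + (p : ℝ) ^ (σ - 1)) := Finset.prod_nonneg fun p _ => by positivity
  have h3 : D ^ (-σ) * ∏ p ∈ s, (1 + (p : ℝ) ^ (σ - 1)) ≤ relErr s D σ := by
    rw [relErr]
    refine mul_le_mul_of_nonneg_right ?_ h2
    exact le_mul_of_one_le_right (Real.rpow_nonneg (by linarith) _) h1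
  have h4 := mul_le_mul_of_nonneg_left h3 (by positivity : (0 : ℝ) ≤ 2 * N)
  linarith

theorem relErr_nonneg {s : Finset ℕ} (hs : ∀ p ∈ s, p.Prime) {D σ : ℝ} (hD : 0 ≤ D) :
    0 ≤ relErr s D σ := by
  have h1 := one_le_prod_fst hs σ
  have h2 : 0 ≤ ∏ p ∈ s, (1 + (p : ℝ) ^ (σ - 1)) := Finset.prod_nonneg fun p _ => by positivity
  exact mul_nonneg (mul_nonneg (by positivity) (by linarith)) h2

/-- The hypothesis reads Λ ≤ (1 − δ) u log log H. It also implies u ≥ log H / log log H, so log u ≥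
(1 − η) log log H, and log log H may be replaced by log u at a cost absorbed by δ ≥ 8η. -/
theorem mul_log_ge_of_condition {η δ u l l2 ly : ℝ} (hη : 0 < η) (hηδ : 8 * η ≤ δ)
    (hδ : δ ≤ 1 / 2) (hl2 : l2 = Real.log l) (hl : 0 < l) (hl2' : 1 ≤ l2) (hly : 0 < ly)
    (hl3 : Real.log l2 ≤ η * l2) (hu : 1 ≤ u)
    (hcond : (1 + l2 / ly) * (l / l2) ≤ (1 - δ) * u) :
    (1 + η) * (l + l / ly * l2) ≤ (1 - 6 * η) * (u * Real.log u) ∧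
      (l + l / ly * l2) / 2 ≤ u * Real.log u := by
  set L := Real.log u with hL
  set Λ := l + l / ly * l2 with hΛ
  have hΛ0 : 0 ≤ Λ := by positivity
  have hu_l2 : Λ ≤ (1 - δ) * u * l2 := by
    have h1 : (1 + l2 / ly) * (l / l2) * l2 = Λ := by rw [hΛ]; field_simp
    rw [← h1]
    exact mul_le_mul_of_nonneg_right hcond (by linarith)
  have hLl2 : (1 - η) * l2 ≤ L := by
    have h1 : l / l2 ≤ u := by
      rw [div_le_iff₀ (by linarith)]
      have h2 : 0 ≤ δ * (u * l2) := mul_nonneg (by linarith) (by positivity)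
      have h3 : 0 ≤ l / ly * l2 := by positivity
      linarith
    have h2 := Real.log_le_log (by positivity) h1
    rw [Real.log_div (by linarith) (by linarith), ← hl2] at h2
    linarith
  have hUΛ : (1 - η) * Λ ≤ (1 - δ) * (u * L) := by
    have h1 := mul_le_mul_of_nonneg_left hu_l2 (by linarith : 0 ≤ 1 - η)
    have h2 := mul_le_mul_of_nonneg_left hLl2
      (mul_nonneg (by linarith) (by linarith) : 0 ≤ (1 - δ) * u)
    linarith
  have hL0 : 0 ≤ L := Real.log_nonneg hu
  have hU0 : 0 ≤ u * L := by positivity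
  constructor
  · have h5 : (1 + η) * (1 - δ) ≤ (1 - 6 * η) * (1 - η) := by nlinarith
    have h7 := mul_le_mul_of_nonneg_right h5 hΛ0
    have h8 := mul_le_mul_of_nonneg_left hUΛ (by linarith : 0 ≤ 1 - 6 * η)
    have h6 : (1 - δ) * ((1 + η) * Λ) ≤ (1 - δ) * ((1 - 6 * η) * (u * L)) := by linarith
    exact le_of_mul_le_mul_left h6 (by linarith)
  · have h1 : η * Λ ≤ 1 / 2 * Λ := mul_le_mul_of_nonneg_right (by linarith) hΛ0
    have h2 : 0 ≤ δ * (u * L) := mul_nonneg (by linarith) hU0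
    linarith

theorem exp_neg_le_P {y : ℕ} {l : ℝ} (hy : 2 ≤ y) (hl : 5 ≤ l)
    (h : Real.log (1 + Real.log y) ≤ 4 * l + 1) : Real.exp (-(5 * l)) ≤ P y := by
  have hly : 0 < Real.log y := Real.log_pos (by exact_mod_cast hy)
  refine le_trans ?_ (P_ge hy)
  rw [le_div_iff₀ (by linarith)]
  calc Real.exp (-(5 * l)) * (1 + Real.log y) ≤ Real.exp (-(5 * l)) * Real.exp (4 * l + 1) := by
        refine mul_le_mul_of_nonneg_left ?_ (Real.exp_pos _).le
        rw [← Real.exp_log (by linarith : 0 < 1 + Real.log y)]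
        exact Real.exp_le_exp.2 h
    _ = Real.exp (1 - l) := by rw [← Real.exp_add]; congr 1; ring
    _ ≤ Real.exp (-4) := Real.exp_le_exp.2 (by linarith)

/-- This verifies `hsieve`. Since y ≤ X^(2η), the level D₂ y is at most √X, so Y + 1 ≥ √X. The sieve
level X^η ≤ X^(1/4) is then negligible against P Y, and `hR` controls the other error. -/
theorem sieve_of_relErr_le {y X H : ℕ} {η u σ D₂ : ℝ} {s : Finset ℕ} (hs : s ⊆ primesUpTo y)
    (hy : 2 ≤ y) (hX1 : 1 ≤ X) (hX : Real.log X = u * Real.log y) (hly : 1 ≤ Real.log y)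
    (hη : 0 < η) (hη1 : η ≤ 1 / 16) (hu : 8 ≤ u) (hu0 : 1 ≤ 2 * η * u) (hσ : 0 ≤ σ)
    (hy4 : 4 * Real.exp 4 * (1 + Real.log y) ≤ y) (hD₂ : D₂ = (X : ℝ) ^ (1 / 2 - 2 * η))
    (hR : 4 * relErr s ((X : ℝ) ^ η) σ ≤ P y) (Y : ℕ)
    (hY : ((X + H : ℕ) : ℝ) ≤ (Y + 1) * (D₂ * y)) :
    ∑ n ∈ Icc 1 Y, rough s n ≤ 2 * dens s * Y := by
  have hX0 : (0 : ℝ) < X := by exact_mod_cast hX1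
  have hX1' : (1 : ℝ) ≤ X := by exact_mod_cast hX1
  have hy0 : (0 : ℝ) < y := by exact_mod_cast (by omega : 0 < y)
  have hPp := P_pos y
  have hP1 : P y ≤ 1 := dens_le_one _
  have hXexp : ∀ a : ℝ, (X : ℝ) ^ a = Real.exp (a * (u * Real.log y)) := fun a => by
    rw [Real.rpow_def_of_pos hX0, hX, mul_comm]
  have hdens : P y ≤ dens s := dens_le_dens_of_subset hs
  set D₁ := (X : ℝ) ^ η with hD₁
  have hD₁1 : 1 ≤ D₁ := Real.one_le_rpow hX1' hη.le
  set Z := (X : ℝ) ^ (1 / 4 : ℝ) with hZ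
  have hZ0 : 0 < Z := by positivity
  have hX4 : (X : ℝ) ^ (1 / 2 : ℝ) = Z * Z := by
    rw [hZ, ← Real.rpow_add hX0]; norm_num
  have hX2 : (X : ℝ) = (Z * Z) * (Z * Z) := by
    rw [← hX4, ← Real.rpow_add hX0]; norm_num
  have hYlow : Z * Z ≤ Y + 1 := by
    have h1 : D₂ * y ≤ Z * Z := by
      rw [← hX4, hD₂, hXexp, hXexp]
      nth_rewrite 2 [← Real.exp_log hy0]
      rw [← Real.exp_add]
      refine Real.exp_le_exp.2 ?_
      have := mul_le_mul_of_nonneg_right hu0 (by linarith : 0 ≤ Real.log y)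
      linarith
    have h2 : (X : ℝ) ≤ (Y + 1) * (Z * Z) := by
      refine le_trans ?_ (hY.trans (mul_le_mul_of_nonneg_left h1 (by positivity)))
      push_cast
      have : (0 : ℝ) ≤ H := by positivity
      linarith
    rw [hX2] at h2
    exact le_of_mul_le_mul_right h2 (by positivity)
  have hbig : 4 * Real.exp 4 * (1 + Real.log y) ≤ Z := by
    refine hy4.trans ?_
    rw [hZ, hXexp]
    nth_rewrite 1 [← Real.exp_log hy0]
    refine Real.exp_le_exp.2 ?_
    have := mul_le_mul_of_nonneg_right hu (by linarith : 0 ≤ Real.log y)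
    linarith
  have hPX : 4 ≤ P y * Z := by
    calc (4 : ℝ) = Real.exp (-4) / (1 + Real.log y) * (4 * Real.exp 4 * (1 + Real.log y)) := by
          rw [Real.exp_neg]; field_simp
      _ ≤ _ := mul_le_mul (P_ge hy) hbig (by positivity) hPp.le
  have hD₁4 : D₁ ≤ Z := Real.rpow_le_rpow_of_exponent_le hX1' (by linarith)
  have hZ4 : 4 ≤ Z := hPX.trans (mul_le_of_le_one_left hZ0.le hP1)
  have hY2 : Z * Z / 2 ≤ Y := by nlinarith
  have hD₁Y : D₁ ≤ P y * Y / 2 := by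
    have h1 := mul_le_mul_of_nonneg_left hY2 hPp.le
    have h2 := mul_le_mul_of_nonneg_right hPX hZ0.le
    linarith
  have hY0 : (0 : ℝ) ≤ Y := by positivity
  have h1 := sum_rough_le_relErr (fun p hp => prime_of_mem_primesUpTo p (hs hp)) hD₁1 hσ Y
  have h2 := mul_le_mul_of_nonneg_right hR hY0
  have h3 := mul_le_mul_of_nonneg_right hdens hY0
  linarith

/-- Here h stands for H, p for P and m for M, and Λ − l = (log H / log y) log log H. R₁ is so small
that even the crude bound p ≥ exp(−5l) suffices; for R₂ the comparison is the sharp one, R₂² against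
exp(−Λ − ηΛ). -/
theorem relErr_compare {h p m R₁ R₂ l Λ U η : ℝ} (hh : h = Real.exp l) (hp : 0 < p) (hp1 : p ≤ 1)
    (hlow : Real.exp (-(5 * l)) ≤ p) (hR₁ : 0 ≤ R₁) (hR₂ : 0 ≤ R₂)
    (hR₁le : R₁ ≤ Real.exp (-(10 * Λ))) (hR₂le : R₂ ≤ Real.exp (-((1 - 6 * η) / 2 * U)))
    (hΛ : l ≤ Λ) (hl : 5 ≤ l) (hU : (1 + η) * Λ ≤ (1 - 6 * η) * U) (hU0 : 0 ≤ U) (hη : 0 < η)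
    (hη1 : η ≤ 1 / 16) (hm : h * p * Real.exp (-(Λ - l) - η * Λ) ≤ m) :
    4 * R₁ ≤ p ∧ h * R₁ ≤ √m ∧ h * p * R₂ ≤ √m ∧ R₂ ≤ 1 := by
  have hh0 : 0 < h := hh ▸ Real.exp_pos _
  have hηΛ : η * Λ ≤ 1 / 16 * Λ := mul_le_mul_of_nonneg_right hη1 (by linarith)
  refine ⟨?_, ?_, ?_, ?_⟩
  · refine le_trans ?_ hlow
    have h1 : (4 : ℝ) ≤ Real.exp (5 * l) := by
      have := Real.add_one_le_exp (5 * l); linarith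
    calc 4 * R₁ ≤ Real.exp (5 * l) * Real.exp (-(10 * Λ)) :=
          mul_le_mul h1 hR₁le hR₁ (Real.exp_pos _).le
      _ ≤ _ := by
          rw [← Real.exp_add]
          exact Real.exp_le_exp.2 (by linarith)
  · refine Real.le_sqrt_of_sq_le (le_trans ?_ hm)
    have h1 : (h * R₁) ^ 2 = h * (h * R₁ ^ 2) := by ring
    rw [h1, mul_assoc]
    refine mul_le_mul_of_nonneg_left ?_ hh0.le
    have h3 : R₁ ^ 2 ≤ Real.exp (-(20 * Λ)) := by
      calc R₁ ^ 2 ≤ Real.exp (-(10 * Λ)) ^ 2 := by gcongr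
        _ = _ := by rw [← Real.exp_nat_mul]; congr 1; push_cast; ring
    calc h * R₁ ^ 2 ≤ Real.exp l * Real.exp (-(20 * Λ)) := by
          rw [hh]; exact mul_le_mul_of_nonneg_left h3 (Real.exp_pos _).le
      _ ≤ Real.exp (-(5 * l)) * Real.exp (-(Λ - l) - η * Λ) := by
          rw [← Real.exp_add, ← Real.exp_add]
          exact Real.exp_le_exp.2 (by linarith)
      _ ≤ _ := mul_le_mul_of_nonneg_right hlow (Real.exp_pos _).le
  · refine Real.le_sqrt_of_sq_le (le_trans ?_ hm)
    have h1 : (h * p * R₂) ^ 2 = h * p * (p * (h * R₂ ^ 2)) := by ring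
    rw [h1]
    refine mul_le_mul_of_nonneg_left ?_ (by positivity)
    have h3 : R₂ ^ 2 ≤ Real.exp (-((1 - 6 * η) * U)) := by
      calc R₂ ^ 2 ≤ Real.exp (-((1 - 6 * η) / 2 * U)) ^ 2 := by gcongr
        _ = _ := by rw [← Real.exp_nat_mul]; congr 1; push_cast; ring
    calc p * (h * R₂ ^ 2) ≤ h * R₂ ^ 2 := mul_le_of_le_one_left (by positivity) hp1
      _ ≤ Real.exp l * Real.exp (-((1 - 6 * η) * U)) := by
          rw [hh]; exact mul_le_mul_of_nonneg_left h3 (Real.exp_pos _).le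
      _ ≤ _ := by
        rw [← Real.exp_add]
        exact Real.exp_le_exp.2 (by linarith)
  · refine hR₂le.trans (Real.exp_le_one_iff.2 ?_)
    have : 0 ≤ (1 - 6 * η) / 2 * U := mul_nonneg (by linarith) hU0
    linarith

theorem error_le_of_relErr {h p R₁ R₂ m X N : ℝ} (hh : 0 ≤ h) (hp : 0 ≤ p) (hR₁ : 0 ≤ R₁)
    (hR₂ : 0 ≤ R₂) (hR₂1 : R₂ ≤ 1) (hm : 0 ≤ m) (hb1 : h * R₁ ≤ m) (hb2 : h * p * R₂ ≤ m)
    (hX : 1 ≤ X) (hN : N ≤ 2 * X) :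
    h * (N * (2 * p * R₂ + R₁ * (1 + R₂))) + 5 * (X + 1) * m ≤ 18 * X * m := by
  have h1 : h * (2 * p * R₂ + R₁ * (1 + R₂)) ≤ 4 * m := by
    have h2 : h * R₁ * R₂ ≤ h * R₁ := mul_le_of_le_one_right (by positivity) hR₂1
    linarith
  have e1 := mul_le_mul hN h1 (by positivity) (by linarith)
  have e2 := mul_le_mul_of_nonneg_right hX hm
  linarith

/-- The first absolute moment when `H` is not too small in comparison with `y`. -/
theorem sum_abs_le_of_long {y H X : ℕ} {δ η u : ℝ} (hη : 0 < η) (hηδ : 8 * η ≤ δ)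
    (hδ : δ ≤ 1 / 2) (hy : 2 ≤ y) (hHX : H ≤ X) (hX1 : 1 ≤ X)
    (hX : Real.log X = u * Real.log y)
    (hcond : (1 + Real.log (Real.log H) / Real.log y) * (Real.log H / Real.log (Real.log H)) ≤
      (1 - δ) * u)
    (hreg : Real.log (Real.log y) ≤ 4 * Real.log H) (hly : 1 ≤ Real.log y)
    (hH : 8 ≤ Real.log H)
    (hH2 : 1 ≤ Real.log (Real.log H))
    (hH3 : Real.log (Real.log (Real.log H)) ≤ η * Real.log (Real.log H))
    (hu : 8 ≤ u) (hu0 : 1 ≤ 2 * η * u)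
    (hu1 : 12 * (100 / η) * u ^ (1 - η) ≤ η * (u * Real.log u))
    (hu2 : 24 + 6 * Real.log u * Real.exp (Real.log u / 2) ≤ u * Real.log u)
    (hy4 : 4 * Real.exp 4 * (1 + Real.log y) ≤ y)
    (hM : H * P y * Real.exp (-(Real.log H / Real.log y * Real.log (Real.log H)) -
      η * (Real.log H + Real.log H / Real.log y * Real.log (Real.log H))) ≤ M H y) :
    ∑ n ∈ range (X + 1), |roughSum (primesUpTo y) H n - H * P y| ≤ 18 * X * √(M H y) := by
  obtain ⟨hUΛ, hU2⟩ := mul_log_ge_of_condition hη hηδ hδ rfl (by linarith) hH2 (by linarith) hH3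
    (by linarith) hcond
  have hH0 : (0 : ℝ) < H := by
    rcases Nat.eq_zero_or_pos H with h | h
    · rw [h] at hH; simp at hH; linarith
    · exact_mod_cast h
  have hHexp : (H : ℝ) = Real.exp (Real.log H) := (Real.exp_log hH0).symm
  set ly := Real.log y with hlydef
  set l := Real.log H with hl
  set l2 := Real.log l with hl2
  set L := Real.log u with hL
  have hly0 : 0 < ly := by linarith
  have hX0 : (0 : ℝ) < X := by exact_mod_cast hX1
  have hX1' : (1 : ℝ) ≤ X := by exact_mod_cast hX1
  have hPp := P_pos y
  have hP1 : P y ≤ 1 := dens_le_one _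
  set Λ := l + l / ly * l2 with hΛ
  have hΛl : l ≤ Λ := by
    have : 0 ≤ l / ly * l2 := by positivity
    linarith
  have hη1 : η ≤ 1 / 16 := by linarith
  have hL0 : 0 ≤ L := Real.log_nonneg (by linarith)
  have hU0 : 0 ≤ u * L := by positivity
  set U := u * L with hU
  have hΛ0 : 0 ≤ Λ := by linarith
  -- With K = 100 / η the small primes save 50 u log u. As Λ ≤ 2 u log u, this covers the power of
  -- log y, bounded through `hreg` by a power of H, and still leaves exp(−10Λ).
  have hK0 : 0 < 100 / η := by positivity
  have hηK : η * (100 / η) = 100 := by field_simp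
  have hR₂le := relErr_largePrimes_le hy hK0 (by linarith : η ≤ 1) (by linarith) hX0 hX
  have hR₁le := relErr_smallPrimes_le (η := η) hy hK0 (by linarith) hX0 hX
  rw [hηK] at hR₁le
  generalize 100 / η = K at *
  set z := Real.exp (ly / K) with hz
  have hD₁1 : 1 ≤ (X : ℝ) ^ η := Real.one_le_rpow hX1' hη.le
  have hD₂1 : 1 ≤ (X : ℝ) ^ (1 / 2 - 2 * η) := Real.one_le_rpow hX1' (by linarith)
  have hσ₁0 : 0 ≤ K * L / (2 * ly) := by positivity
  have hσ₂0 : 0 ≤ (1 - η) * L / ly := div_nonneg (mul_nonneg (by linarith) hL0) hly0.le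
  have hR₁0 : 0 ≤ relErr (smallPrimes y z) ((X : ℝ) ^ η) (K * L / (2 * ly)) :=
    relErr_nonneg prime_of_mem_smallPrimes (by linarith)
  have hR₂0 : 0 ≤ relErr (largePrimes y z) ((X : ℝ) ^ (1 / 2 - 2 * η)) ((1 - η) * L / ly) :=
    relErr_nonneg prime_of_mem_largePrimes (by linarith)
  have hlog1 : Real.log (1 + ly) ≤ 4 * l + 1 := by
    have h1 : Real.log (1 + ly) ≤ Real.log (2 * ly) := Real.log_le_log (by linarith) (by linarith)
    rw [Real.log_mul (by norm_num) hly0.ne'] at h1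
    have := Real.log_two_lt_d9
    linarith
  have hPlow := exp_neg_le_P hy (by linarith) hlog1
  have hsieve := sieve_of_relErr_le (H := H) (u := u) (s := smallPrimes y z)
    (Finset.filter_subset _ _) hy hX1 hX hly hη hη1 hu hu0 hσ₁0 hy4 rfl
  have hfinal := sum_abs_roughSum_sub_le (X := X) (H := H)
    prime_of_mem_smallPrimes prime_of_mem_largePrimes (disjoint_smallPrimes_largePrimes y z)
    (by exact_mod_cast (by omega : 1 ≤ y)) hD₁1 hD₂1 hσ₁0 hσ₂0
    (smallPrimes_le y z) (largePrimes_le y z)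
  rw [smallPrimes_union_largePrimes, fullVar_primesUpTo hy, dens_primesUpTo] at hfinal
  have hlevel : ((X : ℝ) ^ η * (X : ℝ) ^ (1 / 2 - 2 * η)) ^ 2 ≤ X := by
    rw [← Real.rpow_add hX0, ← Real.rpow_natCast, ← Real.rpow_mul hX0.le]
    calc (X : ℝ) ^ ((η + (1 / 2 - 2 * η)) * (2 : ℕ)) ≤ (X : ℝ) ^ (1 : ℝ) :=
          Real.rpow_le_rpow_of_exponent_le hX1' (by push_cast; linarith)
      _ = X := Real.rpow_one _
  generalize relErr (smallPrimes y z) ((X : ℝ) ^ η) (K * L / (2 * ly)) = R₁ at *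
  generalize relErr (largePrimes y z) ((X : ℝ) ^ (1 / 2 - 2 * η)) ((1 - η) * L / ly) = R₂ at *
  have hR₂le : R₂ ≤ Real.exp (-((1 - 6 * η) / 2 * U)) := by
    refine hR₂le.trans (Real.exp_le_exp.2 ?_)
    have h1 : (1 / 2 - 5 / 2 * η) * U ≤ (1 / 2 - 2 * η) * (1 - η) * U := by
      refine mul_le_mul_of_nonneg_right ?_ hU0
      nlinarith only [sq_nonneg η]
    linarith
  have hR₁le : R₁ ≤ Real.exp (-(10 * Λ)) := by
    refine hR₁le.trans (Real.exp_le_exp.2 ?_)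
    linarith
  have hv : l / ly * l2 = Λ - l := by rw [hΛ]; ring
  rw [hv] at hM
  obtain ⟨hR₁P, hb1, hb2, hR₂1⟩ := relErr_compare hHexp hPp hP1 hPlow hR₁0 hR₂0 hR₁le hR₂le hΛl
    (by linarith only [hH]) hUΛ hU0 hη hη1 hM
  refine (hfinal hlevel (hsieve hR₁P)).trans ?_
  have hHX' : (H : ℝ) ≤ X := by exact_mod_cast hHX
  exact error_le_of_relErr hH0.le hPp.le hR₁0 hR₂0 hR₂1 (Real.sqrt_nonneg _) hb1 hb2 hX1'
    (by push_cast; linarith only [hHX'])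


/-! ### The exponential lower bound for the main term -/

/-- The number of odd primes in a long range. -/
theorem card_primes_ge {y : ℕ} {B : ℝ} (hB : 2 ≤ B)
    (hpi : 3 * B ≤ (y * Real.log 2 - Real.log (y + 1)) / Real.log y) :
    2 * B ≤ (((oddPrimesUpTo y).filter fun p : ℕ => B ≤ (p : ℝ)).card : ℝ) := by
  have h1 := hpi.trans (Chebyshev.pi_ge y)
  have h2 : Nat.primeCounting y ≤
      ((oddPrimesUpTo y).filter fun p : ℕ => B ≤ (p : ℝ)).card + ⌊B⌋₊ := by
    have h3 : Nat.primeCounting y = (primesUpTo y).card := by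
      rw [Nat.primeCounting, Nat.primeCounting', Nat.count_eq_card_filter_range,
        ← primesBelow_succ_eq]
      rfl
    rw [h3]
    have hsub : primesUpTo y ⊆ ((oddPrimesUpTo y).filter fun p : ℕ => B ≤ (p : ℝ)) ∪ Icc 1 ⌊B⌋₊ := by
      intro p hp
      obtain ⟨hp1, hp2⟩ := mem_primesUpTo.1 hp
      rw [mem_union]
      by_cases h : (p : ℝ) ≤ B
      · exact Or.inr (mem_Icc.2 ⟨hp1.pos, Nat.le_floor h⟩)
      · have h4 : B < p := not_le.1 h
        have h5 : (2 : ℝ) < p := by linarith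
        exact Or.inl (mem_filter.2 ⟨mem_oddPrimesUpTo.2 ⟨hp1, by exact_mod_cast h5, hp2⟩, h4.le⟩)
    refine (Finset.card_le_card hsub).trans ((Finset.card_union_le _ _).trans ?_)
    simp
  have h3 : (Nat.primeCounting y : ℝ) ≤
      ((oddPrimesUpTo y).filter fun p : ℕ => B ≤ (p : ℝ)).card + (⌊B⌋₊ : ℝ) := by exact_mod_cast h2
  have h4 := Nat.floor_le (by linarith : 0 ≤ B)
  linarith

/-- Each of the r ≈ l / ly primes costs η ly for lying between y^(1−η) and y, and log r comes from
the unordered choice. Only (l / ly) log r is of main size; rounding r up and replacing 1 / (1 − η)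
by 1 go into the η term. -/
theorem log_mul_pow_ge {η ly l l2 r : ℝ} (hη : 0 < η) (hη1 : η ≤ 1 / 4) (hly : 0 < ly)
    (hl0 : 0 < l) (hl2 : l2 = Real.log l) (hl2' : 0 ≤ l2) (hr : r < l / ((1 - η) * ly) + 1)
    (hr1 : 1 ≤ r) (hrl : r ≤ l)
    (c : ℝ) (hc : ly ≤ c * l) (hsmall : l2 ≤ η * l) :
    r * (η * ly + Real.log r) ≤ l / ly * l2 + (3 + c) * η * (l + l / ly * l2) := by
  have h1 : r * ly ≤ 2 * l + c * l := by
    have h2 := mul_le_mul_of_nonneg_right hr.le hly.le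
    have h3 : (l / ((1 - η) * ly) + 1) * ly = l / (1 - η) + ly := by
      have : 1 - η ≠ 0 := by linarith
      field_simp
    rw [h3] at h2
    have h4 : l / (1 - η) ≤ 2 * l := by
      rw [div_le_iff₀ (by linarith)]; nlinarith
    linarith
  have h2 : Real.log r ≤ l2 := by
    rw [hl2]; exact Real.log_le_log (by linarith) hrl
  have h3 : r * Real.log r ≤ (1 + 2 * η) * (l / ly * l2) + l2 := by
    have h4 : r ≤ (1 + 2 * η) * (l / ly) + 1 := by
      refine hr.le.trans ?_
      have h5 : l / ((1 - η) * ly) = 1 / (1 - η) * (l / ly) := by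
        have : 1 - η ≠ 0 := by linarith
        field_simp
      have h6 : 1 / (1 - η) ≤ 1 + 2 * η := by
        rw [div_le_iff₀ (by linarith)]; nlinarith
      rw [h5]
      have := mul_le_mul_of_nonneg_right h6 (by positivity : 0 ≤ l / ly)
      linarith
    calc r * Real.log r ≤ r * l2 := mul_le_mul_of_nonneg_left h2 (by linarith)
      _ ≤ ((1 + 2 * η) * (l / ly) + 1) * l2 := mul_le_mul_of_nonneg_right h4 hl2'
      _ = _ := by ring
  have h7 := mul_le_mul_of_nonneg_left h1 hη.le
  have h8 : 0 ≤ η * (l / ly * l2) := by positivity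
  have hc0 : 0 ≤ c := by
    by_contra h
    have : c * l < 0 := mul_neg_of_neg_of_pos (not_le.1 h) hl0
    linarith
  have h9 : 0 ≤ c * (η * (l / ly * l2)) := by positivity
  linarith

/-- A lower bound for the main term. -/
theorem M_ge_exp {y H : ℕ} {η η' c : ℝ} (hη : 0 < η) (hη1 : η ≤ 1 / 4) (hy : 2 ≤ y) (hH : 2 ≤ H)
    (hc : c = 4 * Real.exp 4) (hη' : η' = (4 + c) * η)
    (hpi : 3 * (y : ℝ) ^ (1 - η) ≤ (y * Real.log 2 - Real.log (y + 1)) / Real.log y)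
    (hB : 2 ≤ (y : ℝ) ^ (1 - η)) (hly : 8 ≤ Real.log y)
    (hl : 8 ≤ Real.log H) (hly2 : Real.log H ≤ (y : ℝ) ^ (1 - η))
    (hl4 : 2 ≤ η' * Real.log H) (hl2 : 0 ≤ Real.log (Real.log H))
    (hsmall : Real.log (Real.log H) ≤ η * Real.log H)
    (hP : Real.log 2 + 8 + 2 * Real.log (1 + c * Real.log H) ≤ η * Real.log H) :
    H * P y * Real.exp (-(Real.log H / Real.log y * Real.log (Real.log H)) -
      η' * (Real.log H + Real.log H / Real.log y * Real.log (Real.log H))) ≤ M H y := by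
  have hH0 : (0 : ℝ) < H := by exact_mod_cast (by omega : 0 < H)
  have hy0 : (0 : ℝ) < y := by exact_mod_cast (by omega : 0 < y)
  have hPp := P_pos y
  set ly := Real.log y with hlydef
  set l := Real.log H with hldef
  set l2 := Real.log l with hl2def
  have hv0 : 0 ≤ l / ly * l2 := by positivity
  have hc0 : 0 < c := by rw [hc]; positivity
  have hη'0 : 0 < η' := by rw [hη']; positivity
  -- If log y exceeds a large multiple of log H, almost all the weight has product at least H.
  -- Otherwise log y ≤ c log H, and powers of P are negligible against exp(η log H).
  by_cases hcase : 2 * Real.exp 4 * (1 + l) ≤ ly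
  · have hHy : H ≤ y := by
      have h1 : l ≤ ly := by
        have := Real.add_one_le_exp (4 : ℝ)
        nlinarith
      have h2 := (Real.log_le_log_iff hH0 hy0).1 h1
      exact_mod_cast h2
    refine le_trans ?_ (M_ge_of_short hH hHy hcase)
    have h3 : Real.exp (-(l / ly * l2) - η' * (l + l / ly * l2)) ≤ 1 / 4 := by
      have h4 : Real.exp (-(l / ly * l2) - η' * (l + l / ly * l2)) ≤ Real.exp (-2) := by
        refine Real.exp_le_exp.2 ?_
        have : 0 ≤ η' * (l / ly * l2) := by positivity
        linarith
      refine h4.trans ?_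
      rw [Real.exp_neg, one_div]
      refine inv_anti₀ (by norm_num) ?_
      have := Real.add_one_le_exp (1 : ℝ)
      have h5 : Real.exp 2 = Real.exp 1 * Real.exp 1 := by rw [← Real.exp_add]; norm_num
      rw [h5]; nlinarith
    have h6 := mul_le_mul_of_nonneg_left h3 (by positivity : 0 ≤ (H : ℝ) * P y)
    linarith
  · have hlyl : ly ≤ c * l := by
      have h1 := not_le.1 hcase
      have h2 := Real.exp_pos 4
      rw [hc]
      nlinarith
    set B := (y : ℝ) ^ (1 - η) with hBdef
    set T := (oddPrimesUpTo y).filter fun p : ℕ => B ≤ (p : ℝ) with hT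
    have hcard : 2 * B ≤ (T.card : ℝ) := card_primes_ge hB hpi
    have hly0 : 0 < ly := by linarith
    -- The least r for which r primes, each at least y^(1−η), have product at least H.
    set r := ⌈l / ((1 - η) * ly)⌉₊ with hr
    have hlly : 0 < l / ((1 - η) * ly) := by
      have : 0 < 1 - η := by linarith
      positivity
    have hr0 : 0 < r := Nat.ceil_pos.2 hlly
    have hrlt : (r : ℝ) < l / ((1 - η) * ly) + 1 := Nat.ceil_lt_add_one hlly.le
    have hr1 : (1 : ℝ) ≤ r := by exact_mod_cast hr0
    have hrl : (r : ℝ) ≤ l := by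
      have h1 : l / ((1 - η) * ly) ≤ l / 2 := by
        refine div_le_div_of_nonneg_left (by linarith) (by norm_num) ?_
        nlinarith
      linarith
    have hcr : 2 * r ≤ T.card := by
      have : (2 : ℝ) * r ≤ T.card := by linarith
      exact_mod_cast this
    have hHB : (H : ℝ) ≤ B ^ r := by
      have h1 : l ≤ r * ((1 - η) * ly) := by
        have h2 := Nat.le_ceil (l / ((1 - η) * ly))
        rw [div_le_iff₀ (mul_pos (by linarith) hly0)] at h2
        exact h2
      have h2 : B ^ r = Real.exp (r * ((1 - η) * ly)) := by
        rw [hBdef, Real.rpow_def_of_pos hy0, ← Real.exp_nat_mul]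
        congr 1; ring
      rw [h2, ← Real.exp_log hH0]
      exact Real.exp_le_exp.2 h1
    have hM := M_ge_of_subset hy hr0 (Finset.filter_subset _ _) (by linarith : (0 : ℝ) ≤ B)
      (fun p hp => (mem_filter.1 hp).2) hHB hcr
    refine le_trans ?_ hM
    rw [mul_div_assoc, mul_assoc, mul_assoc]
    refine mul_le_mul_of_nonneg_left ?_ hH0.le
    have hq : Real.exp (-(r * (η * ly + Real.log r))) ≤ ((T.card : ℝ) / (2 * r * y)) ^ r := by
      have h1 : Real.exp (-(η * ly + Real.log r)) ≤ (T.card : ℝ) / (2 * r * y) := by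
        have h2 : Real.exp (-(η * ly + Real.log r)) = 2 * B / (2 * r * y) := by
          rw [neg_add, Real.exp_add, Real.exp_neg (Real.log r), Real.exp_log (by linarith), hBdef,
            Real.rpow_sub hy0, Real.rpow_one, Real.rpow_def_of_pos hy0, ← hlydef, mul_comm ly η,
            Real.exp_neg]
          field_simp
        rw [h2]
        exact div_le_div_of_nonneg_right hcard (by positivity)
      calc Real.exp (-(r * (η * ly + Real.log r))) = Real.exp (-(η * ly + Real.log r)) ^ r := by
            rw [← Real.exp_nat_mul]; congr 1; ring
        _ ≤ _ := by gcongr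
    have hPsq : Real.exp (-(η * l)) ≤ P y ^ 2 / 2 := by
      have h1 : Real.exp (-4) / (1 + c * l) ≤ P y := by
        refine le_trans ?_ (P_ge hy)
        exact div_le_div_of_nonneg_left (Real.exp_pos _).le (by linarith) (by linarith)
      have h0 : 0 < 1 + c * l := by positivity
      have h2 : (Real.exp (-4) / (1 + c * l)) ^ 2 ≤ P y ^ 2 := by gcongr
      have h3 : (Real.exp (-4) / (1 + c * l)) ^ 2 / 2 =
          Real.exp (-(Real.log 2 + 8 + 2 * Real.log (1 + c * l))) := by
        have e1 : Real.exp (Real.log 2 + 8 + 2 * Real.log (1 + c * l)) =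
            2 * (Real.exp 4 * (1 + c * l)) ^ 2 := by
          rw [Real.exp_add, Real.exp_add, Real.exp_log (by norm_num)]
          have : Real.exp (2 * Real.log (1 + c * l)) = (1 + c * l) ^ 2 := by
            rw [two_mul, Real.exp_add, Real.exp_log h0, sq]
          rw [this]
          have : Real.exp 8 = Real.exp 4 ^ 2 := by rw [← Real.exp_nat_mul]; norm_num
          rw [this]; ring
        rw [Real.exp_neg (Real.log 2 + _ + _), e1, Real.exp_neg]
        field_simp
      have h4 := Real.exp_le_exp.2 (neg_le_neg hP)
      rw [← h3] at h4
      linarith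
    have hlog := log_mul_pow_ge hη hη1 hly0 (by linarith : 0 < l) hl2def hl2 hrlt hr1 hrl c hlyl
      hsmall
    calc P y * Real.exp (-(l / ly * l2) - η' * (l + l / ly * l2))
        ≤ P y * (Real.exp (-(η * l)) * Real.exp (-(r * (η * ly + Real.log r)))) := by
          refine mul_le_mul_of_nonneg_left ?_ hPp.le
          rw [← Real.exp_add]
          refine Real.exp_le_exp.2 ?_
          rw [hη']
          have : 0 ≤ η * (l / ly * l2) := by positivity
          linarith
      _ ≤ P y * (P y ^ 2 / 2 * ((T.card : ℝ) / (2 * r * y)) ^ r) := by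
          refine mul_le_mul_of_nonneg_left ?_ hPp.le
          exact mul_le_mul hPsq hq (Real.exp_pos _).le (by positivity)
      _ = _ := by ring


/-! ### Very short intervals -/

theorem rough_le_of_subset {s t : Finset ℕ} (h : s ⊆ t) (n : ℕ) : rough t n ≤ rough s n := by
  rw [rough, ← Finset.prod_sdiff h]
  exact mul_le_of_le_one_left (rough_nonneg s n) (rough_le_one _ n)

theorem primesUpTo_mono {a b : ℕ} (h : a ≤ b) : primesUpTo a ⊆ primesUpTo b := fun p hp => by
  rw [mem_primesUpTo] at *
  exact ⟨hp.1, hp.2.trans h⟩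

/-- An upper bound for the number of integers without prime factors up to `y`. -/
theorem sum_rough_le_of_large {y N : ℕ} {t : ℝ} (ht : 2 ≤ t) (hy : Real.log y = t ^ 4) (hy2 : 2 ≤ y)
    (hyN : y ≤ N) (h1 : t ^ 3 ≤ Real.exp (t ^ 4 / 2))
    (h2 : 2 * Real.exp (-(t / 2) + (12 + 3 * Real.log (1 + t ^ 4))) ≤ 1 / t ^ 3) :
    ∑ n ∈ Icc 1 N, rough (primesUpTo y) n ≤ N * (4 / t ^ 3) := by
  have ht0 : 0 < t := by linarith
  have ht3 : 8 ≤ t ^ 3 := by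
    have : (2 : ℝ) ^ 3 ≤ t ^ 3 := by gcongr
    linarith
  have hy0 : (0 : ℝ) < y := by exact_mod_cast (by omega : 0 < y)
  have hyN' : (y : ℝ) ≤ N := by exact_mod_cast hyN
  have hN0 : (0 : ℝ) < N := by linarith
  have hN1 : (1 : ℝ) ≤ N := by exact_mod_cast (by omega : 1 ≤ N)
  have hyexp : (y : ℝ) = Real.exp (t ^ 4) := by rw [← hy, Real.exp_log hy0]
  set z := Real.exp (t ^ 3) with hz
  have hz9 : 9 ≤ z := by
    have := Real.add_one_le_exp (t ^ 3); linarith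
  set Z := ⌊z⌋₊ with hZ
  have hZle : (Z : ℝ) ≤ z := Nat.floor_le (by linarith)
  have hZge : z / 2 ≤ Z := by
    have := Nat.lt_floor_add_one z; linarith
  have hZ2 : 2 ≤ Z := by
    have : (2 : ℝ) ≤ Z := by linarith
    exact_mod_cast this
  have hzy : z ≤ y := by
    rw [hyexp, hz]
    refine Real.exp_le_exp.2 ?_
    have : 0 ≤ t ^ 3 * (t - 1) := mul_nonneg (by positivity) (by linarith)
    linarith
  have hZy : Z ≤ y := by
    have : (Z : ℝ) ≤ y := hZle.trans hzy
    exact_mod_cast this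
  have hlogZ : t ^ 3 / 2 ≤ Real.log Z := by
    have e1 := Real.log_le_log (by linarith) hZge
    rw [Real.log_div (by linarith) (by norm_num), hz, Real.log_exp] at e1
    have := Real.log_two_lt_d9
    linarith
  have hlogZ' : Real.log Z ≤ t ^ 3 := by
    have e1 := Real.log_le_log (by linarith) hZle
    rwa [hz, Real.log_exp] at e1
  have hσ : (0 : ℝ) ≤ 1 / t ^ 3 := by positivity
  have hD : (1 : ℝ) ≤ (N : ℝ) ^ (1 / 2 : ℝ) := Real.one_le_rpow hN1 (by norm_num)
  have hprod : ∏ p ∈ primesUpTo Z, (1 + (p : ℝ) ^ (1 / t ^ 3 - 1)) ≤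
      Real.exp (12 + 3 * Real.log (1 + t ^ 4)) := by
    have e1 : ∏ p ∈ primesUpTo Z, (1 + (p : ℝ) ^ (1 / t ^ 3 - 1)) ≤
        Real.exp (∑ p ∈ primesUpTo Z, (p : ℝ) ^ (1 / t ^ 3 - 1)) := by
      rw [Real.exp_sum]
      refine Finset.prod_le_prod (fun p _ => by positivity) fun p _ => ?_
      linarith [Real.add_one_le_exp ((p : ℝ) ^ (1 / t ^ 3 - 1))]
    refine e1.trans (Real.exp_le_exp.2 ?_)
    calc ∑ p ∈ primesUpTo Z, (p : ℝ) ^ (1 / t ^ 3 - 1)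
        ≤ ∑ p ∈ primesUpTo Z, 3 * (1 / (p : ℝ)) := by
          refine Finset.sum_le_sum fun p hp => ?_
          have hp0 : (0 : ℝ) < p := by exact_mod_cast (prime_of_mem_primesUpTo p hp).pos
          have hpZ : (p : ℝ) ≤ Z := by exact_mod_cast (mem_primesUpTo.1 hp).2
          rw [Real.rpow_sub_one hp0.ne', ← mul_div_assoc, mul_one]
          refine div_le_div_of_nonneg_right ?_ hp0.le
          calc (p : ℝ) ^ (1 / t ^ 3) ≤ z ^ (1 / t ^ 3) :=
                Real.rpow_le_rpow hp0.le (hpZ.trans hZle) hσ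
            _ = Real.exp 1 := by
                rw [hz, ← Real.exp_mul]; congr 1; field_simp
            _ ≤ 3 := by linarith [Real.exp_one_lt_d9]
      _ ≤ 3 * (4 + Real.log (1 + Real.log Z)) := by
          rw [← Finset.mul_sum]
          exact mul_le_mul_of_nonneg_left (sum_one_div_le hZ2) (by norm_num)
      _ ≤ 12 + 3 * Real.log (1 + t ^ 4) := by
          have e2 : Real.log (1 + Real.log Z) ≤ Real.log (1 + t ^ 4) := by
            refine Real.log_le_log (by linarith) ?_
            have : 0 ≤ t ^ 3 * (t - 1) := mul_nonneg (by positivity) (by linarith)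
            linarith
          linarith
  have hDσ : ((N : ℝ) ^ (1 / 2 : ℝ)) ^ (-(1 / t ^ 3)) ≤ Real.exp (-(t / 2)) := by
    rw [← Real.rpow_mul hN0.le, Real.rpow_def_of_pos hN0]
    refine Real.exp_le_exp.2 ?_
    have e1 : t ^ 4 ≤ Real.log N := by rw [← hy]; exact Real.log_le_log hy0 hyN'
    have e2 : t / 2 = t ^ 4 * (1 / 2 * (1 / t ^ 3)) := by field_simp
    have e3 := mul_le_mul_of_nonneg_right e1 (by positivity : 0 ≤ 1 / 2 * (1 / t ^ 3))
    linarith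
  have hsieve := sum_rough_le (prime_of_mem_primesUpTo (y := Z)) hD hσ N
  have hdens : dens (primesUpTo Z) ≤ 2 / t ^ 3 := by
    rw [dens_primesUpTo]
    refine (P_le_one_div_log hZ2).trans ?_
    rw [div_le_div_iff₀ (by linarith) (by positivity)]
    linarith
  have hDN : (N : ℝ) ^ (1 / 2 : ℝ) ≤ N * (1 / t ^ 3) := by
    have e1 : t ^ 3 ≤ (N : ℝ) ^ (1 / 2 : ℝ) := by
      refine h1.trans ?_
      have e2 : Real.exp (t ^ 4 / 2) = (y : ℝ) ^ (1 / 2 : ℝ) := by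
        rw [hyexp, ← Real.exp_mul]; congr 1; ring
      rw [e2]
      exact Real.rpow_le_rpow hy0.le hyN' (by norm_num)
    have e3 : (N : ℝ) = (N : ℝ) ^ (1 / 2 : ℝ) * (N : ℝ) ^ (1 / 2 : ℝ) := by
      rw [← Real.rpow_add hN0]; norm_num
    rw [← div_eq_mul_one_div, le_div_iff₀ (by positivity)]
    nth_rewrite 2 [e3]
    exact mul_le_mul_of_nonneg_left e1 (by positivity)
  have htail : ((N : ℝ) ^ (1 / 2 : ℝ)) ^ (-(1 / t ^ 3)) *
      ∏ p ∈ primesUpTo Z, (1 + (p : ℝ) ^ (1 / t ^ 3 - 1)) ≤ 1 / t ^ 3 / 2 := by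
    have e1 := mul_le_mul hDσ hprod (Finset.prod_nonneg fun p _ => by positivity)
      (Real.exp_pos _).le
    rw [← Real.exp_add] at e1
    linarith
  have hmono : ∑ n ∈ Icc 1 N, rough (primesUpTo y) n ≤ ∑ n ∈ Icc 1 N, rough (primesUpTo Z) n :=
    Finset.sum_le_sum fun n _ => rough_le_of_subset (primesUpTo_mono hZy) n
  refine hmono.trans (hsieve.trans ?_)
  have f1 := mul_le_mul_of_nonneg_left hdens hN0.le
  have f2 := mul_le_mul_of_nonneg_left htail (by positivity : (0 : ℝ) ≤ 2 * N)
  have f3 : (N : ℝ) * (4 / t ^ 3) = N * (2 / t ^ 3) + N * (1 / t ^ 3) +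
      2 * N * (1 / t ^ 3 / 2) := by ring
  linarith

/-- The first absolute moment when `H` is very small in comparison with `y`. -/
theorem sum_abs_le_of_short {y H X : ℕ} {t : ℝ} (ht : 2 ≤ t) (hy : Real.log y = t ^ 4)
    (hH : 2 ≤ H) (hHt : (H : ℝ) ≤ t) (hyX : y ≤ X) (hHX : H ≤ X)
    (h1 : t ^ 3 ≤ Real.exp (t ^ 4 / 2))
    (h2 : 2 * Real.exp (-(t / 2) + (12 + 3 * Real.log (1 + t ^ 4))) ≤ 1 / t ^ 3)
    (h3 : 2 * Real.exp 4 * (1 + Real.log t) ≤ t ^ 4)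
    (h4 : Real.exp 4 * (1 + t ^ 4) ≤ t ^ 5) :
    0 < M H y ∧
    ∑ n ∈ range (X + 1), |roughSum (primesUpTo y) H n - H * P y| ≤ 20 * X * √(M H y) := by
  have ht0 : 0 < t := by linarith
  have hH0 : (0 : ℝ) < H := by exact_mod_cast (by omega : 0 < H)
  have hlogH : Real.log H ≤ Real.log t := Real.log_le_log hH0 hHt
  have hlogt : Real.log t ≤ t ^ 4 := by
    have e1 := Real.log_le_sub_one_of_pos ht0
    have e2 : t ≤ t ^ 4 := le_self_pow₀ (by linarith) (by norm_num)
    linarith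
  have hy0 : (0 : ℝ) < y := by
    rcases Nat.eq_zero_or_pos y with h | h
    · rw [h] at hy
      simp only [Nat.cast_zero, Real.log_zero] at hy
      have : 0 < t ^ 4 := by positivity
      linarith
    · exact_mod_cast h
  have hHy : H ≤ y := by
    have e1 : Real.log H ≤ Real.log y := by linarith
    exact_mod_cast (Real.log_le_log_iff hH0 hy0).1 e1
  have hy2 : 2 ≤ y := hH.trans hHy
  have hPp := P_pos y
  have hM : H * P y / 4 ≤ M H y := by
    refine M_ge_of_short hH hHy ?_
    rw [hy]
    refine le_trans ?_ h3
    have := Real.exp_pos 4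
    gcongr
  have hMpos : 0 < M H y := lt_of_lt_of_le (by positivity) hM
  refine ⟨hMpos, ?_⟩
  set m := √(M H y) with hm
  have hm0 : 0 ≤ m := Real.sqrt_nonneg _
  have hHP : H * P y ≤ 4 * m ^ 2 := by
    rw [hm, Real.sq_sqrt hMpos.le]; linarith
  have hHP1 : H * P y ≤ 1 := by
    have e1 := P_le_one_div_log hy2
    rw [hy] at e1
    calc H * P y ≤ t * (1 / t ^ 4) := mul_le_mul hHt e1 hPp.le ht0.le
      _ = 1 / t ^ 3 := by field_simp
      _ ≤ 1 := by
        rw [div_le_one (by positivity)]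
        exact one_le_pow₀ (by linarith)
  -- For a number at most 1 the square is no larger than the number, so H P ≤ 1 and H P ≤ 4 M bound
  -- the mean by √M.
  have hbound1 : H * P y ≤ 2 * m := by
    have e1 : (H * P y) ^ 2 ≤ (2 * m) ^ 2 := by
      have e2 : (H * P y) ^ 2 ≤ H * P y := by
        rw [sq]; exact mul_le_of_le_one_left (by positivity) hHP1
      linarith
    exact le_of_sq_le_sq e1 (by positivity)
  -- The loss in the sieve density is affordable because H ≤ t: (H / t³)² ≤ H t⁻⁵ ≤ H P.
  have hbound2 : H / t ^ 3 ≤ 2 * m := by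
    have e1 : (H / t ^ 3) ^ 2 ≤ (2 * m) ^ 2 := by
      have e2 : H / t ^ 6 ≤ P y := by
        calc (H : ℝ) / t ^ 6 ≤ t / t ^ 6 := by gcongr
          _ = 1 / t ^ 5 := by field_simp
          _ ≤ Real.exp (-4) / (1 + Real.log y) := by
            rw [hy, Real.exp_neg, inv_eq_one_div, div_div]
            exact one_div_le_one_div_of_le (by positivity) h4
          _ ≤ P y := P_ge hy2
      have e3 := mul_le_mul_of_nonneg_left e2 hH0.le
      have e4 : ((H : ℝ) / t ^ 3) ^ 2 = H * (H / t ^ 6) := by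
        field_simp
      rw [e4]; linarith
    exact le_of_sq_le_sq e1 (by positivity)
  have hX2 : (2 : ℝ) ≤ X := by exact_mod_cast hH.trans hHX
  have hHX' : (H : ℝ) ≤ X := by exact_mod_cast hHX
  have hsum : ∑ n ∈ range (X + 1), roughSum (primesUpTo y) H n ≤
      H * ((X + H : ℕ) * (4 / t ^ 3)) := by
    refine (sum_range_sum_shift_le (rough_nonneg (primesUpTo y)) X H).trans ?_
    refine mul_le_mul_of_nonneg_left ?_ hH0.le
    exact sum_rough_le_of_large ht hy hy2 (by omega) h1 h2
  calc ∑ n ∈ range (X + 1), |roughSum (primesUpTo y) H n - H * P y|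
      ≤ ∑ n ∈ range (X + 1), (roughSum (primesUpTo y) H n + H * P y) := by
        refine Finset.sum_le_sum fun n _ => ?_
        have e1 : 0 ≤ roughSum (primesUpTo y) H n := Finset.sum_nonneg fun h _ => rough_nonneg _ _
        have e2 : 0 ≤ H * P y := by positivity
        rw [abs_le]; constructor <;> linarith
    _ ≤ H * ((X + H : ℕ) * (4 / t ^ 3)) + (X + 1) * (H * P y) := by
        rw [Finset.sum_add_distrib, Finset.sum_const, nsmul_eq_mul, Finset.card_range]
        push_cast at hsum ⊢
        linarith
    _ ≤ 20 * X * m := by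
        have e1 : H * (((X + H : ℕ) : ℝ) * (4 / t ^ 3)) ≤ 16 * X * m := by
          have e2 : ((X + H : ℕ) : ℝ) ≤ 2 * X := by push_cast; linarith
          calc H * (((X + H : ℕ) : ℝ) * (4 / t ^ 3)) = 4 * ((X + H : ℕ) : ℝ) * (H / t ^ 3) := by ring
            _ ≤ 4 * (2 * X) * (2 * m) := by gcongr
            _ = _ := by ring
        have e3 : ((X : ℝ) + 1) * (H * P y) ≤ 2 * X * (2 * m) :=
          mul_le_mul (by linarith) hbound1 (by positivity) (by positivity)
        linarith


/-! ### From integers to real points: Markov's inequality -/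

theorem alpha_eq_rough (y n : ℕ) : alpha y n = rough (primesUpTo y) n := by
  rw [alpha, rough]
  split_ifs with h
  · refine (Finset.prod_eq_one fun p hp => ?_).symm
    rw [mem_primesUpTo] at hp
    exact if_neg fun hd => absurd (h p hp.1 hd) (not_lt.2 hp.2)
  · push Not at h
    obtain ⟨p, hp, hd, hle⟩ := h
    symm
    exact Finset.prod_eq_zero (i := p) (mem_primesUpTo.2 ⟨hp, hle⟩) (if_pos hd)

theorem roughCount_eq_roughSum (y H : ℕ) {x : ℝ} (hx : 0 ≤ x) :
    roughCount y H x = roughSum (primesUpTo y) H ⌊x⌋₊ := by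
  rw [roughCount, roughSum, Nat.floor_add_natCast hx]
  symm
  refine Finset.sum_bij (fun h _ => ⌊x⌋₊ + h) (fun h hh => ?_) (fun a _ b _ hab => ?_)
    (fun b hb => ?_) (fun h _ => (alpha_eq_rough _ _).symm)
  · simp only [Finset.mem_Icc, Finset.mem_Ioc] at *
    omega
  · simpa using hab
  · simp only [Finset.mem_Ioc] at hb
    exact ⟨b - ⌊x⌋₊, by simp only [Finset.mem_Icc]; omega, by omega⟩

open MeasureTheory in
/-- Markov's inequality for a step function, with a threshold that is large beyond `a`. -/
theorem volume_exceed_le {f : ℕ → ℝ} {F w : ℝ → ℝ} {X : ℕ} {a B s K : ℝ} (hs : 0 < s)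
    (hB : 0 < B) (ha : 0 ≤ a) (hw : ∀ x, a ≤ x → B ≤ w x) (hF : ∀ x, 0 ≤ x → F x = f ⌊x⌋₊)
    (hsum : ∑ n ∈ range (X + 1), |f n| ≤ K * X * s) :
    volume {x : ℝ | x ∈ Set.Icc (0 : ℝ) X ∧ s * w x < |F x|} ≤ ENNReal.ofReal (a + K * X / B) := by
  set T := (range (X + 1)).filter fun n => B * s < |f n| with hT
  have hcard : (T.card : ℝ) ≤ K * X / B := by
    rw [le_div_iff₀ hB]
    have h1 : (T.card : ℝ) * (B * s) ≤ K * X * s := by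
      calc (T.card : ℝ) * (B * s) = ∑ n ∈ T, B * s := by simp
        _ ≤ ∑ n ∈ T, |f n| := Finset.sum_le_sum fun n hn => (Finset.mem_filter.1 hn).2.le
        _ ≤ ∑ n ∈ range (X + 1), |f n| := Finset.sum_le_sum_of_subset_of_nonneg
            (Finset.filter_subset _ _) fun _ _ _ => abs_nonneg _
        _ ≤ _ := hsum
    exact le_of_mul_le_mul_right (by linarith) hs
  -- The exceptional set is covered by the initial segment where w may be small and the unit
  -- intervals over the bad integers. Monotonicity suffices, so w need not be measurable.
  have hsub : {x : ℝ | x ∈ Set.Icc (0 : ℝ) X ∧ s * w x < |F x|} ⊆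
      Set.Icc 0 a ∪ ⋃ n ∈ T, Set.Ico (n : ℝ) (n + 1) := by
    rintro x ⟨⟨hx0, hxX⟩, hx⟩
    rcases le_total x a with h | h
    · exact Or.inl ⟨hx0, h⟩
    · refine Or.inr (Set.mem_iUnion₂.2 ⟨⌊x⌋₊, ?_, Nat.floor_le hx0, Nat.lt_floor_add_one x⟩)
      rw [hT, Finset.mem_filter, Finset.mem_range, Nat.lt_succ_iff, ← hF x hx0]
      refine ⟨Nat.floor_le_of_le hxX, lt_of_le_of_lt ?_ hx⟩
      rw [mul_comm]
      exact mul_le_mul_of_nonneg_left (hw x h) hs.le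
  calc _ ≤ volume (Set.Icc 0 a ∪ ⋃ n ∈ T, Set.Ico (n : ℝ) (n + 1)) := measure_mono hsub
    _ ≤ volume (Set.Icc 0 a) + volume (⋃ n ∈ T, Set.Ico (n : ℝ) (n + 1)) := measure_union_le _ _
    _ ≤ ENNReal.ofReal a + ∑ n ∈ T, volume (Set.Ico (n : ℝ) (n + 1)) := by
        refine add_le_add (by simp) (measure_biUnion_finset_le _ _)
    _ = ENNReal.ofReal (a + T.card) := by
        simp [ENNReal.ofReal_add ha]
    _ ≤ _ := ENNReal.ofReal_le_ofReal (by linarith)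

/-! ### Sizes of the parameters in the limit and the two regimes -/

open Filter Topology

theorem eventually_log_le_mul {κ : ℝ} (hκ : 0 < κ) : ∀ᶠ t : ℝ in atTop, Real.log t ≤ κ * t := by
  filter_upwards [Real.isLittleO_log_id_atTop.def hκ, eventually_ge_atTop 0] with t ht h0
  simpa [abs_of_nonneg h0] using (le_abs_self _).trans ht

theorem eventually_u_bounds {η : ℝ} (hη : 0 < η) : ∀ᶠ u : ℝ in atTop, 8 ≤ u ∧ 1 ≤ 2 * η * u ∧
    12 * (100 / η) * u ^ (1 - η) ≤ η * (u * Real.log u) ∧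
    24 + 6 * Real.log u * Real.exp (Real.log u / 2) ≤ u * Real.log u := by
  filter_upwards [eventually_ge_atTop (8 : ℝ), eventually_ge_atTop (1 / (2 * η)),
    Real.tendsto_log_atTop.eventually_ge_atTop (12 * (100 / η) / η),
    Real.tendsto_log_atTop.eventually_ge_atTop 24] with u h1 h2 h3 h4
  refine ⟨h1, ?_, ?_, ?_⟩
  · rw [div_le_iff₀ (by positivity)] at h2
    linarith
  · rw [div_le_iff₀ hη] at h3
    have : u ^ (1 - η) ≤ u := by
      simpa using Real.rpow_le_rpow_of_exponent_le (by linarith : 1 ≤ u) (by linarith : 1 - η ≤ 1)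
    calc 12 * (100 / η) * u ^ (1 - η) ≤ (Real.log u * η) * u := by
          apply mul_le_mul h3 this (by positivity)
          exact mul_nonneg (by linarith) hη.le
      _ = _ := by ring
  · set L := Real.log u with hL
    have hu : u = Real.exp (L / 2) * Real.exp (L / 2) := by
      rw [← Real.exp_add, add_halves, hL, Real.exp_log (by linarith)]
    have h5 : 12 ≤ Real.exp (L / 2) := by linarith [Real.add_one_le_exp (L / 2)]
    have h6 : 6 * Real.exp (L / 2) ≤ u / 2 := by nlinarith
    nlinarith [mul_le_mul_of_nonneg_right h6 (by linarith : 0 ≤ L)]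

theorem eventually_y_bounds {η : ℝ} (hη : 0 < η) (hη1 : η ≤ 1 / 4) : ∀ᶠ y : ℝ in atTop,
    3 * y ^ (1 - η) ≤ (y * Real.log 2 - Real.log (y + 1)) / Real.log y ∧
    2 ≤ y ^ (1 - η) ∧ 4 * Real.exp 4 * (1 + Real.log y) ≤ y := by
  filter_upwards [(isLittleO_log_rpow_atTop hη).def (by norm_num : (0 : ℝ) < 1 / 10),
    (tendsto_rpow_atTop (by linarith : 0 < 1 - η)).eventually_ge_atTop 2,
    eventually_log_le_mul (by positivity : 0 < 1 / (8 * Real.exp 4)),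
    eventually_ge_atTop (8 * Real.exp 4),
    (tendsto_atTop_add_const_right atTop (1 : ℝ) tendsto_id).eventually
      (eventually_log_le_mul (by norm_num : (0 : ℝ) < 1 / 10)),
    Real.tendsto_log_atTop.eventually_ge_atTop 1, eventually_ge_atTop 2]
    with y h1 h2 h3 h4 h5 h6 h7
  have hy : 0 < y := by linarith
  refine ⟨?_, h2, ?_⟩
  · rw [le_div_iff₀ (by linarith)]
    have h8 : Real.log y ≤ 1 / 10 * y ^ η := by
      simpa [abs_of_nonneg (Real.rpow_nonneg hy.le η)] using (le_abs_self _).trans h1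
    have h9 : y ^ (1 - η) * y ^ η = y := by
      rw [← Real.rpow_add hy]
      simp
    have h10 := mul_le_mul_of_nonneg_left h8 (Real.rpow_nonneg hy.le (1 - η))
    simp only [id] at h5
    nlinarith [Real.log_two_gt_d9]
  · have h8 : 4 * Real.exp 4 * Real.log y ≤ y / 2 := by
      calc 4 * Real.exp 4 * Real.log y ≤ 4 * Real.exp 4 * (1 / (8 * Real.exp 4) * y) :=
            mul_le_mul_of_nonneg_left h3 (by positivity)
        _ = y / 2 := by field_simp; norm_num
    linarith

theorem eventually_l_bounds {η c η' : ℝ} (hη : 0 < η) (hc : 0 < c) (hη' : 0 < η') :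
    ∀ᶠ l : ℝ in atTop, 8 ≤ l ∧ 1 ≤ Real.log l ∧ Real.log (Real.log l) ≤ η' * Real.log l ∧
    2 ≤ η' * l ∧ Real.log l ≤ η * l ∧
    Real.log 2 + 8 + 2 * Real.log (1 + c * l) ≤ η * l := by
  have hcl : Tendsto (fun l : ℝ => 1 + c * l) atTop atTop :=
    tendsto_atTop_add_const_left _ _ (tendsto_id.const_mul_atTop hc)
  filter_upwards [eventually_ge_atTop 8, Real.tendsto_log_atTop.eventually_ge_atTop 1,
    Real.tendsto_log_atTop.eventually (eventually_log_le_mul hη'),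
    eventually_ge_atTop (2 / η'), eventually_log_le_mul hη,
    hcl.eventually (eventually_log_le_mul (by positivity : 0 < η / (4 * c))),
    eventually_ge_atTop ((18 + η / c) / η)] with l h1 h2 h3 h4 h5 h6 h7
  refine ⟨h1, h2, h3, ?_, h5, ?_⟩
  · rw [div_le_iff₀ hη'] at h4
    linarith
  · rw [div_le_iff₀ hη] at h7
    have h8 : η / (4 * c) * (1 + c * l) = η / c / 4 + η * l / 4 := by field_simp
    have h9 : 0 < η / c := by positivity
    linarith [Real.log_two_lt_d9]

theorem eventually_t_bounds : ∀ᶠ t : ℝ in atTop, 2 ≤ t ∧ t ^ 3 ≤ Real.exp (t ^ 4 / 2) ∧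
    2 * Real.exp (-(t / 2) + (12 + 3 * Real.log (1 + t ^ 4))) ≤ 1 / t ^ 3 ∧
    2 * Real.exp 4 * (1 + Real.log t) ≤ t ^ 4 ∧ Real.exp 4 * (1 + t ^ 4) ≤ t ^ 5 := by
  filter_upwards [eventually_ge_atTop 2, eventually_ge_atTop (2 * Real.exp 4),
    (isLittleO_pow_exp_pos_mul_atTop 15 (by norm_num : (0 : ℝ) < 1 / 2)).def
      (by positivity : 0 < 1 / (16 * Real.exp 12))] with t h1 h2 h3
  have ht : 0 < t := by linarith
  have h1' : (1 : ℝ) ≤ t := by linarith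
  have h4 : 16 * Real.exp 12 * t ^ 15 ≤ Real.exp (t / 2) := by
    rw [Real.norm_of_nonneg (by positivity), Real.norm_of_nonneg (by positivity)] at h3
    calc 16 * Real.exp 12 * t ^ 15
        ≤ 16 * Real.exp 12 * (1 / (16 * Real.exp 12) * Real.exp (1 / 2 * t)) :=
          mul_le_mul_of_nonneg_left h3 (by positivity)
      _ = Real.exp (t / 2) := by
          rw [one_div_mul_eq_div, mul_div_cancel₀ _ (by positivity)]
          ring_nf
  have h5 : (1 : ℝ) ≤ Real.exp 12 := Real.one_le_exp (by norm_num)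
  have h6 : t ≤ t ^ 4 := le_self_pow₀ h1' (by norm_num)
  have h7 : (1 : ℝ) ≤ t ^ 4 := one_le_pow₀ h1'
  refine ⟨h1, ?_, ?_, ?_, ?_⟩
  · calc t ^ 3 ≤ t ^ 15 := pow_le_pow_right₀ h1' (by norm_num)
      _ ≤ 16 * Real.exp 12 * t ^ 15 := le_mul_of_one_le_left (by positivity) (by linarith)
      _ ≤ Real.exp (t / 2) := h4
      _ ≤ _ := Real.exp_le_exp.2 (by linarith)
  · have h8 : Real.exp (3 * Real.log (1 + t ^ 4)) ≤ 8 * t ^ 12 := by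
      rw [mul_comm, Real.exp_mul, Real.exp_log (by positivity)]
      calc (1 + t ^ 4) ^ (3 : ℝ) = (1 + t ^ 4) ^ 3 := by norm_cast
        _ ≤ (2 * t ^ 4) ^ 3 := pow_le_pow_left₀ (by positivity) (by linarith) 3
        _ = _ := by ring
    rw [le_div_iff₀ (by positivity), Real.exp_add, Real.exp_add, Real.exp_neg]
    have h9 : 0 < Real.exp (t / 2) := Real.exp_pos _
    calc 2 * ((Real.exp (t / 2))⁻¹ * (Real.exp 12 * Real.exp (3 * Real.log (1 + t ^ 4)))) * t ^ 3
        ≤ 2 * ((Real.exp (t / 2))⁻¹ * (Real.exp 12 * (8 * t ^ 12))) * t ^ 3 := by gcongr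
      _ = (16 * Real.exp 12 * t ^ 15) / Real.exp (t / 2) := by
          rw [div_eq_mul_inv]; ring
      _ ≤ 1 := (div_le_one h9).2 h4
  · have h8 := Real.log_le_sub_one_of_pos ht
    calc 2 * Real.exp 4 * (1 + Real.log t) ≤ t * t :=
          mul_le_mul h2 (by linarith) (by linarith [Real.log_nonneg h1']) ht.le
      _ = t ^ 2 := by ring
      _ ≤ t ^ 4 := pow_le_pow_right₀ h1' (by norm_num)
  · nlinarith [mul_le_mul_of_nonneg_right h2 (by linarith : 0 ≤ t ^ 4), Real.exp_pos 4]

/-- The regimes are separated by whether log log y ≤ 4 log H, that is, by comparing H with (log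
y)^(1/4); both may occur along one sequence, so the split is made for each k. -/
theorem eventually_sum_abs_le {ε δ : ℝ} (hε : 0 < ε) (hδ : 0 < δ) {y H X : ℕ → ℕ}
    (hy : Tendsto y atTop atTop) (hH : Tendsto H atTop atTop)
    (hXk : ∀ k, 1 < y k ∧ y k ≤ X k ∧ 1 < H k ∧ H k ≤ X k)
    (hlog : ∀ᶠ k in atTop, Real.log (H k) ^ (1 + ε) ≤ (y k : ℝ))
    (hcond : ∀ᶠ k in atTop,
      (1 + Real.log (Real.log (H k)) / Real.log (y k)) *
        (Real.log (H k) / Real.log (Real.log (H k))) ≤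
          (1 - δ) * (Real.log (X k) / Real.log (y k))) :
    ∀ᶠ k in atTop, 0 < M (H k) (y k) ∧
      ∑ n ∈ range (X k + 1), |roughSum (primesUpTo (y k)) (H k) n - H k * P (y k)| ≤
        20 * X k * √(M (H k) (y k)) := by
  set c : ℝ := 4 * Real.exp 4 with hc
  have hc0 : 0 < c := by positivity
  obtain ⟨δ', hδ'0, hδ'1, hδ'2⟩ : ∃ δ' : ℝ, 0 < δ' ∧ δ' ≤ δ ∧ δ' ≤ 1 / 2 :=
    ⟨min δ (1 / 2), by positivity, min_le_left _ _, min_le_right _ _⟩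
  -- `M_ge_exp` turns η into (4 + c) η, and eight times this must be at most δ'. The bound ε / (1 +
  -- ε) gives 1 / (1 + ε) ≤ 1 − η, so that log H ≤ y^(1−η).
  obtain ⟨η, hη0, hη1, hη2, hη3⟩ : ∃ η : ℝ, 0 < η ∧ η ≤ δ' / (8 * (4 + c)) ∧ η ≤ 1 / 4 ∧
      η ≤ ε / (1 + ε) :=
    ⟨min (δ' / (8 * (4 + c))) (min (1 / 4) (ε / (1 + ε))), by positivity, min_le_left _ _,
      (min_le_right _ _).trans (min_le_left _ _), (min_le_right _ _).trans (min_le_right _ _)⟩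
  rw [le_div_iff₀ (by positivity)] at hη1
  have hη' : 0 < (4 + c) * η := by positivity
  have hyR : Tendsto (fun k => (y k : ℝ)) atTop atTop := tendsto_natCast_atTop_atTop.comp hy
  have hly : Tendsto (fun k => Real.log (y k)) atTop atTop := Real.tendsto_log_atTop.comp hyR
  have hl : Tendsto (fun k => Real.log (H k)) atTop atTop :=
    Real.tendsto_log_atTop.comp (tendsto_natCast_atTop_atTop.comp hH)
  have hcond' : ∀ᶠ k in atTop,
      (1 + Real.log (Real.log (H k)) / Real.log (y k)) *
        (Real.log (H k) / Real.log (Real.log (H k))) ≤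
          (1 - δ') * (Real.log (X k) / Real.log (y k)) := by
    filter_upwards [hcond] with k hk
    refine hk.trans (mul_le_mul_of_nonneg_right (by linarith) ?_)
    exact div_nonneg (Real.log_natCast_nonneg _) (Real.log_natCast_nonneg _)
  -- The hypothesis bounds u below by log H / log log H, which tends to infinity with H.
  have hu : Tendsto (fun k => Real.log (X k) / Real.log (y k)) atTop atTop := by
    refine tendsto_atTop.2 fun A => ?_
    have hA : 0 < 1 / (|A| + 1) := by positivity
    filter_upwards [hcond', hl.eventually (eventually_log_le_mul hA),
      (Real.tendsto_log_atTop.comp hl).eventually_ge_atTop 1] with k h1 h2 h3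
    simp only [Function.comp] at h3
    have h4 : 0 ≤ Real.log (X k) / Real.log (y k) :=
      div_nonneg (Real.log_natCast_nonneg _) (Real.log_natCast_nonneg _)
    have h5 : |A| + 1 ≤ Real.log (H k) / Real.log (Real.log (H k)) := by
      rw [one_div_mul_eq_div, le_div_iff₀ (by positivity)] at h2
      rw [le_div_iff₀ (by linarith)]
      linarith
    have h6 : 0 ≤ Real.log (Real.log (H k)) / Real.log (y k) :=
      div_nonneg (by linarith) (Real.log_natCast_nonneg _)
    have h7 : 0 ≤ |A| := abs_nonneg A
    have h8 := le_abs_self A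
    nlinarith [mul_nonneg h6 (by linarith : 0 ≤ Real.log (H k) / Real.log (Real.log (H k))),
      mul_nonneg hδ'0.le h4]
  have ht : Tendsto (fun k => Real.log (y k) ^ (1 / 4 : ℝ)) atTop atTop :=
    (tendsto_rpow_atTop (by norm_num)).comp hly
  filter_upwards [hlog, hcond', hu.eventually (eventually_u_bounds hη'),
    hyR.eventually (eventually_y_bounds hη0 hη2), hl.eventually (eventually_l_bounds hη0 hc0 hη'),
    ht.eventually eventually_t_bounds, hly.eventually_ge_atTop 8]
    with k hk1 hk2 ⟨u1, u2, u3, u4⟩ ⟨y1, y2, y3⟩ ⟨l1, l2, l3, l4, l5, l6⟩ ⟨t1, t2, t3, t4, t5⟩ hy8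
  obtain ⟨hy1, hyX, hH1, hHX⟩ := hXk k
  have hly0 : 0 < Real.log (y k) := by linarith
  by_cases hreg : Real.log (Real.log (y k)) ≤ 4 * Real.log (H k)
  · have hl0 : 0 < Real.log (H k) := by linarith
    have hle : Real.log (H k) ≤ (y k : ℝ) ^ (1 - η) := by
      calc Real.log (H k) = (Real.log (H k) ^ (1 + ε)) ^ (1 / (1 + ε)) := by
            rw [← Real.rpow_mul hl0.le, mul_one_div_cancel (by positivity), Real.rpow_one]
        _ ≤ (y k : ℝ) ^ (1 / (1 + ε)) :=
            Real.rpow_le_rpow (Real.rpow_nonneg hl0.le _) hk1 (by positivity)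
        _ ≤ (y k : ℝ) ^ (1 - η) := by
            refine Real.rpow_le_rpow_of_exponent_le (by exact_mod_cast hy1.le) ?_
            have : 1 / (1 + ε) = 1 - ε / (1 + ε) := by field_simp; ring
            linarith
    have hM := M_ge_exp hη0 hη2 hy1 hH1 hc rfl y1 y2 hy8 l1 hle l4 (by linarith) l5 l6
    have hHP : 0 < (H k : ℝ) * P (y k) := mul_pos (by exact_mod_cast (by omega)) (P_pos _)
    refine ⟨lt_of_lt_of_le (by positivity) hM, ?_⟩
    have := sum_abs_le_of_long (u := Real.log (X k) / Real.log (y k)) hη' (by linarith) hδ'2 hy1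
      hHX (by omega) (by field_simp) hk2 hreg (by linarith) l1 l2 l3 u1 u2 u3 u4 y3 hM
    refine this.trans ?_
    gcongr
    norm_num
  · push Not at hreg
    -- Here t = (log y)^(1/4), and the failure of `hreg` says H < t.
    refine sum_abs_le_of_short t1 ?_ hH1 ?_ hyX hHX t2 t3 t4 t5
    · rw [← Real.rpow_mul_natCast hly0.le]
      norm_num
    · rw [← Real.log_le_log_iff (by positivity) (by positivity), Real.log_rpow hly0]
      linarith

end SiftedIntervals

open SiftedIntervals in
theorem mainTheorem3 :
    ∃ C : ℝ, 0 < C ∧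
      ∀ w : ℝ → ℝ, Filter.Tendsto w Filter.atTop Filter.atTop →
      ∀ ε δ : ℝ, 0 < ε → 0 < δ →
      ∀ y H X : ℕ → ℕ,
        Filter.Tendsto y Filter.atTop Filter.atTop →
        Filter.Tendsto H Filter.atTop Filter.atTop →
        Filter.Tendsto X Filter.atTop Filter.atTop →
        (∀ k, 1 < y k ∧ y k ≤ X k ∧ 1 < H k ∧ H k ≤ X k) →
        (∀ᶠ k in Filter.atTop, Real.log (H k) ^ (1 + ε) ≤ (y k : ℝ)) →
        (∀ᶠ k in Filter.atTop,
          (1 + Real.log (Real.log (H k)) / Real.log (y k)) *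
              (Real.log (H k) / Real.log (Real.log (H k))) ≤
            (1 - δ) * (Real.log (X k) / Real.log (y k))) →
        Filter.Tendsto
          (fun k => MeasureTheory.volume
              {x : ℝ | x ∈ Set.Icc (0 : ℝ) (X k) ∧
                C * (Real.sqrt (SiftedIntervals.M (H k) (y k)) * w x) <
                  |SiftedIntervals.roughCount (y k) (H k) x -
                    (H k : ℝ) * SiftedIntervals.P (y k)|} /
            (X k : ENNReal))
          Filter.atTop (nhds 0) := by
  refine ⟨1, one_pos, fun w hw ε δ hε hδ y H X hy hH hX hXk hlog hcond => ?_⟩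
  refine ENNReal.tendsto_nhds_zero.2 fun e he => ?_
  obtain ⟨r, hr0, hre⟩ := ENNReal.lt_iff_exists_nnreal_btwn.1 he
  have hr : 0 < (r : ℝ) := by exact_mod_cast hr0
  -- With w ≥ 40 / r the bad integers number at most 20 X r / 40 = r X / 2; the segment up to `max a
  -- 0` has length at most r X / 2 once X is large.
  obtain ⟨a, ha⟩ := Filter.eventually_atTop.1 (hw.eventually_ge_atTop (40 / (r : ℝ)))
  filter_upwards [eventually_sum_abs_le hε hδ hy hH hXk hlog hcond,
    (tendsto_natCast_atTop_atTop.comp hX).eventually_ge_atTop (2 * max a 0 / (r : ℝ))]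
    with k ⟨hM, hsum⟩ hXa
  simp only [Function.comp] at hXa
  rw [div_le_iff₀ hr] at hXa
  have hX0 : X k ≠ 0 := by have := hXk k; omega
  refine le_trans ?_ hre.le
  rw [ENNReal.div_le_iff (by exact_mod_cast hX0) (ENNReal.natCast_ne_top _)]
  simp only [one_mul]
  refine (volume_exceed_le (f := fun n => roughSum (primesUpTo (y k)) (H k) n - H k * P (y k))
    (Real.sqrt_pos.2 hM) (by positivity : 0 < 40 / (r : ℝ)) (le_max_right a 0)
    (fun x hx => ha x ((le_max_left a 0).trans hx))
    (fun x hx => by rw [roughCount_eq_roughSum _ _ hx]) hsum).trans ?_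
  rw [← ENNReal.ofReal_coe_nnreal, ← ENNReal.ofReal_natCast, ← ENNReal.ofReal_mul hr.le]
  refine ENNReal.ofReal_le_ofReal ?_
  have : 20 * (X k : ℝ) / (40 / (r : ℝ)) = r * X k / 2 := by field_simp; norm_num
  linarith
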